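/- Let $\Sigma$ be a finite alphabet and let $\Xi$ be a countably infinite set of variables, disjoint from $\Sigma$. A *pattern* is a word over $\Sigma\cup\Xi$. **FC-Datalog.** An *atom* is a pattern equation $x\doteq\alpha$, with $x\in\Xi$ and $\alpha$ a pattern in which $x$ does not occur, or a relation atom $R(y_1,\dots,y_{\mathrm{ar}(R)})$ with $y_i\in\Xi$. A *program* $P=(\mathfrak u,\mathcal R,\Phi)$ consists of a universe variable $\mathfrak u\in\Xi$, a finite set $\mathcal R$ of relation symbols with arities that contains an output symbol $\mathrm{Ans}$, and a finite set $\Phi$ of rules $R(x_1,\dots,x_{\mathrm{ar}(R)})\leftarrow\varphi_1,\dots,\varphi_m$ with $m\ge 1$, where the $\varphi_i$ are atoms and each $x_j$ occurs in some $\varphi_i$. A *$w$-substitution* for a rule maps variables to words, with $\mathfrak u\mapsto w$ and each variable of the body mapped to a factor of $w$. On input $w\in\Sigma^*$ all relations start empty; then, for every rule and every $w$-substitution $\theta$ under which all body atoms hold ($x\doteq\alpha$ holds if $\theta(x)=\theta(\alpha)$ is a factor of $w$; $R(\vec y)$ holds if $\theta(\vec y)$ is in the current relation $R$), the tuple $(\theta(x_1),\dots,\theta(x_{\mathrm{ar}(R)}))$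 is added to the relation of the head symbol, until all relations are stable. If $\mathrm{ar}(\mathrm{Ans})=0$, the program is *Boolean* and $\mathcal L(P)$ is the set of all $w\in\Sigma^*$ for which the final relation $\mathrm{Ans}$ contains the empty tuple. **Linear programs.** Write $R\leftarrow R'$ if some rule has head symbol $R$ and has $R'$ in its body; $R$ and $R'$ are *mutually recursive* if each is reachable from the other by one or more such steps. A program is *linear* if the body of every rule contains at most one atom whose symbol is mutually recursive with the head symbol. For such a rule $\rho$ with head $R(x_1,\dots,x_m)$ let $\mathsf{top}(\rho)=(x_1,\dots,x_m,\mathfrak u)$, and let $\mathsf{bottom}(\rho)$ be the tuple of variables of the body atom that is mutually recursive with the head (the empty tuple if there is none). **Determinism.** For $w\in\Sigma^*$ let $W_\rho$ be the set of pairs $(\theta(\mathsf{top}(\rho)),\theta(\mathsf{bottom}(\rho)))$ over all $w$-substitutions $\theta$ for $\rho$ under which all pattern equations of $\rho$ hold. A linear program is *locally deterministic* if, for every $w$, every $W_\rho$ is a partial function from top tuples to bottom tuples; it is *globally deterministic* if, for every $w$ and all distinct rules $\rho,\chi$ with the same head symbol, no top tuple occurs in both $W_\rho$ and $W_\chi$.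 **One letter lookahead.** A linear program is an *OLLA* program if in each rule $\rho$ every pattern equation has one of the following forms, with $x,x'\in\mathsf{top}(\rho)$, $y\in\mathsf{bottom}(\rho)$, $\mathsf a\in\Sigma\cup\{\varepsilon\}$, and $z\in\Xi$ a variable that is neither in $\mathsf{top}(\rho)$ nor in $\mathsf{bottom}(\rho)$ and occurs nowhere else in $\rho$: - $x\doteq\varepsilon$ or $x\doteq x'$; - $x\doteq y\mathsf a$ or $x\doteq\mathsf a y$; - $y\doteq x\mathsf a$ or $y\doteq\mathsf a x$; - $\mathfrak u\doteq x\mathsf a z$; - $\mathfrak u\doteq z\mathsf a x$; and if in each rule $\rho$ no variable of $\mathsf{top}(\rho)$ or $\mathsf{bottom}(\rho)$ occurs both in an equation in which a letter $\mathsf a\in\Sigma$ stands to the right of $x$ or $y$ (that is, $x\doteq y\mathsf a$, $y\doteq x\mathsf a$ or $\mathfrak u\doteq x\mathsf a z$) and in an equation in which a letter $\mathsf a\in\Sigma$ stands to the left of $x$ or $y$ (that is, $x\doteq\mathsf a y$, $y\doteq\mathsf a x$ or $\mathfrak u\doteq z\mathsf a x$). *DOLLA FC-Datalog* is the set of OLLA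 programs that are locally and globally deterministic. **Theorem.** DOLLA FC-Datalog captures $\mathsf{LOGSPACE}$: for every finite alphabet $\Sigma$, a language $L\subseteq\Sigma^*$ is decided by a deterministic Turing machine (with a read-only input tape) in work space $O(\log n)$ if and only if $L=\mathcal L(P)$ for some Boolean DOLLA FC-Datalog program $P$ over $\Sigma$. -/

import Mathlib

/-! # FC-Datalog over a finite alphabet, its deterministic one-letter-lookahead fragment, and LOGSPACE

Terminal symbols are the elements of a type `A`; the countably infinite set of variables is `ℕ`. -/

namespace FCDatalog

universe u v

/-! ## Syntax -/

/-- A pattern: a word over terminals (`Sum.inl a`) and variables (`Sum.inr x`). -/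
abbrev Pattern (A : Type u) := List (A ⊕ ℕ)

/-- The list of variable occurrences in a pattern. -/
def Pattern.vars {A : Type u} (α : Pattern A) : List ℕ := α.filterMap Sum.getRight?

/-- The image of a pattern under a substitution that maps every variable to a terminal word. -/
def Pattern.subst {A : Type u} (θ : ℕ → List A) (α : Pattern A) : List A :=
  α.flatMap (Sum.elim (fun a => [a]) θ)

/-- Atoms: pattern equations `x ≐ α` and relation atoms `R(y₁, …, yₙ)`. -/
inductive Atom (A : Type u) (S : Type v) : Type (max u v)
  | eqn (x : ℕ) (α : Pattern A)
  | rel (R : S) (ys : List ℕ)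

/-- The list of variable occurrences in an atom. -/
def Atom.vars {A : Type u} {S : Type v} : Atom A S → List ℕ
  | .eqn x α => x :: α.vars
  | .rel _ ys => ys

/-- A rule `R(x₁, …, xₙ) ← φ₁, …, φₘ`. -/
structure Rule (A : Type u) (S : Type v) : Type (max u v) where
  /-- the head relation symbol -/
  head : S
  /-- the tuple of variables in the head -/
  headVars : List ℕ
  /-- the atoms of the body -/
  body : List (Atom A S)

/-- The list of variable occurrences in the body of a rule. -/
def Rule.vars {A : Type u} {S : Type v} (ρ : Rule A S) : List ℕ := ρ.body.flatMap Atom.vars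

/-- An FC-Datalog program over the alphabet `A`. -/
structure Program (A : Type u) where
  /-- the universe variable -/
  univ : ℕ
  /-- the relation symbols -/
  Rel : Type
  finite_rel : Finite Rel
  /-- the arity of each relation symbol -/
  ar : Rel → ℕ
  /-- the output relation symbol -/
  ans : Rel
  /-- the rules -/
  rules : Set (Rule A Rel)
  finite_rules : rules.Finite
  body_ne_nil : ∀ ρ ∈ rules, ρ.body ≠ []
  length_headVars : ∀ ρ ∈ rules, ρ.headVars.length = ar ρ.head
  length_rel : ∀ ρ ∈ rules, ∀ R ys, Atom.rel R ys ∈ ρ.body → ys.length = ar R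
  headVars_subset : ∀ ρ ∈ rules, ∀ x ∈ ρ.headVars, x ∈ ρ.vars
  not_mem_eqn : ∀ ρ ∈ rules, ∀ x α, Atom.eqn x α ∈ ρ.body → x ∉ Pattern.vars α

namespace Program

variable {A : Type u} (P : Program A)

/-! ## Semantics -/

/-- An interpretation of all relation symbols by relations over words. -/
abbrev Interp := P.Rel → Set (List (List A))

/-- `(w, θ) ⊨ φ`, relative to an interpretation of the relation symbols; every value is required
to be a factor of `w`. -/
def Sat (w : List A) (θ : ℕ → List A) (I : P.Interp) : Atom A P.Rel → Prop
  | .eqn x α => θ x = α.subst θ ∧ θ x <:+: w ∧ α.subst θ <:+: w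
  | .rel R ys => ys.map θ ∈ I R ∧ ∀ y ∈ ys, θ y <:+: w

/-- `θ` is a `w`-substitution for the rule `ρ`: the universe variable is mapped to `w` and each
variable of the body is mapped to a factor of `w`. -/
def IsWSubst (ρ : Rule A P.Rel) (w : List A) (θ : ℕ → List A) : Prop :=
  θ P.univ = w ∧ ∀ x ∈ ρ.vars, θ x <:+: w

/-- One round of filling up the relations: apply every rule with every `w`-substitution. -/
def step (w : List A) (I : P.Interp) : P.Interp := fun R =>
  I R ∪ {t | ∃ ρ ∈ P.rules, ρ.head = R ∧ ∃ θ : ℕ → List A,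
    P.IsWSubst ρ w θ ∧ (∀ φ ∈ ρ.body, P.Sat w θ I φ) ∧ t = ρ.headVars.map θ}

/-- The relations after `n` rounds, starting with empty relations. -/
def stage (P : Program A) (w : List A) : ℕ → P.Interp
  | 0 => fun _ => ∅
  | n + 1 => P.step w (stage P w n)

/-- The relations after the process has stabilized. -/
def fixpoint (w : List A) : P.Interp := fun R => ⋃ n, P.stage w n R

/-- `⟦P⟧(w)`: the content of the output relation. -/
def result (w : List A) : Set (List (List A)) := P.fixpoint w P.ans

/-- A program is Boolean if its output relation has arity zero. -/
def IsBoolean : Prop := P.ar P.ans = 0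

/-- The language of a Boolean program: the words `w` with `⟦P⟧(w) = {()}`. -/
def language : Language A := {w | [] ∈ P.result w}

/-! ## Linear programs -/

/-- `R ← R'`: some rule has head symbol `R` and contains `R'` in its body. -/
def Uses (R R' : P.Rel) : Prop :=
  ∃ ρ ∈ P.rules, ρ.head = R ∧ ∃ ys, Atom.rel R' ys ∈ ρ.body

/-- Mutual recursion of two relation symbols. -/
def MutRec (R R' : P.Rel) : Prop :=
  Relation.TransGen P.Uses R R' ∧ Relation.TransGen P.Uses R' R

open Classical in
/-- The variable tuples of the body atoms whose symbol is mutually recursive with the head. -/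
noncomputable def recArgs (ρ : Rule A P.Rel) : List (List ℕ) :=
  ρ.body.filterMap fun φ =>
    match φ with
    | .eqn _ _ => none
    | .rel R ys => if P.MutRec ρ.head R then some ys else none

/-- Each rule has at most one body atom that is mutually recursive with its head. -/
def IsLinear : Prop := ∀ ρ ∈ P.rules, (P.recArgs ρ).length ≤ 1

/-! ## Determinism -/

/-- The top variables: the head variables and the universe variable. -/
def top (ρ : Rule A P.Rel) : List ℕ := ρ.headVars ++ [P.univ]

/-- The bottom variables: the variables of the (in a linear rule, unique) body atom that is
mutually recursive with the head; the empty tuple if there is no such atom. -/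
noncomputable def bottom (ρ : Rule A P.Rel) : List ℕ := (P.recArgs ρ).flatten

/-- `(w, θ) ⊨ pe(ρ)`: all pattern equations of `ρ` hold. -/
def SatEqns (w : List A) (θ : ℕ → List A) (ρ : Rule A P.Rel) : Prop :=
  ∀ x α, Atom.eqn x α ∈ ρ.body → θ x = α.subst θ ∧ θ x <:+: w ∧ α.subst θ <:+: w

/-- The relation `W_ρ` between top tuples and bottom tuples on the input word `w`. -/
def topBottom (w : List A) (ρ : Rule A P.Rel) (t b : List (List A)) : Prop :=
  ∃ θ : ℕ → List A, P.IsWSubst ρ w θ ∧ P.SatEqns w θ ρ ∧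
    t = (P.top ρ).map θ ∧ b = (P.bottom ρ).map θ

/-- Every `W_ρ` is a partial function, on every input word. -/
def IsLocallyDet : Prop :=
  ∀ w : List A, ∀ ρ ∈ P.rules, ∀ t b b', P.topBottom w ρ t b → P.topBottom w ρ t b' → b = b'

/-- On every input word, distinct rules with the same head symbol share no top tuple. -/
def IsGloballyDet : Prop :=
  ∀ w : List A, ∀ ρ ∈ P.rules, ∀ χ ∈ P.rules, ρ.head = χ.head → ρ ≠ χ →
    ¬ ∃ t b b', P.topBottom w ρ t b ∧ P.topBottom w χ t b'

/-! ## One letter lookahead -/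

/-- `z` is neither a top nor a bottom variable and occurs exactly once in the rule. -/
def IsFresh (ρ : Rule A P.Rel) (z : ℕ) : Prop :=
  z ∉ P.top ρ ∧ z ∉ P.bottom ρ ∧ ρ.vars.count z = 1

/-- The permitted equations that contain no letter. -/
inductive EpsEqn (ρ : Rule A P.Rel) : ℕ → Pattern A → Prop
  | empty (x : ℕ) : x ∈ P.top ρ → EpsEqn ρ x []
  | eqTop (x x' : ℕ) : x ∈ P.top ρ → x' ∈ P.top ρ → EpsEqn ρ x [.inr x']
  | del (x y : ℕ) : x ∈ P.top ρ → y ∈ P.bottom ρ → EpsEqn ρ x [.inr y]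
  | add (x y : ℕ) : x ∈ P.top ρ → y ∈ P.bottom ρ → EpsEqn ρ y [.inr x]
  | next (x z : ℕ) : x ∈ P.top ρ → P.IsFresh ρ z → EpsEqn ρ P.univ [.inr x, .inr z]
  | prev (x z : ℕ) : x ∈ P.top ρ → P.IsFresh ρ z → EpsEqn ρ P.univ [.inr z, .inr x]

/-- The permitted equations with a letter `a` to the right of the top or bottom variable. -/
inductive RightEqn (ρ : Rule A P.Rel) : ℕ → Pattern A → Prop
  | del (x y : ℕ) (a : A) : x ∈ P.top ρ → y ∈ P.bottom ρ → RightEqn ρ x [.inr y, .inl a]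
  | add (x y : ℕ) (a : A) : x ∈ P.top ρ → y ∈ P.bottom ρ → RightEqn ρ y [.inr x, .inl a]
  | next (x z : ℕ) (a : A) : x ∈ P.top ρ → P.IsFresh ρ z →
      RightEqn ρ P.univ [.inr x, .inl a, .inr z]

/-- The permitted equations with a letter `a` to the left of the top or bottom variable. -/
inductive LeftEqn (ρ : Rule A P.Rel) : ℕ → Pattern A → Prop
  | del (x y : ℕ) (a : A) : x ∈ P.top ρ → y ∈ P.bottom ρ → LeftEqn ρ x [.inl a, .inr y]
  | add (x y : ℕ) (a : A) : x ∈ P.top ρ → y ∈ P.bottom ρ → LeftEqn ρ y [.inl a, .inr x]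
  | prev (x z : ℕ) (a : A) : x ∈ P.top ρ → P.IsFresh ρ z →
      LeftEqn ρ P.univ [.inr z, .inl a, .inr x]

/-- All pattern equations of the rule have one of the permitted forms. -/
def IsOLLARule (ρ : Rule A P.Rel) : Prop :=
  ∀ x α, Atom.eqn x α ∈ ρ.body → P.EpsEqn ρ x α ∨ P.RightEqn ρ x α ∨ P.LeftEqn ρ x α

/-- The variable `v` occurs in a left and also in a right equation of `ρ`. -/
def MixesSides (ρ : Rule A P.Rel) (v : ℕ) : Prop :=
  (∃ x α, Atom.eqn x α ∈ ρ.body ∧ P.LeftEqn ρ x α ∧ (v = x ∨ v ∈ Pattern.vars α)) ∧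
  (∃ x α, Atom.eqn x α ∈ ρ.body ∧ P.RightEqn ρ x α ∧ (v = x ∨ v ∈ Pattern.vars α))

/-- OLLA programs: linear programs all of whose rules are OLLA rules in which no top or bottom
variable is used in both left and right equations. -/
def IsOLLA : Prop :=
  P.IsLinear ∧ (∀ ρ ∈ P.rules, P.IsOLLARule ρ) ∧
    ∀ ρ ∈ P.rules, ∀ v, v ∈ P.top ρ ∨ v ∈ P.bottom ρ → ¬ P.MixesSides ρ v

/-- DOLLA programs: locally and globally deterministic OLLA programs. -/
def IsDOLLA : Prop := P.IsOLLA ∧ P.IsLocallyDet ∧ P.IsGloballyDet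

end Program

/-- The fragment DOLLA FC-Datalog over the alphabet `A`. -/
def DOLLA (A : Type u) : Set (Program A) := {P | P.IsDOLLA}

/-- A fragment captures a class of languages if that class consists exactly of the languages
defined by the (Boolean) programs of the fragment. -/
def Captures {A : Type u} (F : Set (Program A)) (C : Set (Language A)) : Prop :=
  C = {L | ∃ P ∈ F, P.IsBoolean ∧ L = P.language}

end FCDatalog

/-! # Deterministic logarithmic space -/

namespace LogSpace

universe u

/-- Head moves. -/
inductive Move
  | left
  | stay
  | right

/-- The symbols on the input tape: endmarkers and letters. -/
inductive InSym (A : Type u) : Type u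
  | leftEnd
  | letter (a : A)
  | rightEnd

/-- A deterministic Turing machine with a read-only two-way input tape with endmarkers and
`k` read-write one-way infinite work tapes. A missing transition means that the machine halts. -/
structure Machine (A : Type u) where
  /-- the number of work tapes -/
  k : ℕ
  /-- the states -/
  Q : Type
  finite_Q : Finite Q
  /-- the work tape alphabet -/
  Γ : Type
  finite_Γ : Finite Γ
  blank : Γ
  start : Q
  accept : Set Q
  δ : Q → InSym A → (Fin k → Γ) → Option (Q × Move × (Fin k → Γ × Move))

namespace Machine

variable {A : Type u} (M : Machine A)

/-- A configuration: state, input head, work heads, work tapes. -/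
structure Config where
  state : M.Q
  inPos : ℕ
  workPos : Fin M.k → ℕ
  work : Fin M.k → ℕ → M.Γ

/-- The content of cell `p` of the input tape: the word occupies the cells `1, …, |w|`. -/
def inputAt (w : List A) : ℕ → InSym A
  | 0 => .leftEnd
  | p + 1 => match w[p]? with
    | some a => .letter a
    | none => .rightEnd

/-- Moving a head on a tape with a leftmost cell `0`. -/
def movePos : Move → ℕ → ℕ
  | .left, p => p - 1
  | .stay, p => p
  | .right, p => p + 1

/-- The initial configuration. -/
def init : M.Config where
  state := M.start
  inPos := 0
  workPos := fun _ => 0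
  work := fun _ _ => M.blank

/-- One step on input `w`; the input head does not leave the cells `0, …, |w| + 1`. -/
def step (w : List A) (c : M.Config) : Option M.Config :=
  (M.δ c.state (inputAt w c.inPos) (fun i => c.work i (c.workPos i))).map fun r =>
    { state := r.1
      inPos := min (movePos r.2.1 c.inPos) (w.length + 1)
      workPos := fun i => movePos (r.2.2 i).2 (c.workPos i)
      work := fun i => Function.update (c.work i) (c.workPos i) (r.2.2 i).1 }

/-- The machine halts on every input, and it accepts exactly the words of `L`. -/
def Decides (L : Language A) : Prop :=
  ∀ w : List A, ∃ c, StateTransition.Reaches (M.step w) M.init c ∧ M.step w c = none ∧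
    (c.state ∈ M.accept ↔ w ∈ L)

/-- On input `w` the machine visits at most the first `s` cells of each work tape. -/
def UsesSpace (w : List A) (s : ℕ) : Prop :=
  ∀ c, StateTransition.Reaches (M.step w) M.init c → ∀ i, c.workPos i < s

end Machine

/-- The languages over `A` that are decided by a deterministic Turing machine in space
`O(log n)`, where `n` is the length of the input. -/
def LOGSPACE (A : Type u) : Set (Language A) :=
  {L | ∃ M : Machine A, M.Decides L ∧
    ∃ c : ℕ, ∀ w : List A, M.UsesSpace w (c * (Nat.log 2 w.length + 1))}

end LogSpace

set_option linter.unusedSimpArgs false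
set_option linter.unusedSectionVars false


/-! # Register machines and structured programs -/

namespace RegMachine

open Relation StateTransition

universe u v

-- Both inclusions pass through register machines whose registers hold numbers at most `|w|`, one
-- register being the position of the input head.
--
-- From `LOGSPACE` to DOLLA. A register with value `v` is represented by the prefix of `w` of length
-- `v`. Increment, decrement, the tests for `0` and for `|w|`, and reading the next letter then
-- become equations that compare words up to one letter on the right. A configuration is a tuple of
-- prefixes in the relation named by its label, and each rule derives a configuration from its
-- successor. Hence a configuration is derivable exactly when its run accepts (`mem_language`). The
-- current values determine which rule applies and what the new values are, which gives global and
-- local determinism (`Key.unique`, `IsRule.isLocallyDet_aux`). Letters occur on the right only, so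
-- sides are never mixed. Rules that can never fire make all labels mutually recursive, because the
-- permitted equations relate top variables to variables of a recursive atom. It remains to run a
-- logspace machine on registers: a work tape is two stacks around the head, a stack is a number,
-- and a number below a fixed power of `|w| + 1` is a fixed number of registers (`pow_log_le`,
-- `Sim.nruns_stepCmd`).
--
-- From DOLLA to `LOGSPACE`. In a linear program that is locally and globally deterministic, a fact
-- determines the only rule with a recursive atom that can derive it, and also the recursive fact
-- used. Within one class of mutually recursive symbols, the search for a derivation is thus a walk
-- without branching (`StepOf.unique`). The remaining atoms belong to lower classes, decided
-- beforehand by well-founded recursion (`decidable`). So it suffices that the predicates on factors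
-- of `w` decided by register programs are closed under first-order operations and deterministic
-- reachability. Factors are pairs of positions; quantifiers are loops over positions; reachability
-- iterates the step as often as there are tuples, after which a repetition would have occurred
-- (`LD.ex`, `LD.reach`, `LW.reach`). These programs never increment a full register other than the
-- input head. A Turing machine can therefore keep the registers in binary, within logarithmic
-- space, although it cannot compare a work tape with `|w|` directly (`mem_logspace`).
--
-- In both directions the empty word is answered separately, since with `|w| = 0` a register carries
-- no information.

/-- Instructions of a register machine with labels `Lb`. The registers are `some i` for `i : κ`
and the position `none` of the input head. -/
inductive Instr (A : Type u) (κ : Type) (Lb : Type v) : Type (max u v)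
  | goto (ℓ : Lb)
  | inc (i : Option κ) (ℓ ℓ' : Lb)
  | dec (i : Option κ) (ℓ ℓ' : Lb)
  | read (f : Option A → Lb)
  | halt (b : Bool)

/-- Register contents. -/
abbrev Regs (κ : Type) := Option κ → ℕ

variable {A : Type u} {κ : Type} {Lb : Type v}

namespace Instr

/-- Executing an instruction on input `w`. All registers are bounded by `|w|`. Incrementing a full
register is a jump to the second label; in the strict semantics the machine is stuck unless the
register is the input head. -/
def exec [DecidableEq κ] (strict : Bool) (w : List A) (r : Regs κ) :
    Instr A κ Lb → Option (Lb × Regs κ)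
  | goto ℓ => some (ℓ, r)
  | inc i ℓ ℓ' => if r i < w.length then some (ℓ, Function.update r i (r i + 1)) else
      if strict = true ∧ i ≠ none then none else some (ℓ', r)
  | dec i ℓ ℓ' => if r i = 0 then some (ℓ', r) else some (ℓ, Function.update r i (r i - 1))
  | read f => some (f w[r none]?, r)
  | halt _ => none

/-- Renaming of labels. -/
def map {Lb' : Type*} (g : Lb → Lb') : Instr A κ Lb → Instr A κ Lb'
  | goto ℓ => goto (g ℓ)
  | inc i ℓ ℓ' => inc i (g ℓ) (g ℓ')
  | dec i ℓ ℓ' => dec i (g ℓ) (g ℓ')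
  | read f => read (g ∘ f)
  | halt b => halt b

/-- All target labels belong to a set. -/
def Targets (S : Set Lb) : Instr A κ Lb → Prop
  | goto ℓ => ℓ ∈ S
  | inc _ ℓ ℓ' => ℓ ∈ S ∧ ℓ' ∈ S
  | dec _ ℓ ℓ' => ℓ ∈ S ∧ ℓ' ∈ S
  | read f => ∀ o, f o ∈ S
  | halt _ => True

theorem exec_map [DecidableEq κ] {Lb' : Type*} (g : Lb → Lb') (strict : Bool) (w : List A)
    (r : Regs κ) (ins : Instr A κ Lb) :
    (ins.map g).exec strict w r = (ins.exec strict w r).map (Prod.map g id) := by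
  cases ins <;> simp only [map, exec] <;> (try split_ifs) <;> simp

theorem exists_map_eq {Lb' : Type*} (g : Lb' → Lb) {ins : Instr A κ Lb}
    (h : ins.Targets (Set.range g)) : ∃ ins' : Instr A κ Lb', ins'.map g = ins := by
  cases ins with
  | goto ℓ => obtain ⟨x, rfl⟩ := h; exact ⟨goto x, rfl⟩
  | inc i ℓ ℓ' => obtain ⟨⟨x, rfl⟩, ⟨y, rfl⟩⟩ := h; exact ⟨inc i x y, rfl⟩
  | dec i ℓ ℓ' => obtain ⟨⟨x, rfl⟩, ⟨y, rfl⟩⟩ := h; exact ⟨dec i x y, rfl⟩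
  | read f => choose k hk using h; exact ⟨read k, by simp only [map]; congr; funext o; exact hk o⟩
  | halt b => exact ⟨halt b, rfl⟩

end Instr

/-- One step of the machine with the given instruction table. -/
def step [DecidableEq κ] (prog : Lb → Instr A κ Lb) (strict : Bool) (w : List A)
    (c : Lb × Regs κ) : Option (Lb × Regs κ) := (prog c.1).exec strict w c.2

/-- The machine halts, with the given answer. -/
def Answers [DecidableEq κ] (prog : Lb → Instr A κ Lb) (strict : Bool) (w : List A)
    (c : Lb × Regs κ) (p : Prop) : Prop :=
  ∃ c' b, Reaches (step prog strict w) c c' ∧ prog c'.1 = .halt b ∧ (b = true ↔ p)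

/-- The labels of structured programs are stacks of commands, an infinite type, whereas Turing
machines and Datalog programs need finitely many. A finite set closed under jumps suffices:
instructions are pulled back along its enumeration, and execution commutes with renaming. -/
theorem exists_finite_table [DecidableEq κ] (prog : Lb → Instr A κ Lb) (S : Set Lb) (hS : S.Finite)
    (hcl : ∀ ℓ ∈ S, (prog ℓ).Targets S) (start : Lb) (hst : start ∈ S) :
    ∃ (N : ℕ) (prog' : Fin N → Instr A κ (Fin N)) (start' : Fin N), ∀ strict w r p,
      Answers prog strict w (start, r) p → Answers prog' strict w (start', r) p := by
  have : Finite S := hS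
  obtain ⟨N, ⟨e⟩⟩ := Finite.exists_equiv_fin S
  let g : Fin N → Lb := fun i => (e.symm i : Lb)
  have hg : Set.range g = S := by
    ext x
    constructor
    · rintro ⟨i, rfl⟩
      exact (e.symm i).2
    · intro hx
      exact ⟨e ⟨x, hx⟩, by simp [g]⟩
  have key : ∀ i, ∃ ins' : Instr A κ (Fin N), ins'.map g = prog (g i) := fun i =>
    Instr.exists_map_eq g (by rw [hg]; exact hcl _ (e.symm i).2)
  choose prog' hprog' using key
  obtain ⟨s', hs'⟩ : start ∈ Set.range g := hg ▸ hst
  refine ⟨N, prog', s', fun strict w r p => ?_⟩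
  rintro ⟨c', b, hr, hb, hp⟩
  have hstep : ∀ c, step prog strict w (Prod.map g id c) =
      (step prog' strict w c).map (Prod.map g id) := by
    intro c
    simp only [step, Prod.map_fst, Prod.map_snd, id, ← hprog', Instr.exec_map]
  have lift : ∃ d, Prod.map g id d = c' ∧ Reaches (step prog' strict w) (s', r) d := by
    clear hb hp
    induction hr with
    | refl => exact ⟨(s', r), by simp [hs'], ReflTransGen.refl⟩
    | tail _ h ih =>
      obtain ⟨d, rfl, hd⟩ := ih
      rw [hstep, Option.mem_def, Option.map_eq_some_iff] at h
      obtain ⟨d', hd', rfl⟩ := h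
      exact ⟨d', rfl, hd.tail hd'⟩
  obtain ⟨d, rfl, hd⟩ := lift
  refine ⟨d, b, hd, ?_, hp⟩
  simp only [Prod.map_fst, ← hprog'] at hb
  cases h : prog' d.1 <;> simp [h, Instr.map] at hb ⊢
  exact hb

-- Structured commands and their compilation to instruction tables.

/-- Structured programs over the registers `Option κ` with a finite memory `F`. -/
inductive Cmd (A : Type u) (F κ : Type) : Type u
  | assign (g : F → F)
  | read (g : Option A → F → F)
  | seq (a b : Cmd A F κ)
  | ite (p : F → Bool) (a b : Cmd A F κ)
  | inc (i : Option κ) (a b : Cmd A F κ)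
  | dec (i : Option κ) (a b : Cmd A F κ)
  | fill (i : Option κ) (a : Cmd A F κ)
  | drain (i : Option κ) (a : Cmd A F κ)
  | loop (p : F → Bool) (a : Cmd A F κ)

namespace Cmd

variable {F : Type}

/-- The instruction table for structured programs: a label consists of the list of the programs
that remain to be executed and the content of the finite memory. -/
def table (acc : F → Bool) : List (Cmd A F κ) × F → Instr A κ (List (Cmd A F κ) × F)
  | ([], f) => .halt (acc f)
  | (assign g :: K, f) => .goto (K, g f)
  | (read g :: K, f) => .read fun o => (K, g o f)
  | (seq a b :: K, f) => .goto (a :: b :: K, f)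
  | (ite p a b :: K, f) => .goto (bif p f then a :: K else b :: K, f)
  | (inc i a b :: K, f) => .inc i (a :: K, f) (b :: K, f)
  | (dec i a b :: K, f) => .dec i (a :: K, f) (b :: K, f)
  | (fill i a :: K, f) => .inc i (a :: fill i a :: K, f) (K, f)
  | (drain i a :: K, f) => .dec i (a :: drain i a :: K, f) (K, f)
  | (loop p a :: K, f) => .goto (bif p f then a :: loop p a :: K else K, f)

/-- The stacks that occur during the execution of a program on top of the stack `K`. -/
def conts : Cmd A F κ → List (Cmd A F κ) → Set (List (Cmd A F κ))
  | assign g, K => {assign g :: K}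
  | read g, K => {read g :: K}
  | seq a b, K => {seq a b :: K} ∪ conts a (b :: K) ∪ conts b K
  | ite p a b, K => {ite p a b :: K} ∪ conts a K ∪ conts b K
  | inc i a b, K => {inc i a b :: K} ∪ conts a K ∪ conts b K
  | dec i a b, K => {dec i a b :: K} ∪ conts a K ∪ conts b K
  | fill i a, K => {fill i a :: K} ∪ conts a (fill i a :: K)
  | drain i a, K => {drain i a :: K} ∪ conts a (drain i a :: K)
  | loop p a, K => {loop p a :: K} ∪ conts a (loop p a :: K)

/-- A loop puts itself back under its body, so the body always returns to a stack already listed.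
Control is therefore finite even though the data make loops run arbitrarily long. -/
theorem finite_conts (c : Cmd A F κ) (K : List (Cmd A F κ)) : (c.conts K).Finite := by
  induction c generalizing K <;> simp_all [conts]

theorem mem_conts (c : Cmd A F κ) (K : List (Cmd A F κ)) : c :: K ∈ c.conts K := by
  cases c <;> simp [conts]

theorem _root_.RegMachine.Instr.Targets.mono {S T : Set Lb} (h : S ⊆ T) {ins : Instr A κ Lb}
    (hi : ins.Targets S) : ins.Targets T := by
  cases ins
  · exact h hi
  · exact ⟨h hi.1, h hi.2⟩
  · exact ⟨h hi.1, h hi.2⟩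
  · exact fun o => h (hi o)
  · trivial

/-- Closure of the listed stacks under jumps. The inserted stack `K` is the exit, where the command
itself is finished. -/
theorem targets_table (acc : F → Bool) (c : Cmd A F κ) (K : List (Cmd A F κ)) :
    ∀ K' ∈ c.conts K, ∀ f, (table acc (K', f)).Targets {x | x.1 ∈ insert K (c.conts K)} := by
  induction c generalizing K with
  | assign g => rintro _ rfl f; simp [table, Instr.Targets]
  | read g => rintro _ rfl f; simp [table, Instr.Targets]
  | seq a b iha ihb =>
    rintro K' ((rfl | h) | h) f
    · simp [table, Instr.Targets, conts, mem_conts]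
    · refine (iha (b :: K) K' h f).mono ?_
      rintro x (hx | hx)
      · simp [hx, conts, mem_conts]
      · simp [hx, conts]
    · refine (ihb K K' h f).mono ?_
      rintro x (hx | hx) <;> simp [hx, conts]
  | ite p a b iha ihb =>
    rintro K' ((rfl | h) | h) f
    · cases h : p f <;> simp [h, table, Instr.Targets, conts, mem_conts]
    · refine (iha K K' h f).mono ?_
      rintro x (hx | hx) <;> simp [hx, conts]
    · refine (ihb K K' h f).mono ?_
      rintro x (hx | hx) <;> simp [hx, conts]
  | inc i a b iha ihb =>
    rintro K' ((rfl | h) | h) f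
    · simp [table, Instr.Targets, conts, mem_conts]
    · refine (iha K K' h f).mono ?_
      rintro x (hx | hx) <;> simp [hx, conts]
    · refine (ihb K K' h f).mono ?_
      rintro x (hx | hx) <;> simp [hx, conts]
  | dec i a b iha ihb =>
    rintro K' ((rfl | h) | h) f
    · simp [table, Instr.Targets, conts, mem_conts]
    · refine (iha K K' h f).mono ?_
      rintro x (hx | hx) <;> simp [hx, conts]
    · refine (ihb K K' h f).mono ?_
      rintro x (hx | hx) <;> simp [hx, conts]
  | fill i a iha =>
    rintro K' (rfl | h) f
    · simp [table, Instr.Targets, conts, mem_conts]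
    · refine (iha _ K' h f).mono ?_
      rintro x (hx | hx) <;> simp [hx, conts]
  | drain i a iha =>
    rintro K' (rfl | h) f
    · simp [table, Instr.Targets, conts, mem_conts]
    · refine (iha _ K' h f).mono ?_
      rintro x (hx | hx) <;> simp [hx, conts]
  | loop p a iha =>
    rintro K' (rfl | h) f
    · cases h : p f <;> simp [h, table, Instr.Targets, conts, mem_conts]
    · refine (iha _ K' h f).mono ?_
      rintro x (hx | hx) <;> simp [hx, conts]

/-- The program `c`, run on input `w`, takes the memory from `σ` to `τ`. -/
def Runs [DecidableEq κ] (strict : Bool) (w : List A) (c : Cmd A F κ) (σ τ : F × Regs κ) : Prop :=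
  ∀ (acc : F → Bool) (K : List (Cmd A F κ)),
    Reaches (step (table acc) strict w) ((c :: K, σ.1), σ.2) ((K, τ.1), τ.2)

/-- The interface to both machine models: one finite table, independent of the input, works for
every word and every initial content of the registers. -/
theorem exists_table [DecidableEq κ] [Finite F] (c : Cmd A F κ) (acc : F → Bool) (f : F) :
    ∃ (N : ℕ) (prog : Fin N → Instr A κ (Fin N)) (start : Fin N), ∀ strict w r τ p,
      c.Runs strict w (f, r) τ → (acc τ.1 = true ↔ p) →
        Answers prog strict w (start, r) p := by
  obtain ⟨N, prog, start, h⟩ := exists_finite_table (table acc (A := A) (κ := κ))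
    ((insert [] (c.conts [])) ×ˢ Set.univ)
    (((c.finite_conts []).insert []).prod Set.finite_univ)
    (by
      rintro ⟨K, f⟩ ⟨hK | hK, -⟩
      · change K = [] at hK
        subst hK
        trivial
      · refine (targets_table acc c [] K hK f).mono ?_
        rintro x hx
        exact ⟨hx, trivial⟩)
    ([c], f) (by simp [mem_conts])
  exact ⟨N, prog, start, fun strict w r τ p hr hp =>
    h strict w r p ⟨(([], τ.1), τ.2), acc τ.1, hr acc [], rfl, hp⟩⟩

-- Execution rules for the commands.

section Rules

variable [DecidableEq κ] {strict : Bool} {w : List A} {a b : Cmd A F κ} {σ τ υ : F × Regs κ}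
  {i : Option κ} {p : F → Bool}

theorem Runs.assign (g : F → F) : (assign g).Runs strict w σ (g σ.1, σ.2) :=
  fun _ _ => ReflTransGen.single rfl

theorem Runs.read (g : Option A → F → F) :
    (read g).Runs strict w σ (g w[σ.2 none]? σ.1, σ.2) :=
  fun _ _ => ReflTransGen.single rfl

theorem Runs.seq (ha : a.Runs strict w σ τ) (hb : b.Runs strict w τ υ) :
    (seq a b).Runs strict w σ υ :=
  fun acc K => ReflTransGen.head rfl ((ha acc _).trans (hb acc K))

theorem Runs.ite_true (hp : p σ.1 = true) (h : a.Runs strict w σ τ) :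
    (ite p a b).Runs strict w σ τ := fun acc K =>
  ReflTransGen.head (b := ((a :: K, σ.1), σ.2)) (by simp [step, table, hp, Instr.exec]) (h acc K)

theorem Runs.ite_false (hp : p σ.1 = false) (h : b.Runs strict w σ τ) :
    (ite p a b).Runs strict w σ τ := fun acc K =>
  ReflTransGen.head (b := ((b :: K, σ.1), σ.2)) (by simp [step, table, hp, Instr.exec]) (h acc K)

theorem Runs.inc_lt (hi : σ.2 i < w.length)
    (h : a.Runs strict w (σ.1, Function.update σ.2 i (σ.2 i + 1)) τ) :
    (inc i a b).Runs strict w σ τ := fun acc K =>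
  ReflTransGen.head (b := ((a :: K, σ.1), Function.update σ.2 i (σ.2 i + 1)))
    (by simp [step, table, hi, Instr.exec]) (h acc K)

/-- The condition `hs` is needed since a strict machine is stuck at a full register that is not the
input head. -/
theorem Runs.inc_ge (hs : strict = false ∨ i = none) (hi : w.length ≤ σ.2 i)
    (h : b.Runs strict w σ τ) : (inc i a b).Runs strict w σ τ := fun acc K =>
  ReflTransGen.head (b := ((b :: K, σ.1), σ.2))
    (by rcases hs with hs | hs <;> simp [step, table, hi.not_gt, hs, Instr.exec]; simp_all)
    (h acc K)

theorem Runs.dec_pos (hi : σ.2 i ≠ 0)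
    (h : a.Runs strict w (σ.1, Function.update σ.2 i (σ.2 i - 1)) τ) :
    (dec i a b).Runs strict w σ τ := fun acc K =>
  ReflTransGen.head (b := ((a :: K, σ.1), Function.update σ.2 i (σ.2 i - 1)))
    (by simp [step, table, hi, Instr.exec]) (h acc K)

theorem Runs.dec_zero (hi : σ.2 i = 0)
    (h : b.Runs strict w σ τ) : (dec i a b).Runs strict w σ τ := fun acc K =>
  ReflTransGen.head (b := ((b :: K, σ.1), σ.2))
    (by simp [step, table, hi, Instr.exec]) (h acc K)

theorem Runs.fill_lt (hi : σ.2 i < w.length)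
    (h : a.Runs strict w (σ.1, Function.update σ.2 i (σ.2 i + 1)) τ)
    (h' : (fill i a).Runs strict w τ υ) :
    (fill i a).Runs strict w σ υ := fun acc K =>
  ReflTransGen.head (b := ((a :: fill i a :: K, σ.1), Function.update σ.2 i (σ.2 i + 1)))
    (by simp [step, table, hi, Instr.exec]) ((h acc _).trans (h' acc K))

theorem Runs.fill_ge (hs : strict = false ∨ i = none) (hi : w.length ≤ σ.2 i) :
    (fill i a).Runs strict w σ σ := fun acc K =>
  ReflTransGen.single
    (by rcases hs with hs | hs <;> simp [step, table, hi.not_gt, hs, Instr.exec]; simp_all)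

theorem Runs.drain_pos (hi : σ.2 i ≠ 0)
    (h : a.Runs strict w (σ.1, Function.update σ.2 i (σ.2 i - 1)) τ)
    (h' : (drain i a).Runs strict w τ υ) :
    (drain i a).Runs strict w σ υ := fun acc K =>
  ReflTransGen.head (b := ((a :: drain i a :: K, σ.1), Function.update σ.2 i (σ.2 i - 1)))
    (by simp [step, table, hi, Instr.exec]) ((h acc _).trans (h' acc K))

theorem Runs.drain_zero (hi : σ.2 i = 0) : (drain i a).Runs strict w σ σ := fun acc K =>
  ReflTransGen.single (by simp [step, table, hi, Instr.exec])

theorem Runs.loop_true (hp : p σ.1 = true) (h : a.Runs strict w σ τ)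
    (h' : (loop p a).Runs strict w τ υ) : (loop p a).Runs strict w σ υ := fun acc K =>
  ReflTransGen.head (b := ((a :: loop p a :: K, σ.1), σ.2))
    (by simp [step, table, hp, Instr.exec]) ((h acc _).trans (h' acc K))

theorem Runs.loop_false (hp : p σ.1 = false) : (loop p a).Runs strict w σ σ := fun acc K =>
  ReflTransGen.single (by simp [step, table, hp, Instr.exec])

end Rules

end Cmd

end RegMachine


/-! # From register machines to DOLLA programs -/

-- General facts on the fixpoint semantics and on recursive atoms.

namespace FCDatalog.Program

universe u

variable {A : Type u} (P : Program A)

theorem stage_mono (w : List A) {m n : ℕ} (h : m ≤ n) (R : P.Rel) :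
    P.stage w m R ⊆ P.stage w n R := by
  induction h with
  | refl => exact subset_rfl
  | step _ ih => exact ih.trans Set.subset_union_left

theorem Sat.mono {P : Program A} {w : List A} {θ : ℕ → List A} {I J : P.Interp}
    (h : ∀ R, I R ⊆ J R) {φ : Atom A P.Rel} (hφ : P.Sat w θ I φ) : P.Sat w θ J φ := by
  cases φ
  · exact hφ
  · exact ⟨h _ hφ.1, hφ.2⟩

/-- Stages increase and a body is finite, so the maximum of the stages at which the single atoms
become true serves for all of them. -/
theorem exists_stage_sat (w : List A) (θ : ℕ → List A) (l : List (Atom A P.Rel))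
    (h : ∀ φ ∈ l, P.Sat w θ (P.fixpoint w) φ) : ∃ n, ∀ φ ∈ l, P.Sat w θ (P.stage w n) φ := by
  induction l with
  | nil => exact ⟨0, by simp⟩
  | cons φ l ih =>
    obtain ⟨n, hn⟩ := ih fun ψ hψ => h ψ (List.mem_cons_of_mem _ hψ)
    obtain ⟨m, hm⟩ : ∃ m, P.Sat w θ (P.stage w m) φ := by
      have hφ := h φ List.mem_cons_self
      cases φ with
      | eqn x α => exact ⟨0, hφ⟩
      | rel R ys =>
        obtain ⟨m, hm⟩ := Set.mem_iUnion.1 hφ.1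
        exact ⟨m, hm, hφ.2⟩
    refine ⟨max m n, fun ψ hψ => ?_⟩
    rcases List.mem_cons.1 hψ with rfl | hψ
    · exact hm.mono fun R => P.stage_mono w (le_max_left _ _) R
    · exact (hn ψ hψ).mono fun R => P.stage_mono w (le_max_right _ _) R

theorem mem_fixpoint_of_rule {w : List A} {ρ : Rule A P.Rel} (hρ : ρ ∈ P.rules) {θ : ℕ → List A}
    (hθ : P.IsWSubst ρ w θ) (h : ∀ φ ∈ ρ.body, P.Sat w θ (P.fixpoint w) φ) :
    ρ.headVars.map θ ∈ P.fixpoint w ρ.head := by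
  obtain ⟨n, hn⟩ := P.exists_stage_sat w θ _ h
  exact Set.mem_iUnion.2 ⟨n + 1, Or.inr ⟨ρ, hρ, rfl, θ, hθ, hn, rfl⟩⟩

/-- Induction on the stage. The body is evaluated in the tuples that lie in the fixpoint and satisfy
`Q`, so both facts are available for each body atom. -/
theorem fixpoint_induction {w : List A} {Q : P.Rel → List (List A) → Prop}
    (h : ∀ ρ ∈ P.rules, ∀ θ, P.IsWSubst ρ w θ →
      (∀ φ ∈ ρ.body, P.Sat w θ (fun R => {t | t ∈ P.fixpoint w R ∧ Q R t}) φ) →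
      Q ρ.head (ρ.headVars.map θ))
    {R : P.Rel} {t : List (List A)} (ht : t ∈ P.fixpoint w R) : Q R t := by
  obtain ⟨n, hn⟩ := Set.mem_iUnion.1 ht
  clear ht
  induction n generalizing R t with
  | zero => exact hn.elim
  | succ n ih =>
    rcases hn with hn | ⟨ρ, hρ, rfl, θ, hθ, hb, rfl⟩
    · exact ih hn
    · exact h ρ hρ θ hθ fun φ hφ =>
        (hb φ hφ).mono fun _ _ ht => Set.mem_ofPred.2 ⟨Set.mem_iUnion.2 ⟨n, ht⟩, ih ht⟩

theorem exists_rule_of_mem_fixpoint {w : List A} {R : P.Rel} {t : List (List A)}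
    (ht : t ∈ P.fixpoint w R) : ∃ ρ ∈ P.rules, ρ.head = R ∧ ∃ θ, P.IsWSubst ρ w θ ∧
      (∀ φ ∈ ρ.body, P.Sat w θ (P.fixpoint w) φ) ∧ t = ρ.headVars.map θ :=
  P.fixpoint_induction (Q := fun R t => ∃ ρ ∈ P.rules, ρ.head = R ∧ ∃ θ, P.IsWSubst ρ w θ ∧
      (∀ φ ∈ ρ.body, P.Sat w θ (P.fixpoint w) φ) ∧ t = ρ.headVars.map θ)
    (fun ρ hρ θ hθ h => ⟨ρ, hρ, rfl, θ, hθ, fun φ hφ => (h φ hφ).mono fun _ _ ht => ht.1, rfl⟩) ht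

theorem mem_recArgs {ρ : Rule A P.Rel} {ys : List ℕ} :
    ys ∈ P.recArgs ρ ↔ ∃ R, Atom.rel R ys ∈ ρ.body ∧ P.MutRec ρ.head R := by
  classical
  simp only [recArgs, List.mem_filterMap]
  constructor
  · rintro ⟨φ, hφ, h⟩
    cases φ with
    | eqn x α => simp at h
    | rel R zs =>
      simp only [Option.ite_none_right_eq_some, Option.some.injEq] at h
      obtain ⟨hR, rfl⟩ := h
      exact ⟨R, hφ, hR⟩
  · rintro ⟨R, hR, hm⟩
    exact ⟨_, hR, by simp [hm]⟩

theorem mem_bottom {ρ : Rule A P.Rel} {y : ℕ} :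
    y ∈ P.bottom ρ ↔ ∃ R ys, Atom.rel R ys ∈ ρ.body ∧ P.MutRec ρ.head R ∧ y ∈ ys := by
  simp only [bottom, List.mem_flatten, mem_recArgs]
  constructor
  · rintro ⟨ys, ⟨R, h, h'⟩, hy⟩
    exact ⟨R, ys, h, h', hy⟩
  · rintro ⟨R, ys, h, h', hy⟩
    exact ⟨ys, ⟨R, h, h'⟩, hy⟩

/-- An atom is a relation atom. -/
def _root_.FCDatalog.Atom.IsRel {S : Type*} : Atom A S → Bool
  | .eqn _ _ => false
  | .rel _ _ => true

/-- Linearity follows from counting relation atoms, without knowing which symbols are mutually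
recursive. -/
theorem length_recArgs_le (ρ : Rule A P.Rel) :
    (P.recArgs ρ).length ≤ (ρ.body.filter Atom.IsRel).length := by
  unfold Program.recArgs
  induction ρ.body with
  | nil => exact le_rfl
  | cons φ l ih =>
    rw [List.filterMap_cons]
    cases φ with
    | eqn x α => simpa [Atom.IsRel] using ih
    | rel R ys =>
      rw [show (Atom.rel R ys :: l).filter Atom.IsRel = Atom.rel R ys :: l.filter Atom.IsRel from rfl]
      split <;> simp only [List.length_cons] <;> lia

end FCDatalog.Program

-- The rules for a register machine and the verification of the DOLLA conditions.

namespace RegMachine.Datalog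

open FCDatalog Relation StateTransition

universe u

variable {A : Type u} {κ Lb : Type} {r : ℕ} (e : Option κ ≃ Fin r)

/-- The tuple of the values of a function on the registers. -/
def tup {β : Type*} (f : Option κ → β) : List β := (List.finRange r).map (f ∘ e.symm)

theorem map_tup {β γ : Type*} (f : Option κ → β) (g : β → γ) :
    (tup e f).map g = tup e (g ∘ f) := by simp [tup, Function.comp_assoc]

theorem tup_inj {β : Type*} {f g : Option κ → β} : tup e f = tup e g ↔ f = g := by
  refine ⟨fun h => ?_, fun h => h ▸ rfl⟩
  have h' : ∀ i, f (e.symm i) = g (e.symm i) := fun i =>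
    List.map_inj_left.1 h i (List.mem_finRange i)
  funext i
  simpa using h' (e i)

theorem mem_tup {β : Type*} {f : Option κ → β} {b : β} : b ∈ tup e f ↔ ∃ i, f i = b := by
  simp only [tup, List.mem_map, List.mem_finRange, true_and, Function.comp_apply]
  exact ⟨fun ⟨i, h⟩ => ⟨_, h⟩, fun ⟨i, h⟩ => ⟨e i, by simpa using h⟩⟩

theorem length_tup {β : Type*} (f : Option κ → β) : (tup e f).length = r := by simp [tup]

/-- The variable for a register. -/
def xv (i : Option κ) : ℕ := e i + 1

/-- Numbering of the variables: `0` is the universe variable, `1, …, r` are the registers, `r + 1`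
is the new value of a changed register, and the variables from `r + 2` on are the fresh ones. The
bounds keep these groups apart. -/
theorem xv_le (i : Option κ) : xv e i ≤ r := (e i).2

theorem xv_ne_zero (i : Option κ) : xv e i ≠ 0 := Nat.succ_ne_zero _

theorem xv_inj {i j : Option κ} : xv e i = xv e j ↔ i = j := by
  simp [xv, Fin.val_inj]

/-- The substitution that maps the universe variable, the register variables and the auxiliary
variables to given words. -/
def val (w : List A) (X : Option κ → List A) (Y : List A) (Z : ℕ → List A) (n : ℕ) : List A :=
  if n = 0 then w else if h : n - 1 < r then X (e.symm ⟨n - 1, h⟩) else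
    if n = r + 1 then Y else Z n

section Val

variable (w : List A) (X : Option κ → List A) (Y : List A) (Z : ℕ → List A)

theorem val_zero : val e w X Y Z 0 = w := rfl

theorem val_xv (i : Option κ) : val e w X Y Z (xv e i) = X i := by simp [val, xv]

theorem val_comp_xv : val e w X Y Z ∘ xv e = X := funext fun i => val_xv e w X Y Z i

theorem val_y : val e w X Y Z (r + 1) = Y := by simp [val]

theorem val_z {n : ℕ} (h : r + 2 ≤ n) : val e w X Y Z n = Z n := by
  have h1 : n ≠ 0 := by lia
  have h2 : ¬ n - 1 < r := by lia
  have h3 : n ≠ r + 1 := by lia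
  simp [val, h1, h2, h3]

end Val

variable [DecidableEq κ]

/-- The bodies of the rules for an instruction; the letter that is read selects the rule. -/
inductive Body : Instr A κ Lb → Option A → List (Atom A (Option Lb)) → Prop
  | goto (ℓ) : Body (.goto ℓ) none [.rel (some ℓ) (tup e (xv e))]
  | incLt (i ℓ ℓ' a) : Body (.inc i ℓ ℓ') (some a)
      [.eqn 0 [.inr (xv e i), .inl a, .inr (r + 2)], .eqn (r + 1) [.inr (xv e i), .inl a],
        .rel (some ℓ) (tup e (Function.update (xv e) i (r + 1)))]
  | incFull (i ℓ ℓ') : Body (.inc i ℓ ℓ') none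
      [.eqn (xv e i) [.inr 0], .rel (some ℓ') (tup e (xv e))]
  | decPos (i ℓ ℓ' a) : Body (.dec i ℓ ℓ') (some a)
      [.eqn (xv e i) [.inr (r + 1), .inl a],
        .rel (some ℓ) (tup e (Function.update (xv e) i (r + 1)))]
  | decZero (i ℓ ℓ') : Body (.dec i ℓ ℓ') none
      [.eqn (xv e i) [], .rel (some ℓ') (tup e (xv e))]
  | readLt (f a) : Body (.read f) (some a)
      [.eqn 0 [.inr (xv e none), .inl a, .inr (r + 2)], .rel (some (f (some a))) (tup e (xv e))]
  | readFull (f) : Body (.read f) none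
      [.eqn (xv e none) [.inr 0], .rel (some (f none)) (tup e (xv e))]
  | halt : Body (.halt true) none
      (tup e fun i => .eqn 0 [.inr (xv e i), .inr (r + 2 + xv e i)])

/-- Label and letter determine the rule. This yields both the finiteness of the rule set and the
last step of global determinism. -/
theorem Body.unique {ins : Instr A κ Lb} {o : Option A} {b b' : List (Atom A (Option Lb))}
    (h : Body e ins o b) (h' : Body e ins o b') : b = b' := by
  cases h <;> cases h' <;> rfl

variable (prog : Lb → Instr A κ Lb) (start : Lb)

/-- The rules of the program for a register machine. The rules `dead` never apply; they make all
labels mutually recursive. -/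
inductive IsRule : Rule A (Option Lb) → Prop
  | move (ℓ o b) (h : Body e (prog ℓ) o b) : IsRule ⟨some ℓ, tup e (xv e), b⟩
  | dead (ℓ ℓ' a) : IsRule ⟨some ℓ, tup e (xv e),
      [.eqn 0 [.inr (xv e none), .inl a, .inr (r + 2)], .eqn (xv e none) [.inr 0],
        .rel (some ℓ') (tup e (xv e))]⟩
  | start : IsRule ⟨none, [], [.rel (some start) (tup e fun _ => 0)]⟩

theorem finite_isRule [Finite A] [Finite Lb] : {ρ | IsRule e prog start ρ}.Finite := by
  have h1 : (⋃ ℓ : Lb, ⋃ o : Option A, (fun b => (⟨some ℓ, tup e (xv e), b⟩ : Rule A (Option Lb))) ''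
      {b | Body e (prog ℓ) o b}).Finite :=
    Set.finite_iUnion fun ℓ => Set.finite_iUnion fun o => Set.Finite.image _
      (Set.Subsingleton.finite fun b hb b' hb' => Body.unique e hb hb')
  have h2 : (Set.range fun x : Lb × Lb × A => (⟨some x.1, tup e (xv e),
      [.eqn 0 [.inr (xv e none), .inl x.2.2, .inr (r + 2)], .eqn (xv e none) [.inr 0],
        .rel (some x.2.1) (tup e (xv e))]⟩ : Rule A (Option Lb))).Finite := Set.finite_range _
  have h3 : ({⟨none, [], [.rel (some start) (tup e fun _ => 0)]⟩} : Set (Rule A (Option Lb))).Finite :=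
    Set.finite_singleton _
  refine ((h1.union h2).union h3).subset ?_
  rintro _ (⟨ℓ, o, b, h⟩ | ⟨ℓ, ℓ', a⟩ | _)
  · exact Or.inl (Or.inl (Set.mem_iUnion.2 ⟨ℓ, Set.mem_iUnion.2 ⟨o, b, h, rfl⟩⟩))
  · exact Or.inl (Or.inr ⟨(ℓ, ℓ', a), rfl⟩)
  · exact Or.inr rfl

variable {e prog start}

theorem IsRule.rel_length {ρ : Rule A (Option Lb)} (h : IsRule e prog start ρ) {R : Option Lb}
    {ys : List ℕ} (hR : Atom.rel R ys ∈ ρ.body) : ys.length = R.elim 0 fun _ => r := by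
  cases h with
  | move ℓ o b h =>
    cases hi : prog ℓ <;> rw [hi] at h <;> cases h <;> simp at hR <;>
      first
      | (obtain ⟨rfl, rfl⟩ := hR; simp [length_tup])
      | (simp [mem_tup] at hR)
  | dead ℓ ℓ' a =>
    simp at hR
    obtain ⟨rfl, rfl⟩ := hR
    simp [length_tup]
  | start =>
    simp at hR
    obtain ⟨rfl, rfl⟩ := hR
    simp [length_tup]

theorem IsRule.headVars_subset {ρ : Rule A (Option Lb)} (h : IsRule e prog start ρ) :
    ∀ x ∈ ρ.headVars, x ∈ ρ.vars := by
  cases h with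
  | move ℓ o b h =>
    intro x hx
    obtain ⟨j, rfl⟩ := (mem_tup e).1 hx
    cases hi : prog ℓ <;> rw [hi] at h <;> cases h
    case inc.incLt i _ _ a =>
      by_cases hj : j = i
      · simp [Rule.vars, Atom.vars, Pattern.vars, hj]
      · simp only [Rule.vars, Atom.vars, List.flatMap_cons, List.mem_append, mem_tup]
        exact Or.inr (Or.inr (Or.inl ⟨j, by simp [hj]⟩))
    case dec.decPos i _ _ a =>
      by_cases hj : j = i
      · simp [Rule.vars, Atom.vars, Pattern.vars, hj]
      · simp only [Rule.vars, Atom.vars, List.flatMap_cons, List.mem_append, mem_tup]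
        exact Or.inr (Or.inl ⟨j, by simp [hj]⟩)
    -- An equation `𝔲 ≐ x z` is no restriction on a prefix `x`; it is there so that every head
    -- variable occurs in the body.
    case halt =>
      simp only [Rule.vars, List.mem_flatMap, mem_tup]
      exact ⟨_, ⟨j, rfl⟩, by simp [Atom.vars, Pattern.vars]⟩
    all_goals simp [Rule.vars, Atom.vars, mem_tup]
  | dead ℓ ℓ' a =>
    intro x hx
    obtain ⟨j, rfl⟩ := (mem_tup e).1 hx
    simp [Rule.vars, Atom.vars, mem_tup]
  | start => simp

theorem IsRule.not_mem_eqn {ρ : Rule A (Option Lb)} (h : IsRule e prog start ρ) (x : ℕ)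
    (α : Pattern A) (hx : Atom.eqn x α ∈ ρ.body) : x ∉ Pattern.vars α := by
  have h0 : ∀ j, 0 ≠ xv e j := fun j => (xv_ne_zero e j).symm
  have h1 : ∀ j, xv e j ≠ r + 1 := fun j => (Nat.lt_succ_of_le (xv_le e j)).ne
  cases h with
  | move ℓ o b h =>
    cases hi : prog ℓ <;> rw [hi] at h <;> cases h <;>
      simp only [List.mem_cons, Atom.eqn.injEq, reduceCtorEq, List.not_mem_nil, or_false,
        mem_tup] at hx
    case halt =>
      obtain ⟨i, rfl, rfl⟩ := hx
      simp [Pattern.vars, h0]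
      lia
    case inc.incLt =>
      rcases hx with ⟨rfl, rfl⟩ | ⟨rfl, rfl⟩ <;> simp [Pattern.vars, h0, (h1 _).symm]
    all_goals
      obtain ⟨rfl, rfl⟩ := hx
      simp [Pattern.vars, h0, h1, xv_ne_zero]
  | dead ℓ ℓ' a =>
    simp only [List.mem_cons, Atom.eqn.injEq, reduceCtorEq, List.not_mem_nil, or_false] at hx
    rcases hx with ⟨rfl, rfl⟩ | ⟨rfl, rfl⟩ <;> simp [Pattern.vars, h0, xv_ne_zero]
  | start => simp at hx

theorem IsRule.body_ne_nil {ρ : Rule A (Option Lb)} (h : IsRule e prog start ρ) :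
    ρ.body ≠ [] := by
  cases h with
  | move ℓ o b h =>
    cases hi : prog ℓ <;> rw [hi] at h <;> cases h <;> try simp
    -- The halting body has one equation per register, and `r` is positive because the input head
    -- `none` is a register.
    intro h
    have h' := congrArg List.length h
    rw [length_tup] at h'
    have := (e none).2
    simp at h'
    lia
  | dead ℓ ℓ' a => simp
  | start => simp

variable (e prog start)

/-- The FC-Datalog program for a register machine. -/
def program [Finite A] [Finite Lb] : Program A where
  univ := 0
  Rel := Option Lb
  finite_rel := inferInstance
  ar R := R.elim 0 fun _ => r
  ans := none
  rules := {ρ | IsRule e prog start ρ}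
  finite_rules := finite_isRule e prog start
  body_ne_nil _ h := h.body_ne_nil
  length_headVars := by
    rintro _ (_ | _ | _) <;> simp [length_tup]
  length_rel _ h _ _ hR := h.rel_length hR
  headVars_subset _ h := h.headVars_subset
  not_mem_eqn _ h := h.not_mem_eqn

variable [Finite A] [Finite Lb]

/-- The rules `dead` provide a direct use between any two labels as soon as a letter exists. Thereby
the new value of a register is a bottom variable, as the forms `x ≐ ya` and `y ≐ xa` require. -/
theorem mutRec (a : A) (ℓ ℓ' : Lb) :
    (program e prog start).MutRec (some ℓ) (some ℓ') :=
  have h : ∀ ℓ ℓ', (program e prog start).Uses (some ℓ) (some ℓ') := fun ℓ ℓ' =>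
    ⟨_, IsRule.dead ℓ ℓ' a, rfl, tup e (xv e), .tail _ (.tail _ (.head _))⟩
  ⟨.single (h _ _), .single (h _ _)⟩

variable {e prog start}

omit [Finite A] [Finite Lb] in
theorem IsRule.length_filter_isRel {ρ : Rule A (Option Lb)} (h : IsRule e prog start ρ) :
    (ρ.body.filter Atom.IsRel).length ≤ 1 := by
  cases h with
  | move ℓ o b h =>
    cases hi : prog ℓ <;> rw [hi] at h <;> cases h
    case halt =>
      refine (List.length_eq_zero_iff.2 (List.filter_eq_nil_iff.2 fun φ hφ => ?_)).trans_le
        (Nat.zero_le 1)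
      obtain ⟨i, rfl⟩ := (mem_tup e).1 hφ
      simp [Atom.IsRel]
    all_goals exact Nat.le_refl 1
  | dead ℓ ℓ' a => exact Nat.le_refl 1
  | start => exact Nat.le_refl 1

theorem IsRule.length_recArgs {ρ : Rule A (Option Lb)} (h : IsRule e prog start ρ) :
    ((program e prog start).recArgs ρ).length ≤ 1 :=
  (Program.length_recArgs_le (program e prog start) ρ).trans h.length_filter_isRel

-- The arguments of a body atom are copies of the universe variable, the head variables, or the head
-- variables with one replaced by a variable tied to the old one by an equation. Local determinism
-- is read off from these three shapes.
omit [Finite A] [Finite Lb] in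
theorem IsRule.rel_vars {ρ : Rule A (Option Lb)} (h : IsRule e prog start ρ) {R : Option Lb}
    {ys : List ℕ} (hR : Atom.rel R ys ∈ ρ.body) {y : ℕ} (hy : y ∈ ys) :
    ys = tup e (fun _ => 0) ∨ (ys = tup e (xv e) ∧ ρ.headVars = tup e (xv e)) ∨
      (∃ i, ys = tup e (Function.update (xv e) i (r + 1)) ∧ ρ.headVars = tup e (xv e) ∧ ∃ a,
        (.eqn (r + 1) [.inr (xv e i), .inl a] ∈ ρ.body ∨
          .eqn (xv e i) [.inr (r + 1), .inl a] ∈ ρ.body)) := by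
  cases h with
  | move ℓ o b h =>
    cases hi : prog ℓ <;> rw [hi] at h <;> cases h <;>
      simp only [List.mem_cons, Atom.rel.injEq, reduceCtorEq, List.not_mem_nil, or_false, false_or,
        mem_tup, exists_false] at hR <;> obtain ⟨rfl, rfl⟩ := hR
    case inc.incLt i ℓ1 ℓ2 a => exact Or.inr (Or.inr ⟨i, rfl, rfl, a, Or.inl (by simp)⟩)
    case dec.decPos i ℓ1 ℓ2 a => exact Or.inr (Or.inr ⟨i, rfl, rfl, a, Or.inr (by simp)⟩)
    all_goals exact Or.inr (Or.inl ⟨rfl, rfl⟩)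
  | dead ℓ ℓ' a =>
    simp only [List.mem_cons, Atom.rel.injEq, reduceCtorEq, List.not_mem_nil, or_false,
      false_or] at hR
    exact Or.inr (Or.inl ⟨hR.2, rfl⟩)
  | start =>
    simp only [List.mem_cons, Atom.rel.injEq, List.not_mem_nil, or_false] at hR
    exact Or.inl hR.2

theorem IsRule.bottom_lt {ρ : Rule A (Option Lb)} (h : IsRule e prog start ρ) {y : ℕ}
    (hy : y ∈ (program e prog start).bottom ρ) : y < r + 2 := by
  obtain ⟨R, ys, hR, -, hy⟩ := Program.mem_bottom _ |>.1 hy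
  rcases h.rel_vars hR hy with rfl | ⟨rfl, -⟩ | ⟨i, rfl, -, -⟩ <;> obtain ⟨j, rfl⟩ := (mem_tup e).1 hy
  · lia
  · have := xv_le e j
    lia
  · by_cases hj : j = i
    · simp [hj]
    · rw [Function.update_of_ne hj]
      have := xv_le e j
      lia

theorem zero_mem_top (ρ : Rule A (Option Lb)) : 0 ∈ (program e prog start).top ρ := by
  simp [Program.top, program]

theorem mem_top_iff {ℓ : Lb} {b : List (Atom A (Option Lb))} {x : ℕ} :
    x ∈ (program e prog start).top ⟨some ℓ, tup e (xv e), b⟩ ↔ (∃ i, xv e i = x) ∨ x = 0 := by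
  simp [Program.top, program, mem_tup]

theorem isFresh {ℓ : Lb} {b : List (Atom A (Option Lb))}
    (h : IsRule e prog start ⟨some ℓ, tup e (xv e), b⟩) {z : ℕ} (hz : r + 2 ≤ z)
    (hc : (b.flatMap Atom.vars).count z = 1) :
    (program e prog start).IsFresh ⟨some ℓ, tup e (xv e), b⟩ z := by
  refine ⟨?_, fun hy => (h.bottom_lt hy).not_ge hz, hc⟩
  rw [mem_top_iff]
  rintro (⟨i, rfl⟩ | rfl)
  · have := xv_le e i
    lia
  · lia

theorem count_tup {f : Option κ → ℕ} {z : ℕ} (h : ∀ i, f i ≠ z) : (tup e f).count z = 0 :=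
  List.count_eq_zero.2 fun hz => by
    obtain ⟨i, hi⟩ := (mem_tup e).1 hz
    exact h i hi

/-- Every register has its own fresh variable, above all register variables, so the count is a sum
over the registers with a single nonzero term. -/
theorem count_vars_halt (i : Option κ) :
    (((tup e fun i => .eqn 0 [.inr (xv e i), .inr (r + 2 + xv e i)]) :
      List (Atom A (Option Lb))).flatMap Atom.vars).count (r + 2 + xv e i) = 1 := by
  have h : ∀ j : Fin r, ((Atom.vars ∘ (fun i => (.eqn 0 [.inr (xv e i), .inr (r + 2 + xv e i)] :
      Atom A (Option Lb))) ∘ e.symm) j).count (r + 2 + xv e i) = if j = e i then 1 else 0 := by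
    intro j
    have h1 := xv_le e i
    have h2 := xv_le e (e.symm j)
    have h3 : xv e (e.symm j) ≠ r + 2 + xv e i := by lia
    simp only [Function.comp_apply, Atom.vars, Pattern.vars, List.filterMap_cons,
      Sum.getRight?_inr, List.filterMap_nil, List.count_cons, List.count_nil, beq_iff_eq,
      Nat.add_left_cancel_iff, xv_inj, h3, if_false, Equiv.symm_apply_eq]
    simp
    lia
  rw [tup, List.flatMap_def, List.map_map, List.count_flatten, List.map_map]
  have : (List.count (r + 2 + xv e i) ∘ Atom.vars ∘ (fun i =>
      (.eqn 0 [.inr (xv e i), .inr (r + 2 + xv e i)] : Atom A (Option Lb))) ∘ e.symm) =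
      fun j => if j = e i then 1 else 0 := funext h
  rw [this, ← Fin.sum_univ_def]
  simp

/-- Registers are prefixes, which change at their right end only. Having no left equation at all
makes the condition on mixed sides trivial. -/
theorem IsRule.eqn {ρ : Rule A (Option Lb)} (h : IsRule e prog start ρ) {x : ℕ} {α : Pattern A}
    (hx : Atom.eqn x α ∈ ρ.body) :
    ((program e prog start).EpsEqn ρ x α ∨ (program e prog start).RightEqn ρ x α) ∧
      ¬ (program e prog start).LeftEqn ρ x α := by
  have h1 : ∀ j, xv e j ≠ r + 2 := fun j => by have := xv_le e j; lia
  have h2 : ∀ i j, Function.update (xv e) i (r + 1) j ≠ r + 2 := by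
    intro i j
    by_cases hj : j = i
    · simp [hj]
    · simp [hj, h1]
  have hr := h
  cases h with
  | move ℓ o b h =>
    have htop : ∀ i, xv e i ∈ (program e prog start).top ⟨some ℓ, tup e (xv e), b⟩ :=
      fun i => mem_top_iff.2 (Or.inl ⟨i, rfl⟩)
    have h0 := zero_mem_top (e := e) (prog := prog) (start := start) ⟨some ℓ, tup e (xv e), b⟩
    -- Left equations start with a letter or with a fresh variable, whereas a register variable is a
    -- top variable and so never fresh.
    have hleft : ∀ x α, (program e prog start).LeftEqn ⟨some ℓ, tup e (xv e), b⟩ x α →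
        ∀ i β, α ≠ .inr (xv e i) :: β := by
      rintro _ _ (⟨x, y, a, -, -⟩ | ⟨x, y, a, -, -⟩ | ⟨x, z, a, -, hz⟩) i β hβ
      · simp at hβ
      · simp at hβ
      · obtain ⟨rfl, -⟩ : z = xv e i ∧ _ := by simpa using hβ
        exact hz.1 (htop i)
    have hbot : ∀ i ℓ', Atom.rel (some ℓ') (tup e (Function.update (xv e) i (r + 1))) ∈ b →
        A → r + 1 ∈ (program e prog start).bottom ⟨some ℓ, tup e (xv e), b⟩ :=
      fun i ℓ' hm a => (Program.mem_bottom _).2 ⟨some ℓ', _, hm, mutRec e prog start a ℓ ℓ',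
        (mem_tup e).2 ⟨i, by simp⟩⟩
    cases hi : prog ℓ <;> rw [hi] at h <;> cases h <;>
      simp only [List.mem_cons, Atom.eqn.injEq, reduceCtorEq, List.not_mem_nil, or_false,
        mem_tup] at hx
    case inc.incLt i ℓ1 ℓ2 a =>
      have hb := hbot i ℓ1 (by simp) a
      rcases hx with ⟨rfl, rfl⟩ | ⟨rfl, rfl⟩
      · exact ⟨Or.inr (.next _ _ _ (htop _) (isFresh hr le_rfl
          (by simp [Atom.vars, Pattern.vars, List.filterMap_cons, List.count_cons, count_tup (h2 _), h1]))),
          fun hl => hleft _ _ hl _ _ rfl⟩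
      · exact ⟨Or.inr (.add _ _ _ (htop _) hb), fun hl => hleft _ _ hl _ _ rfl⟩
    case inc.incFull i ℓ1 ℓ2 =>
      obtain ⟨rfl, rfl⟩ := hx
      exact ⟨Or.inl (.eqTop _ _ (htop _) h0), by rintro (_ | _ | _)⟩
    case dec.decPos i ℓ1 ℓ2 a =>
      have hb := hbot i ℓ1 (by simp) a
      obtain ⟨rfl, rfl⟩ := hx
      exact ⟨Or.inr (.del _ _ _ (htop _) hb), by rintro (_ | _ | _)⟩
    case dec.decZero i ℓ1 ℓ2 =>
      obtain ⟨rfl, rfl⟩ := hx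
      exact ⟨Or.inl (.empty _ (htop _)), by rintro (_ | _ | _)⟩
    case read.readLt f a =>
      obtain ⟨rfl, rfl⟩ := hx
      exact ⟨Or.inr (.next _ _ _ (htop _) (isFresh hr le_rfl
          (by simp [Atom.vars, Pattern.vars, List.filterMap_cons, List.count_cons, count_tup h1, h1]))),
          fun hl => hleft _ _ hl _ _ rfl⟩
    case read.readFull f =>
      obtain ⟨rfl, rfl⟩ := hx
      exact ⟨Or.inl (.eqTop _ _ (htop _) h0), by rintro (_ | _ | _)⟩
    case halt =>
      obtain ⟨i, rfl, rfl⟩ := hx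
      exact ⟨Or.inl (.next _ _ (htop _) (isFresh hr (by lia) (count_vars_halt i))),
        by rintro (_ | _ | _)⟩
  | dead ℓ ℓ' a =>
    simp only [List.mem_cons, Atom.eqn.injEq, reduceCtorEq, List.not_mem_nil, or_false] at hx
    rcases hx with ⟨rfl, rfl⟩ | ⟨rfl, rfl⟩
    · refine ⟨Or.inr (.next _ _ _ (mem_top_iff.2 (Or.inl ⟨_, rfl⟩)) (isFresh hr le_rfl
          (by simp [Atom.vars, Pattern.vars, List.filterMap_cons, List.count_cons, count_tup h1, h1]))), ?_⟩
      intro hl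
      cases hl with
      | prev x z a h hz => exact hz.1 (mem_top_iff.2 (Or.inl ⟨_, rfl⟩))
    · exact ⟨Or.inl (.eqTop _ _ (mem_top_iff.2 (Or.inl ⟨_, rfl⟩)) (zero_mem_top _)),
        by rintro (_ | _ | _)⟩
  | start => simp at hx

theorem isOLLA : (program e prog start).IsOLLA :=
  ⟨fun _ h => h.length_recArgs, fun _ h _ _ hx => (h.eqn hx).1.imp_right Or.inl,
    fun _ h _ _ hm => by
      obtain ⟨⟨x, α, hx, hl, -⟩, -⟩ := hm
      exact (h.eqn hx).2 hl⟩

/-- Appending a given letter is a function, and so is removing one, by cancellation; every other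
bottom variable is itself a top variable. -/
theorem IsRule.isLocallyDet_aux {ρ : Rule A (Option Lb)} (h : IsRule e prog start ρ)
    {w : List A} {θ θ' : ℕ → List A} (hθ : (program e prog start).SatEqns w θ ρ)
    (hθ' : (program e prog start).SatEqns w θ' ρ)
    (htop : ∀ x ∈ (program e prog start).top ρ, θ x = θ' x) {y : ℕ}
    (hy : y ∈ (program e prog start).bottom ρ) : θ y = θ' y := by
  obtain ⟨R, ys, hR, hm, hy⟩ := Program.mem_bottom _ |>.1 hy
  have hh : ∀ x ∈ ρ.headVars, θ x = θ' x := fun x hx => htop x (List.mem_append_left _ hx)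
  rcases h.rel_vars hR hy with rfl | ⟨rfl, hv⟩ | ⟨i, rfl, hv, a, ha⟩
  · obtain ⟨j, rfl⟩ := (mem_tup e).1 hy
    exact htop 0 (zero_mem_top _)
  · exact hh y (hv ▸ hy)
  · have hx : ∀ i, θ (xv e i) = θ' (xv e i) := fun i => hh _ (hv ▸ (mem_tup e).2 ⟨i, rfl⟩)
    obtain ⟨j, rfl⟩ := (mem_tup e).1 hy
    by_cases hj : j = i
    · subst hj
      rw [Function.update_self]
      rcases ha with ha | ha
      · rw [(hθ _ _ ha).1, (hθ' _ _ ha).1]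
        simp [Pattern.subst, hx]
      · have h1 := (hθ _ _ ha).1
        rw [hx j, (hθ' _ _ ha).1] at h1
        simpa [Pattern.subst, eq_comm] using h1
    · rw [Function.update_of_ne hj]
      exact hx j

theorem isLocallyDet : (program e prog start).IsLocallyDet := by
  rintro w ρ hρ t b b' ⟨θ, -, hθ, rfl, rfl⟩ ⟨θ', -, hθ', ht, rfl⟩
  exact List.map_congr_left fun y hy =>
    IsRule.isLocallyDet_aux hρ hθ hθ' (List.map_inj_left.1 ht) hy

/-- The letter that selects the rule for an instruction is admissible for the values of the
registers. -/
def Key (w : List A) (X : Option κ → List A) : Instr A κ Lb → Option A → Prop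
  | .goto _, o => o = none
  | .inc i _ _, some a => X i ++ [a] <+: w
  | .inc i _ _, none => X i = w
  | .dec i _ _, some a => ∃ y, X i = y ++ [a]
  | .dec i _ _, none => X i = []
  | .read _, some a => X none ++ [a] <+: w
  | .read _, none => X none = w
  | .halt _, o => o = none

-- A proper prefix of `w` has exactly one next letter, the full word has none, and a nonempty word
-- has exactly one last letter.
omit [DecidableEq κ] [Finite A] [Finite Lb] in
theorem Key.unique {w : List A} {X : Option κ → List A} {ins : Instr A κ Lb} {o o' : Option A}
    (h : Key w X ins o) (h' : Key w X ins o') : o = o' := by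
  have h1 : ∀ (x : List A) a, x ++ [a] <+: w → x ≠ w := by
    rintro x a h rfl
    have := h.length_le
    simp at this
  have h2 : ∀ (x : List A) a b, x ++ [a] <+: w → x ++ [b] <+: w → a = b := by
    intro x a b ha hb
    have := List.prefix_of_prefix_length_le ha hb (by simp)
    simpa using this.eq_of_length (by simp)
  cases ins <;> cases o <;> cases o' <;> simp only [Key, reduceCtorEq] at h h' ⊢
  · exact absurd h (h1 _ _ h')
  · exact absurd h' (h1 _ _ h)
  · rw [h2 _ _ _ h h']
  · obtain ⟨y, hy⟩ := h'
    simp [h] at hy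
  · obtain ⟨y, hy⟩ := h
    simp [h'] at hy
  · obtain ⟨y, hy⟩ := h
    obtain ⟨z, hz⟩ := h'
    rw [hy] at hz
    simpa using (List.append_inj' hz rfl).2
  · exact absurd h (h1 _ _ h')
  · exact absurd h' (h1 _ _ h)
  · rw [h2 _ _ _ h h']

/-- The core of global determinism: the equations of a rule force its selecting letter to fit the
register values, which are part of the top tuple. -/
theorem Body.key {ℓ : Lb} {o : Option A} {b : List (Atom A (Option Lb))}
    (h : Body e (prog ℓ) o b) {w : List A} {θ : ℕ → List A} (h0 : θ 0 = w)
    (hθ : ∀ x α, Atom.eqn x α ∈ b → θ x = α.subst θ) : Key w (θ ∘ xv e) (prog ℓ) o := by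
  have h3 : ∀ i a, θ 0 = Pattern.subst θ [.inr (xv e i), .inl a, .inr (r + 2)] →
      (θ ∘ xv e) i ++ [a] <+: w := by
    intro i a h
    rw [← h0, h]
    exact ⟨θ (r + 2), by simp [Pattern.subst]⟩
  cases hi : prog ℓ <;> rw [hi] at h <;> cases h
  case inc.incLt => exact h3 _ _ (hθ _ _ (by simp))
  case read.readLt => exact h3 _ _ (hθ _ _ (by simp))
  case inc.incFull => simpa [Key, Pattern.subst, h0] using hθ _ _ List.mem_cons_self
  case read.readFull => simpa [Key, Pattern.subst, h0] using hθ _ _ List.mem_cons_self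
  case dec.decPos => exact ⟨θ (r + 1), by simpa [Pattern.subst] using hθ _ _ List.mem_cons_self⟩
  case dec.decZero => simpa [Key, Pattern.subst] using hθ _ _ List.mem_cons_self
  all_goals rfl

-- The equations `𝔲 ≐ x a z` and `x ≐ 𝔲` contradict each other by length.
omit [DecidableEq κ] [Finite A] [Finite Lb] in
theorem not_dead {θ : ℕ → List A} {a : A}
    (h : θ 0 = Pattern.subst θ [.inr (xv e none), .inl a, .inr (r + 2)])
    (h' : θ (xv e none) = Pattern.subst θ [.inr 0]) : False := by
  have := congrArg List.length h
  simp [Pattern.subst] at h' this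
  rw [h'] at this
  lia

theorem isGloballyDet : (program e prog start).IsGloballyDet := by
  rintro w ρ hρ χ hχ hh hne ⟨t, b, b', ⟨θ, hw, hθ, rfl, -⟩, ⟨θ', hw', hθ', ht, -⟩⟩
  rcases hρ with ⟨ℓ, o, b, hb⟩ | ⟨ℓ, ℓ', a⟩ | _
  · rcases hχ with ⟨ℓ₁, o', b', hb'⟩ | ⟨ℓ₁, ℓ', a⟩ | _
    · obtain rfl : ℓ = ℓ₁ := Option.some.inj hh
      have h1 := hb.key hw.1 fun x α hx => (hθ x α hx).1
      have h2 := hb'.key hw'.1 fun x α hx => (hθ' x α hx).1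
      have h3 : θ ∘ xv e = θ' ∘ xv e := funext fun i =>
        List.map_inj_left.1 ht _ (mem_top_iff.2 (Or.inl ⟨i, rfl⟩))
      rw [← h3] at h2
      obtain rfl := h1.unique h2
      obtain rfl := hb.unique e hb'
      exact hne rfl
    · exact not_dead (hθ' _ _ (.head _)).1 (hθ' _ _ (.tail _ (.head _))).1
    · cases hh
  · exact not_dead (hθ _ _ (.head _)).1 (hθ _ _ (.tail _ (.head _))).1
  · rcases hχ with ⟨ℓ₁, o', b', hb'⟩ | ⟨ℓ₁, ℓ', a⟩ | _
    · cases hh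
    · cases hh
    · exact hne rfl

theorem isDOLLA : (program e prog start).IsDOLLA := ⟨isOLLA, isLocallyDet, isGloballyDet⟩

end RegMachine.Datalog


-- Derivations of the program correspond to accepting runs.

namespace RegMachine.Datalog

open FCDatalog Relation StateTransition

universe u

variable {A : Type u} {κ Lb : Type} {r : ℕ} {e : Option κ ≃ Fin r} [DecidableEq κ]
  {prog : Lb → Instr A κ Lb} {start : Lb} [Finite A] [Finite Lb]

theorem val_infix {w : List A} {X : Option κ → List A} {Y : List A} {Z : ℕ → List A}
    (hX : ∀ i, X i <:+: w) (hY : Y <:+: w) (hZ : ∀ n, Z n <:+: w) (n : ℕ) :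
    val e w X Y Z n <:+: w := by
  unfold val
  split_ifs
  · exact List.infix_refl w
  · exact hX _
  · exact hY
  · exact hZ n

/-- One derivation step with an explicit substitution: `X` gives the registers, `Y` the changed
value and `Z` the fresh variables. -/
theorem Body.mem_fixpoint {ℓ : Lb} {o : Option A} {b : List (Atom A (Option Lb))}
    (h : Body e (prog ℓ) o b) {w : List A} {X : Option κ → List A} {Y : List A} {Z : ℕ → List A}
    (hX : ∀ i, X i <:+: w) (hY : Y <:+: w) (hZ : ∀ n, Z n <:+: w)
    (heq : ∀ x α, Atom.eqn x α ∈ b → val e w X Y Z x = α.subst (val e w X Y Z))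
    (hrel : ∀ R ys, Atom.rel R ys ∈ b →
      ys.map (val e w X Y Z) ∈ (program e prog start).fixpoint w R) :
    tup e X ∈ (program e prog start).fixpoint w (some ℓ) := by
  have hv := val_infix (e := e) hX hY hZ
  have := (program e prog start).mem_fixpoint_of_rule (w := w) (θ := val e w X Y Z)
    (IsRule.move (e := e) (prog := prog) (start := start) ℓ o b h)
    ⟨val_zero e w X Y Z, fun x _ => hv x⟩ (by
      intro φ hφ
      cases φ with
      | eqn x α =>
        have h1 := heq x α hφ
        exact ⟨h1, hv x, h1 ▸ hv x⟩
      | rel R ys => exact ⟨hrel R ys hφ, fun y _ => hv y⟩)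
  rw [map_tup, val_comp_xv] at this
  exact this

/-- The machine reaches an accepting halt. -/
def Accepts (prog : Lb → Instr A κ Lb) (w : List A) (c : Lb × Regs κ) : Prop :=
  ∃ c', Reaches (step prog false w) c c' ∧ prog c'.1 = .halt true

omit [Finite A] [Finite Lb] in
theorem Accepts.head {w : List A} {c c' : Lb × Regs κ} (h : step prog false w c = some c')
    (h' : Accepts prog w c') : Accepts prog w c := by
  obtain ⟨d, hd, hd'⟩ := h'
  exact ⟨d, hd.head h, hd'⟩

omit [Finite A] [Finite Lb] in
theorem take_update (w : List A) (v : Regs κ) (i : Option κ) (m : ℕ) :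
    (fun j => w.take (Function.update v i m j)) =
      Function.update (fun j => w.take (v j)) i (w.take m) := by
  funext j
  by_cases h : j = i
  · subst h
    simp
  · simp [h]

omit [DecidableEq κ] [Finite A] [Finite Lb] in
theorem getElem?_of_take_append {w z : List A} {a : A} {m : ℕ} (hm : m ≤ w.length)
    (h : w = w.take m ++ a :: z) : w[m]? = some a := by
  have hl : (w.take m).length = m := by simpa using hm
  rw [h, List.getElem?_append_right (by lia), hl]
  simp

omit [DecidableEq κ] [Finite A] [Finite Lb] in
theorem take_eq_append_singleton {w y : List A} {a : A} {m : ℕ} (hm : m ≤ w.length)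
    (h : w.take m = y ++ [a]) : m ≠ 0 ∧ y = w.take (m - 1) := by
  have hl : m = y.length + 1 := by
    have := congrArg List.length h
    simpa [hm] using this
  subst hl
  refine ⟨Nat.succ_ne_zero _, ?_⟩
  have h2 := congrArg (List.take y.length) h
  rw [List.take_take] at h2
  simpa using h2.symm

/-- A rule derives a configuration from its successor, so induction on the derivation prepends steps
to an accepting run. The bound on `v` makes a prefix determine its length. -/
theorem accepts_of_mem_fixpoint {w : List A} {R : Option Lb} {t : List (List A)}
    (ht : t ∈ (program e prog start).fixpoint w R) :
    ∀ (ℓ : Lb) (v : Regs κ), R = some ℓ → (∀ i, v i ≤ w.length) →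
      t = tup e (fun i => w.take (v i)) → Accepts prog w (ℓ, v) := by
  refine (program e prog start).fixpoint_induction
    (Q := fun R t => ∀ (ℓ : Lb) (v : Regs κ), R = some ℓ → (∀ i, v i ≤ w.length) →
      t = tup e (fun i => w.take (v i)) → Accepts prog w (ℓ, v)) ?_ ht
  rintro _ (⟨ℓ, o, b, hb⟩ | ⟨ℓ, ℓ', a⟩ | _) θ hθ hsat ℓ₁ v hℓ hv ht
  · obtain rfl : ℓ = ℓ₁ := Option.some.inj hℓ
    rw [map_tup, tup_inj] at ht
    have hx : ∀ i, θ (xv e i) = w.take (v i) := fun i => congrFun ht i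
    have h0 : θ 0 = w := hθ.1
    have hrel : ∀ (ℓ' : Lb) (y : Option κ → ℕ), Atom.rel (some ℓ') (tup e y) ∈ b →
        ∀ v' : Regs κ, (∀ i, v' i ≤ w.length) → θ ∘ y = (fun i => w.take (v' i)) →
          Accepts prog w (ℓ', v') := by
      intro ℓ' y hy v' hv' hyv
      have := (hsat _ hy).1
      exact this.2 ℓ' v' rfl hv' (by rw [map_tup, hyv])
    have heq : ∀ x α, Atom.eqn x α ∈ b → θ x = α.subst θ := fun x α hx => (hsat _ hx).1
    cases hi : prog ℓ <;> rw [hi] at hb <;> cases hb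
    case goto ℓ' =>
      exact Accepts.head (by simp [step, hi, Instr.exec]) (hrel _ _ (.head _) v hv ht)
    case inc.incLt i ℓ1 ℓ2 a =>
      have e1 := heq _ _ (.head _)
      have e2 := heq _ _ (.tail _ (.head _))
      simp only [Pattern.subst, List.flatMap_cons, List.flatMap_nil, Sum.elim_inr, Sum.elim_inl,
        List.append_nil, hx, h0, List.singleton_append] at e1 e2
      have e3 := getElem?_of_take_append (hv i) e1
      have hlt : v i < w.length := (List.getElem?_eq_some_iff.1 e3).1
      refine Accepts.head (by simp [step, hi, Instr.exec, hlt])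
        (hrel _ _ (.tail _ (.tail _ (.head _))) (Function.update v i (v i + 1)) ?_ ?_)
      · intro j
        by_cases hj : j = i
        · subst hj
          simpa using hlt
        · simpa [hj] using hv j
      · rw [take_update, Function.comp_update, ht, e2, List.take_add_one, e3]
        rfl
    case inc.incFull i ℓ1 ℓ2 =>
      have e1 := heq _ _ (.head _)
      simp only [Pattern.subst, List.flatMap_cons, List.flatMap_nil, Sum.elim_inr,
        List.append_nil, hx, h0] at e1
      have hge : ¬ v i < w.length := by
        have := congrArg List.length e1
        simp at this
        lia
      exact Accepts.head (by simp [step, hi, Instr.exec, hge])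
        (hrel _ _ (.tail _ (.head _)) v hv ht)
    case dec.decPos i ℓ1 ℓ2 a =>
      have e1 := heq _ _ (.head _)
      simp only [Pattern.subst, List.flatMap_cons, List.flatMap_nil, Sum.elim_inr, Sum.elim_inl,
        List.append_nil, hx, h0] at e1
      obtain ⟨hne, hy⟩ := take_eq_append_singleton (hv i) e1
      refine Accepts.head (by simp [step, hi, Instr.exec, hne])
        (hrel _ _ (.tail _ (.head _)) (Function.update v i (v i - 1)) ?_ ?_)
      · intro j
        by_cases hj : j = i
        · subst hj
          have := hv j
          simp
          lia
        · simpa [hj] using hv j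
      · rw [take_update, Function.comp_update, ht, hy]
    case dec.decZero i ℓ1 ℓ2 =>
      have e1 := heq _ _ (.head _)
      simp only [Pattern.subst, List.flatMap_nil, hx] at e1
      have hz : v i = 0 := by
        have h1 : min (v i) w.length = 0 := by rw [← List.length_take, e1]; rfl
        have := hv i
        lia
      exact Accepts.head (by simp [step, hi, Instr.exec, hz])
        (hrel _ _ (.tail _ (.head _)) v hv ht)
    case read.readLt f a =>
      have e1 := heq _ _ (.head _)
      simp only [Pattern.subst, List.flatMap_cons, List.flatMap_nil, Sum.elim_inr, Sum.elim_inl,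
        List.append_nil, hx, h0, List.singleton_append] at e1
      have e3 := getElem?_of_take_append (hv none) e1
      exact Accepts.head (by simp [step, hi, Instr.exec, e3])
        (hrel _ _ (.tail _ (.head _)) v hv ht)
    case read.readFull f =>
      have e1 := heq _ _ (.head _)
      simp only [Pattern.subst, List.flatMap_cons, List.flatMap_nil, Sum.elim_inr,
        List.append_nil, hx, h0] at e1
      have e3 : w[v none]? = none := by
        rw [List.getElem?_eq_none_iff]
        have := congrArg List.length e1
        simp at this
        lia
      exact Accepts.head (by simp [step, hi, Instr.exec, e3])
        (hrel _ _ (.tail _ (.head _)) v hv ht)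
    case halt => exact ⟨_, ReflTransGen.refl, hi⟩
  · exact (not_dead (hsat _ (.head _)).1 (hsat _ (.tail _ (.head _))).1).elim
  · cases hℓ

/-- Induction along the run from its accepting end backwards; each executed instruction supplies the
rule and the letter. -/
theorem mem_fixpoint_of_accepts {w : List A} {c : Lb × Regs κ} (h : Accepts prog w c)
    (hv : ∀ i, c.2 i ≤ w.length) :
    tup e (fun i => w.take (c.2 i)) ∈ (program e prog start).fixpoint w (some c.1) := by
  obtain ⟨d, hr, hd⟩ := h
  have hX : ∀ (v : Regs κ) i, w.take (v i) <:+: w := fun v i => (List.take_prefix _ _).isInfix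
  have hnil : ([] : List A) <:+: w := List.nil_infix
  have hdrop : ∀ m, w.drop m <:+: w := fun m => (List.drop_suffix _ _).isInfix
  induction hr using ReflTransGen.head_induction_on with
  | refl =>
    obtain ⟨ℓ, v⟩ := d
    have hd' : prog ℓ = .halt true := hd
    -- The fresh variable of register `i` has number `r + 3 + e i`; its value is the suffix of `w`
    -- that remains after the prefix of that register.
    refine Body.mem_fixpoint (hd' ▸ Body.halt) (Y := []) (Z := fun n => w.drop (if h : n - (r + 3) < r then
      v (e.symm ⟨n - (r + 3), h⟩) else 0)) (hX v) hnil (fun n => hdrop _) ?_ ?_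
    · intro x α hx
      obtain ⟨i, hi⟩ := (mem_tup e).1 hx
      obtain ⟨rfl, rfl⟩ : 0 = x ∧ _ := by simpa using hi
      simp only [Pattern.subst, List.flatMap_cons, List.flatMap_nil, Sum.elim_inr,
        List.append_nil, val_xv, val_zero]
      rw [val_z _ _ _ _ _ (by lia)]
      have : r + 2 + xv e i - (r + 3) = e i := by
        simp only [xv]
        lia
      simp [this]
    · intro R ys hx
      obtain ⟨i, hi⟩ := (mem_tup e).1 hx
      simp at hi
  | head hs _ ih =>
    rename_i c c' _
    obtain ⟨ℓ, v⟩ := c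
    have hbnd : ∀ i m, m ≤ w.length → ∀ j, Function.update v i m j ≤ w.length := by
      intro i m hm j
      by_cases hj : j = i
      · subst hj
        simpa using hm
      · simpa [hj] using hv j
    rw [Option.mem_def, step] at hs
    cases hi : prog ℓ with
    | goto ℓ' =>
      simp only [hi, Instr.exec, Option.some.injEq] at hs
      subst hs
      refine Body.mem_fixpoint (hi ▸ Body.goto ℓ') (Y := []) (Z := fun _ => []) (hX v) hnil
        (fun _ => hnil) ?_ ?_
      · intro x α hx
        simp at hx
      · intro R ys hx
        obtain ⟨rfl, rfl⟩ : R = _ ∧ ys = _ := by simpa using hx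
        rw [map_tup, val_comp_xv]
        exact ih hv
    | inc i ℓ1 ℓ2 =>
      simp only [hi, Instr.exec] at hs
      split_ifs at hs with h1 h2
      · have e1 : w[v i]? = some w[v i] := List.getElem?_eq_getElem h1
        have e2 : w.take (v i + 1) = w.take (v i) ++ [w[v i]] := by
          rw [List.take_add_one, e1]
          rfl
        obtain rfl := Option.some.inj hs
        -- `Y` is the lengthened prefix and `Z` the rest of `w` after it.
        refine Body.mem_fixpoint (hi ▸ Body.incLt i ℓ1 ℓ2 w[v i]) (Y := w.take (v i + 1))
          (Z := fun _ => w.drop (v i + 1)) (hX v) (List.take_prefix _ _).isInfix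
          (fun _ => hdrop _) ?_ ?_
        · intro x α hx
          simp only [List.mem_cons, Atom.eqn.injEq, reduceCtorEq, List.not_mem_nil, or_false] at hx
          rcases hx with ⟨rfl, rfl⟩ | ⟨rfl, rfl⟩
          · simp only [Pattern.subst, List.flatMap_cons, List.flatMap_nil, Sum.elim_inr,
              Sum.elim_inl, List.append_nil, val_xv, val_zero]
            rw [val_z _ _ _ _ _ le_rfl, ← List.append_assoc, ← e2, List.take_append_drop]
          · simp only [Pattern.subst, List.flatMap_cons, List.flatMap_nil, Sum.elim_inr,
              Sum.elim_inl, List.append_nil, val_xv, val_y, e2]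
        · intro R ys hx
          obtain ⟨rfl, rfl⟩ : R = _ ∧ ys = _ := by simpa using hx
          rw [map_tup, Function.comp_update, val_comp_xv, val_y, ← take_update]
          exact ih (hbnd _ _ h1)
      · obtain rfl := Option.some.inj hs
        refine Body.mem_fixpoint (hi ▸ Body.incFull i ℓ1 ℓ2) (Y := []) (Z := fun _ => [])
          (hX v) hnil (fun _ => hnil) ?_ ?_
        · intro x α hx
          obtain ⟨rfl, rfl⟩ : x = _ ∧ α = _ := by simpa using hx
          simp only [Pattern.subst, List.flatMap_cons, List.flatMap_nil, Sum.elim_inr,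
              Sum.elim_inl, List.append_nil, val_xv, val_zero]
          exact List.take_of_length_le (not_lt.1 h1)
        · intro R ys hx
          obtain ⟨rfl, rfl⟩ : R = _ ∧ ys = _ := by simpa using hx
          rw [map_tup, val_comp_xv]
          exact ih hv
    | dec i ℓ1 ℓ2 =>
      simp only [hi, Instr.exec] at hs
      split_ifs at hs with h1
      · obtain rfl := Option.some.inj hs
        refine Body.mem_fixpoint (hi ▸ Body.decZero i ℓ1 ℓ2) (Y := []) (Z := fun _ => [])
          (hX v) hnil (fun _ => hnil) ?_ ?_
        · intro x α hx
          obtain ⟨rfl, rfl⟩ : x = _ ∧ α = _ := by simpa using hx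
          simp [Pattern.subst, val_xv, h1]
        · intro R ys hx
          obtain ⟨rfl, rfl⟩ : R = _ ∧ ys = _ := by simpa using hx
          rw [map_tup, val_comp_xv]
          exact ih hv
      · obtain rfl := Option.some.inj hs
        have hvi := hv i
        have h2 : v i - 1 < w.length := by
          dsimp only at hvi
          lia
        have e2 : w.take (v i) = w.take (v i - 1) ++ [w[v i - 1]] := by
          conv_lhs => rw [show v i = v i - 1 + 1 by lia]
          rw [List.take_add_one, List.getElem?_eq_getElem h2]
          rfl
        refine Body.mem_fixpoint (hi ▸ Body.decPos i ℓ1 ℓ2 w[v i - 1]) (Y := w.take (v i - 1))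
          (Z := fun _ => []) (hX v) (List.take_prefix _ _).isInfix (fun _ => hnil) ?_ ?_
        · intro x α hx
          obtain ⟨rfl, rfl⟩ : x = _ ∧ α = _ := by simpa using hx
          simp only [Pattern.subst, List.flatMap_cons, List.flatMap_nil, Sum.elim_inr,
              Sum.elim_inl, List.append_nil, val_xv, val_y]
          exact e2
        · intro R ys hx
          obtain ⟨rfl, rfl⟩ : R = _ ∧ ys = _ := by simpa using hx
          rw [map_tup, Function.comp_update, val_comp_xv, val_y, ← take_update]
          exact ih (hbnd _ _ h2.le)
    | read f =>
      simp only [hi, Instr.exec, Option.some.injEq] at hs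
      subst hs
      cases h1 : w[v none]? with
      | none =>
        refine Body.mem_fixpoint (hi ▸ Body.readFull f) (Y := []) (Z := fun _ => [])
          (hX v) hnil (fun _ => hnil) ?_ ?_
        · intro x α hx
          obtain ⟨rfl, rfl⟩ : x = _ ∧ α = _ := by simpa using hx
          simp only [Pattern.subst, List.flatMap_cons, List.flatMap_nil, Sum.elim_inr,
              Sum.elim_inl, List.append_nil, val_xv, val_zero]
          exact List.take_of_length_le (List.getElem?_eq_none_iff.1 h1)
        · intro R ys hx
          obtain ⟨rfl, rfl⟩ : R = _ ∧ ys = _ := by simpa using hx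
          rw [map_tup, val_comp_xv, ← h1]
          exact ih hv
      | some a =>
        have e2 : w.take (v none + 1) = w.take (v none) ++ [a] := by
          rw [List.take_add_one, h1]
          rfl
        refine Body.mem_fixpoint (hi ▸ Body.readLt f a) (Y := [])
          (Z := fun _ => w.drop (v none + 1)) (hX v) hnil (fun _ => hdrop _) ?_ ?_
        · intro x α hx
          obtain ⟨rfl, rfl⟩ : x = _ ∧ α = _ := by simpa using hx
          simp only [Pattern.subst, List.flatMap_cons, List.flatMap_nil, Sum.elim_inr,
            Sum.elim_inl, List.append_nil, val_xv, val_zero]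
          rw [val_z _ _ _ _ _ le_rfl, ← List.append_assoc, ← e2, List.take_append_drop]
        · intro R ys hx
          obtain ⟨rfl, rfl⟩ : R = _ ∧ ys = _ := by simpa using hx
          rw [map_tup, val_comp_xv, ← h1]
          exact ih hv
    | halt b => simp [hi, Instr.exec] at hs

/-- The start rule puts `𝔲` into every argument, so the machine starts with all registers equal to
`|w|`. -/
theorem mem_language {w : List A} :
    w ∈ (program e prog start).language ↔ Accepts prog w (start, fun _ => w.length) := by
  have hw : (fun _ : Option κ => w.take w.length) = fun _ => w := by simp
  constructor
  · intro h
    obtain ⟨ρ, hρ, hh, θ, hθ, hsat, -⟩ := Program.exists_rule_of_mem_fixpoint _ h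
    rcases hρ with ⟨ℓ, o, b, hb⟩ | ⟨ℓ, ℓ', a⟩ | _
    · cases hh
    · cases hh
    · have := (hsat _ (.head _)).1
      rw [map_tup] at this
      refine accepts_of_mem_fixpoint this start _ rfl (fun _ => le_rfl) ?_
      rw [hw]
      congr 1
      funext i
      exact hθ.1
  · intro h
    have h1 := mem_fixpoint_of_accepts (e := e) (start := start) h fun _ => le_rfl
    dsimp only at h1
    rw [hw] at h1
    exact (program e prog start).mem_fixpoint_of_rule (w := w) (θ := fun _ => w)
      (IsRule.start (e := e) (prog := prog) (start := start)) ⟨rfl, fun _ _ => List.infix_refl w⟩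
      (by
        intro φ hφ
        obtain rfl := List.mem_singleton.1 hφ
        exact ⟨by rw [map_tup]; exact h1, fun _ _ => List.infix_refl w⟩)

end RegMachine.Datalog

namespace RegMachine

open FCDatalog Relation StateTransition Datalog

universe u

variable {A : Type u} {κ Lb : Type}

/-- The step function is deterministic, hence two halting configurations reached from the same start
coincide. -/
theorem Answers.accepts_iff [DecidableEq κ] {prog : Lb → Instr A κ Lb} {w : List A}
    {c : Lb × Regs κ} {p : Prop} (h : Answers prog false w c p) : Accepts prog w c ↔ p := by
  obtain ⟨d, b, hr, hb, hp⟩ := h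
  rw [← hp]
  constructor
  · rintro ⟨d', hr', hd'⟩
    have halt : ∀ (x y : Lb × Regs κ) b, prog x.1 = .halt b → Reaches (step prog false w) x y →
        y = x := by
      intro x y b hx h
      rcases h.cases_head with rfl | ⟨z, hz, -⟩
      · rfl
      · simp [step, hx, Instr.exec] at hz
    rcases reaches_total hr hr' with h | h
    · rw [halt _ _ _ hb h, hb] at hd'
      simpa using hd'
    · rw [halt _ _ _ hd' h, hd'] at hb
      simpa using hb.symm
  · rintro rfl
    exact ⟨d, hr, hb⟩

/-- A language that is decided by a register machine is defined by a DOLLA program. -/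
theorem exists_dolla [Finite A] [DecidableEq κ] [Finite κ] [Finite Lb]
    (prog : Lb → Instr A κ Lb) (start : Lb) (L : Language A)
    (h : ∀ w, Answers prog false w (start, fun _ => w.length) (w ∈ L)) :
    ∃ P ∈ DOLLA A, P.IsBoolean ∧ L = P.language := by
  obtain ⟨r, ⟨e⟩⟩ := Finite.exists_equiv_fin (Option κ)
  refine ⟨program e prog start, isDOLLA, rfl, ?_⟩
  ext w
  rw [mem_language, (h w).accepts_iff]

end RegMachine


/-! # From register machines to Turing machines with logarithmic work space -/

namespace RegMachine.Tape

open LogSpace Relation StateTransition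

universe u

/-- Tape symbols: the blank, a mark for the first cell, and bits. -/
inductive Sym
  | blank
  | mark
  | bit (b : Bool)

/-- The phases of the simulation of an instruction. -/
inductive Phase
  | run
  | carry
  | rewind
  | borrow
  | restore
  | back

instance : Finite Sym := Finite.of_injective
  (fun s => match s with | .blank => none | .mark => some none | .bit b => some (some b))
  (by rintro (_ | _ | _) (_ | _ | _) h <;> simp_all)

instance : Finite Phase := Finite.of_injective
  (fun p => match p with
    | .run => (0 : Fin 6) | .carry => 1 | .rewind => 2 | .borrow => 3 | .restore => 4 | .back => 5)
  (by rintro (_ | _) (_ | _) h <;> simp_all)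

/-- Adding one to a binary number, least significant bit first. -/
def incL : List Bool → List Bool
  | [] => [true]
  | false :: l => true :: l
  | true :: l => false :: incL l

/-- Subtracting one from a binary number, least significant bit first. -/
def decL : List Bool → Option (List Bool)
  | [] => none
  | true :: l => some (false :: l)
  | false :: l => (decL l).map (true :: ·)

/-- The value of a binary number, least significant bit first. -/
def valL : List Bool → ℕ
  | [] => 0
  | b :: l => b.toNat + 2 * valL l

theorem valL_incL (l : List Bool) : valL (incL l) = valL l + 1 := by
  induction l with
  | nil => rfl
  | cons b l ih =>
    cases b <;> simp [incL, valL, ih]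
    · lia
    · lia

/-- The number gets longer only when a carry runs through all ones, and then the new value is a
power of two. This keeps the length logarithmic in the value. -/
theorem length_incL (l : List Bool) :
    (incL l).length = l.length ∨ (incL l).length = l.length + 1 ∧ valL l + 1 = 2 ^ l.length := by
  induction l with
  | nil => exact Or.inr ⟨rfl, rfl⟩
  | cons b l ih =>
    cases b
    · exact Or.inl rfl
    · rcases ih with ih | ⟨ih, ih'⟩
      · exact Or.inl (by simp [incL, ih])
      · refine Or.inr ⟨by simp [incL, ih], ?_⟩
        simp only [valL, Bool.toNat_true, List.length_cons, pow_succ]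
        lia

theorem decL_eq_some {l l' : List Bool} (h : decL l = some l') :
    l'.length = l.length ∧ valL l = valL l' + 1 := by
  induction l generalizing l' with
  | nil => simp [decL] at h
  | cons b l ih =>
    cases b
    · simp only [decL, Option.map_eq_some_iff] at h
      obtain ⟨m, hm, rfl⟩ := h
      obtain ⟨h1, h2⟩ := ih hm
      refine ⟨by simp [h1], ?_⟩
      simp only [valL, Bool.toNat_true, Bool.toNat_false]
      lia
    · obtain rfl := Option.some.inj h
      simp [valL]
      lia

/-- Leading zeros are kept, so a number equal to zero is a block of zeros; a failed subtraction is
undone by rewriting a block of this length. -/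
theorem decL_eq_none {l : List Bool} (h : decL l = none) :
    l = List.replicate l.length false ∧ valL l = 0 := by
  induction l with
  | nil => exact ⟨rfl, rfl⟩
  | cons b l ih =>
    cases b
    · simp only [decL, Option.map_eq_none_iff] at h
      obtain ⟨h1, h2⟩ := ih h
      exact ⟨by rw [List.length_cons, List.replicate_succ, ← h1], by simp [valL, h2]⟩
    · simp [decL] at h

/-- The tape that holds a binary number, with a mark in the first cell. -/
def tapeOf (l : List Bool) : ℕ → Sym
  | 0 => .mark
  | j + 1 => (l[j]?).elim .blank .bit

theorem tapeOf_append (l : List Bool) (b : Bool) (l' : List Bool) :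
    tapeOf (l ++ b :: l') (l.length + 1) = .bit b := by simp [tapeOf]

theorem tapeOf_length (l : List Bool) : tapeOf l (l.length + 1) = .blank := by simp [tapeOf]

theorem update_tapeOf (l : List Bool) (b b' : Bool) (l' : List Bool) :
    Function.update (tapeOf (l ++ b :: l')) (l.length + 1) (.bit b') = tapeOf (l ++ b' :: l') := by
  funext j
  by_cases h : j = l.length + 1
  · subst h
    simp [tapeOf]
  · rw [Function.update_of_ne h]
    cases j with
    | zero => rfl
    | succ j =>
      have hj : j ≠ l.length := fun h' => h (h' ▸ rfl)
      simp only [tapeOf]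
      rcases lt_or_gt_of_ne hj with hj | hj
      · rw [List.getElem?_append_left hj, List.getElem?_append_left hj]
      · rw [List.getElem?_append_right hj.le, List.getElem?_append_right hj.le]
        obtain ⟨m, hm⟩ : ∃ m, j - l.length = m + 1 := ⟨j - l.length - 1, by lia⟩
        simp [hm]

theorem update_tapeOf_length (l : List Bool) (b : Bool) :
    Function.update (tapeOf l) (l.length + 1) (.bit b) = tapeOf (l ++ [b]) := by
  funext j
  by_cases h : j = l.length + 1
  · subst h
    simp [tapeOf]
  · rw [Function.update_of_ne h]
    cases j with
    | zero => rfl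
    | succ j =>
      have hj : j ≠ l.length := fun h' => h (h' ▸ rfl)
      simp only [tapeOf]
      rcases lt_or_gt_of_ne hj with hj | hj
      · rw [List.getElem?_append_left hj]
      · rw [List.getElem?_eq_none (by lia), List.getElem?_eq_none (by simp; lia)]

theorem tapeOf_ne_mark (l : List Bool) (m : ℕ) : tapeOf l (m + 1) ≠ .mark := by
  simp only [tapeOf]
  cases l[m]? <;> simp

variable {A : Type u} {Lb : Type} {k : ℕ}

/-- The symbol read on tape `i`. -/
def rd (i : ℕ) (y : Fin k → Sym) : Sym := if h : i < k then y ⟨i, h⟩ else .blank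

/-- Writing and moving on tape `i` only. -/
def act (i : ℕ) (s : Sym) (m : Move) (y : Fin k → Sym) (t : Fin k) : Sym × Move :=
  if (t : ℕ) = i then (s, m) else (y t, .stay)

/-- Neither writing nor moving. -/
def idle (y : Fin k → Sym) (t : Fin k) : Sym × Move := (y t, .stay)

/-- The states of the Turing machine. -/
abbrev State (Lb : Type) := Option (Phase × Lb)

variable (prog : Lb → Instr A ℕ Lb) (start : Lb)

/-- The transition function of the Turing machine. -/
def delta : State Lb → InSym A → (Fin k → Sym) →
    Option (State Lb × Move × (Fin k → Sym × Move))
  | none, _, _ => some (some (.run, start), .right, fun _ => (.mark, .right))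
  | some (.run, ℓ), s, y =>
    match prog ℓ with
    | .goto ℓ' => some (some (.run, ℓ'), .stay, idle y)
    | .inc none ℓ₁ ℓ₂ =>
      match s with
      | .rightEnd => some (some (.run, ℓ₂), .stay, idle y)
      | _ => some (some (.run, ℓ₁), .right, idle y)
    | .inc (some _) _ _ => some (some (.carry, ℓ), .stay, idle y)
    | .dec none _ _ => some (some (.back, ℓ), .left, idle y)
    | .dec (some _) _ _ => some (some (.borrow, ℓ), .stay, idle y)
    | .read f =>
      match s with
      | .letter a => some (some (.run, f (some a)), .stay, idle y)
      | _ => some (some (.run, f none), .stay, idle y)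
    | .halt _ => none
  | some (.carry, ℓ), _, y =>
    match prog ℓ with
    | .inc (some i) _ _ =>
      match rd i y with
      | .bit true => some (some (.carry, ℓ), .stay, act i (.bit false) .right y)
      | _ => some (some (.rewind, ℓ), .stay, act i (.bit true) .left y)
    | _ => none
  | some (.rewind, ℓ), _, y =>
    match prog ℓ with
    | .inc (some i) ℓ₁ _ | .dec (some i) ℓ₁ _ =>
      match rd i y with
      | .mark => some (some (.run, ℓ₁), .stay, act i .mark .right y)
      | s => some (some (.rewind, ℓ), .stay, act i s .left y)
    | _ => none
  | some (.borrow, ℓ), _, y =>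
    match prog ℓ with
    | .dec (some i) _ _ =>
      match rd i y with
      | .bit false => some (some (.borrow, ℓ), .stay, act i (.bit true) .right y)
      | .bit true => some (some (.rewind, ℓ), .stay, act i (.bit false) .left y)
      | s => some (some (.restore, ℓ), .stay, act i s .left y)
    | _ => none
  | some (.restore, ℓ), _, y =>
    match prog ℓ with
    | .dec (some i) _ ℓ₂ =>
      match rd i y with
      | .mark => some (some (.run, ℓ₂), .stay, act i .mark .right y)
      | _ => some (some (.restore, ℓ), .stay, act i (.bit false) .left y)
    | _ => none
  | some (.back, ℓ), s, y =>
    match prog ℓ with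
    | .dec none ℓ₁ ℓ₂ =>
      match s with
      | .leftEnd => some (some (.run, ℓ₂), .right, idle y)
      | _ => some (some (.run, ℓ₁), .stay, idle y)
    | _ => none

variable (k) in
/-- The Turing machine for a register machine that uses the registers below `k`. -/
def machine [Finite Lb] : Machine A where
  k := k
  Q := State Lb
  finite_Q := inferInstance
  Γ := Sym
  finite_Γ := inferInstance
  blank := .blank
  start := none
  accept := {q | ∃ ℓ, q = some (.run, ℓ) ∧ prog ℓ = .halt true}
  δ := delta prog start

variable [Finite Lb]

variable (k) in
/-- Configurations of the Turing machine. -/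
abbrev Conf := (machine k prog start).Config

variable {prog start} in
theorem Conf.ext {q q' : State Lb} {p p' : ℕ} {x x' : Fin k → ℕ} {W W' : Fin k → ℕ → Sym}
    (hq : q = q') (hp : p = p') (hx : x = x') (hW : W = W') :
    (⟨q, p, x, W⟩ : Conf k prog start) = ⟨q', p', x', W'⟩ := by
  subst hq hp hx hW
  rfl

/-- One step that stays within space `s`. -/
def Good (w : List A) (s : ℕ) (c c' : Conf k prog start) : Prop :=
  (machine k prog start).step w c = some c' ∧ ∀ i, c'.workPos i < s

variable {prog start}

theorem Good.reaches {w : List A} {s : ℕ} {c c' : Conf k prog start}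
    (h : ReflTransGen (Good prog start w s) c c') :
    Reaches ((machine k prog start).step w) c c' := ReflTransGen.mono (fun _ _ h => h.1) _ _ h

/-- By determinism every reachable configuration lies on the given path to the halting one, and all
steps of that path respect the space bound. -/
theorem Good.workPos_lt {w : List A} {s : ℕ} {c c' d : Conf k prog start}
    (h : ReflTransGen (Good prog start w s) c c') (hc : ∀ i, c.workPos i < s)
    (hh : (machine k prog start).step w c' = none)
    (hd : Reaches ((machine k prog start).step w) c d) (i : Fin k) : d.workPos i < s := by
  induction h using ReflTransGen.head_induction_on with
  | refl =>
    rcases hd.cases_head with rfl | ⟨z, hz, -⟩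
    · exact hc i
    · rw [Option.mem_def, hh] at hz
      cases hz
  | head hs _ ih =>
    rcases hd.cases_head with rfl | ⟨z, hz, hzd⟩
    · exact hc i
    · rw [Option.mem_def, hs.1] at hz
      obtain rfl := Option.some.inj hz
      exact ih hs.2 hzd

/-- A configuration from its components. -/
def cfg (q : State Lb) (p : ℕ) (W : Fin k → ℕ → Sym) (x : Fin k → ℕ) : Conf k prog start :=
  ⟨q, p, x, W⟩

theorem good_idle {w : List A} {s : ℕ} {q q' : State Lb} {p : ℕ} {W : Fin k → ℕ → Sym}
    {x : Fin k → ℕ} {m : Move} (hx : ∀ i, x i < s)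
    (h : delta prog start q (Machine.inputAt w p) (fun i => W i (x i)) =
      some (q', m, idle fun i => W i (x i))) :
    Good prog start w s (cfg q p W x)
      (cfg q' (min (Machine.movePos m p) (w.length + 1)) W x) := by
  refine ⟨?_, hx⟩
  simp only [Machine.step, machine, cfg, h, Option.map_some, Option.some.injEq]
  exact congrArg some (Conf.ext (prog := prog) (start := start) rfl rfl rfl
    (funext fun i => Function.update_eq_self _ _))

theorem good_act {w : List A} {s : ℕ} {q q' : State Lb} {p : ℕ} (hp : p ≤ w.length + 1)
    {W : Fin k → ℕ → Sym} {x : Fin k → ℕ} {m : Move} {c : Sym} {i : Fin k}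
    (hx : ∀ i, x i < s) (hm : Machine.movePos m (x i) < s)
    (h : delta prog start q (Machine.inputAt w p) (fun i => W i (x i)) =
      some (q', .stay, act i c m fun i => W i (x i))) :
    Good prog start w s (cfg q p W x)
      (cfg q' p (Function.update W i (Function.update (W i) (x i) c))
        (Function.update x i (Machine.movePos m (x i)))) := by
  have h2 : ∀ j, j = i ∨ (j : ℕ) ≠ i := fun j => by
    rw [ne_eq, Fin.val_inj]
    exact em _
  refine ⟨?_, fun (j : Fin k) => ?_⟩
  · simp only [Machine.step, machine, cfg, h, Option.map_some, Option.some.injEq]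
    refine congrArg some (Conf.ext (prog := prog) (start := start) rfl (min_eq_left hp) ?_ ?_)
    · funext j
      rcases h2 j with rfl | hj
      · simp [act]
      · rw [Function.update_of_ne (by simpa [Fin.val_inj] using hj)]
        simp [act, hj, Machine.movePos]
    · funext j
      rcases h2 j with rfl | hj
      · simp [act]
      · rw [Function.update_of_ne (by simpa [Fin.val_inj] using hj)]
        simp [act, hj]
  · change Function.update x i (Machine.movePos m (x i)) j < s
    rcases eq_or_ne j i with rfl | hj
    · rwa [Function.update_self]
    · rw [Function.update_of_ne hj]
      exact hx j

/-- A configuration in which all work heads but that of tape `i` are in cell one. -/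
def at' (q : State Lb) (p : ℕ) (W : Fin k → ℕ → Sym) (i : Fin k) (l : List Bool) (x : ℕ) :
    Conf k prog start :=
  cfg q p (Function.update W i (tapeOf l)) (Function.update (fun _ => 1) i x)

-- Binary counting on a single work tape.

section Micro

variable {w : List A} {s : ℕ} {ℓ : Lb} {p : ℕ} (hp : p ≤ w.length + 1) {W : Fin k → ℕ → Sym}
  {i : Fin k}

include hp

/-- The transition is required for all readings `y` that agree with tape `i`, since the symbols on
the other tapes play no role. -/
theorem good_at {q q' : State Lb} {l l' : List Bool} {x x' : ℕ} {m : Move} {c : Sym}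
    (hs : 2 ≤ s) (hx : x < s) (hx' : Machine.movePos m x = x') (hx's : x' < s)
    (hc : Function.update (tapeOf l) x c = tapeOf l')
    (h : ∀ y, rd (k := k) i y = tapeOf l x → delta prog start q (Machine.inputAt w p) y =
      some (q', .stay, act i c m y)) :
    Good prog start w s (at' q p W i l x) (at' q' p W i l' x') := by
  subst hx'
  have := good_act (prog := prog) (start := start) (q := q) (q' := q') hp (s := s) (m := m) (c := c)
    (i := i) (W := Function.update W i (tapeOf l)) (x := Function.update (fun _ => 1) i x)
    (fun j => by
      by_cases hj : j = i
      · subst hj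
        simpa using hx
      · rw [Function.update_of_ne hj]
        exact hs) (by simpa using hx's) (h _ (by simp [rd]))
  simpa [at', hc] using this

theorem rewind_path {ℓ₁ : Lb} (hℓ : (∃ ℓ₂, prog ℓ = .inc (some i) ℓ₁ ℓ₂) ∨
      ∃ ℓ₂, prog ℓ = .dec (some i) ℓ₁ ℓ₂) (l : List Bool) (hl : l.length + 1 < s) (x : ℕ)
    (hx : x ≤ l.length + 1) :
    ReflTransGen (Good prog start w s) (at' (some (.rewind, ℓ)) p W i l x)
      (at' (some (.run, ℓ₁)) p W i l 1) := by
  induction x with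
  | zero =>
    refine .single (good_at hp (m := .right) (c := .mark) (by lia) (by lia) rfl (by lia)
      (Function.update_eq_self 0 _) fun y hy => ?_)
    have hy : rd i y = .mark := hy
    rcases hℓ with ⟨ℓ₂, hℓ⟩ | ⟨ℓ₂, hℓ⟩ <;> simp [delta, hℓ, hy]
  | succ x ih =>
    refine .head (good_at hp (m := .left) (c := tapeOf l (x + 1)) (x' := x) (by lia) (by lia) rfl
      (by lia)
      (Function.update_eq_self (x + 1) _) fun y hy => ?_) (ih (by lia))
    have := tapeOf_ne_mark l x
    rw [← hy] at this ⊢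
    rcases hℓ with ⟨ℓ₂, hℓ⟩ | ⟨ℓ₂, hℓ⟩ <;> simp only [delta, hℓ]

/-- `l` holds the bits already passed and `r` those still ahead. A one becomes a zero and joins `l`;
the first zero or blank becomes a one, and the head is rewound. -/
theorem carry_path {ℓ₁ ℓ₂ : Lb} (hℓ : prog ℓ = .inc (some i) ℓ₁ ℓ₂) (r l : List Bool)
    (hs : (l ++ r).length + 1 < s) (hs' : (l ++ incL r).length + 1 < s) :
    ReflTransGen (Good prog start w s) (at' (some (.carry, ℓ)) p W i (l ++ r) (l.length + 1))
      (at' (some (.run, ℓ₁)) p W i (l ++ incL r) 1) := by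
  induction r generalizing l with
  | nil =>
    refine .head (good_at hp (m := .left) (c := .bit true) (by lia) (by simpa using hs) rfl
      (by simp [Machine.movePos] at hs ⊢; lia) ?_ fun y hy => ?_)
      (rewind_path hp (Or.inl ⟨_, hℓ⟩) _ hs' _ ?_)
    · rw [List.append_nil]
      exact update_tapeOf_length l true
    · rw [List.append_nil, tapeOf_length] at hy
      simp [delta, hℓ, hy]
    · simp [Machine.movePos]
      lia
  | cons b r ih =>
    cases b
    · refine .head (good_at hp (m := .left) (c := .bit true) (by lia)
        (by simp at hs; lia) rfl (by simp [Machine.movePos] at hs ⊢; lia)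
        (update_tapeOf _ _ _ _) fun y hy => ?_) (rewind_path hp (Or.inl ⟨_, hℓ⟩) _ hs' _ ?_)
      · rw [tapeOf_append] at hy
        simp [delta, hℓ, hy]
      · simp [Machine.movePos]
        lia
    · have := ih (l ++ [false]) (by simpa using hs) (by simpa [incL] using hs')
      simp only [List.append_assoc, List.singleton_append, List.length_append,
        List.length_singleton] at this
      refine .head (good_at hp (m := .right) (c := .bit false) (by lia)
        (by simp at hs; lia) rfl (by simp [Machine.movePos] at hs ⊢; lia)
        (update_tapeOf _ _ _ _) fun y hy => ?_) this
      rw [tapeOf_append] at hy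
      simp [delta, hℓ, hy]

/-- On the way back, `a` ones written by the failed borrow remain and `b` bits are zeros again; the
mark in the first cell ends the phase. -/
theorem restore_path {ℓ₁ ℓ₂ : Lb} (hℓ : prog ℓ = .dec (some i) ℓ₁ ℓ₂) (a b : ℕ)
    (hs : a + b + 1 < s) :
    ReflTransGen (Good prog start w s)
      (at' (some (.restore, ℓ)) p W i (List.replicate a true ++ List.replicate b false) a)
      (at' (some (.run, ℓ₂)) p W i (List.replicate (a + b) false) 1) := by
  induction a generalizing b with
  | zero =>
    rw [Nat.zero_add, List.replicate_zero, List.nil_append]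
    refine .single (good_at hp (m := .right) (c := .mark) (by lia) (by lia) rfl (by lia)
      (Function.update_eq_self 0 _) fun y hy => ?_)
    have hy : rd i y = .mark := hy
    simp [delta, hℓ, hy]
  | succ a ih =>
    have h1 : List.replicate (a + 1) true ++ List.replicate b false =
        List.replicate a true ++ true :: List.replicate b false := by
      rw [List.replicate_succ', List.append_assoc]
      rfl
    have h2 : List.replicate a true ++ List.replicate (b + 1) false =
        List.replicate a true ++ false :: List.replicate b false := by
      rw [List.replicate_succ]
    have h3 := ih (b + 1) (by lia)
    rw [h2, show a + (b + 1) = a + 1 + b by lia] at h3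
    rw [h1]
    have h4 := update_tapeOf (List.replicate a true) true false (List.replicate b false)
    have h5 := tapeOf_append (List.replicate a true) true (List.replicate b false)
    rw [List.length_replicate] at h4 h5
    refine .head (good_at hp (m := .left) (c := .bit false) (by lia) (by lia) rfl
      (by simp [Machine.movePos]; lia) h4 fun y hy => ?_) h3
    rw [h5] at hy
    simp [delta, hℓ, hy]

/-- The `a` zeros passed so far have been rewritten as ones. Meeting a one completes the
subtraction; meeting the blank shows that the number was zero, and the ones must be turned back. -/
theorem borrow_path {ℓ₁ ℓ₂ : Lb} (hℓ : prog ℓ = .dec (some i) ℓ₁ ℓ₂) (r : List Bool) (a : ℕ)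
    (hs : a + r.length + 1 < s) :
    (∀ r', decL r = some r' → ReflTransGen (Good prog start w s)
      (at' (some (.borrow, ℓ)) p W i (List.replicate a true ++ r) (a + 1))
      (at' (some (.run, ℓ₁)) p W i (List.replicate a true ++ r') 1)) ∧
    (decL r = none → ReflTransGen (Good prog start w s)
      (at' (some (.borrow, ℓ)) p W i (List.replicate a true ++ r) (a + 1))
      (at' (some (.run, ℓ₂)) p W i (List.replicate (a + r.length) false) 1)) := by
  induction r generalizing a with
  | nil =>
    refine ⟨fun r' h => by simp [decL] at h, fun _ => ?_⟩
    have h1 := restore_path (start := start) (W := W) hp hℓ a 0 hs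
    have h2 := tapeOf_length (List.replicate a true)
    rw [List.length_replicate] at h2
    simp only [List.replicate_zero, List.append_nil] at h1 ⊢
    refine .head (good_at hp (m := .left) (c := tapeOf (List.replicate a true) (a + 1)) (by lia)
      hs rfl (by simp [Machine.movePos] at hs ⊢; lia) (Function.update_eq_self _ _)
      fun y hy => ?_) h1
    rw [h2] at hy ⊢
    simp [delta, hℓ, hy]
  | cons b r ih =>
    have h4 := fun b' => update_tapeOf (List.replicate a true) b b' r
    have h5 := tapeOf_append (List.replicate a true) b r
    rw [List.length_replicate] at h5
    simp only [List.length_replicate] at h4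
    rw [List.length_cons] at hs
    cases b
    · have h1 : ∀ r : List Bool, List.replicate (a + 1) true ++ r =
          List.replicate a true ++ true :: r := fun r => by
        rw [List.replicate_succ', List.append_assoc]
        rfl
      have hstep : Good prog start w s
          (at' (some (.borrow, ℓ)) p W i (List.replicate a true ++ false :: r) (a + 1))
          (at' (some (.borrow, ℓ)) p W i (List.replicate a true ++ true :: r) (a + 1 + 1)) := by
        refine good_at hp (m := .right) (c := .bit true) (by lia) (by lia) rfl
          (by lia) (h4 true) fun y hy => ?_
        rw [h5] at hy
        simp [delta, hℓ, hy]
      obtain ⟨ih1, ih2⟩ := ih (a + 1) (by lia)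
      simp only [h1] at ih1 ih2
      constructor
      · intro r' hr'
        simp only [decL, Option.map_eq_some_iff] at hr'
        obtain ⟨m, hm, rfl⟩ := hr'
        exact .head hstep (ih1 m hm)
      · intro hr
        simp only [decL, Option.map_eq_none_iff] at hr
        rw [show a + (false :: r).length = a + 1 + r.length by simp; lia]
        exact .head hstep (ih2 hr)
    · refine ⟨fun r' hr' => ?_, fun h => by simp [decL] at h⟩
      obtain rfl := Option.some.inj hr'
      refine .head (good_at hp (m := .left) (c := .bit false) (by lia) (by lia) rfl
        (by simp [Machine.movePos]; lia) (h4 false) fun y hy => ?_)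
        (rewind_path hp (Or.inr ⟨_, hℓ⟩) _ ?_ _ ?_)
      · rw [h5] at hy
        simp [delta, hℓ, hy]
      · simp
        lia
      · simp [Machine.movePos]
        lia

end Micro

/-- The Turing machine configuration represents the register machine configuration. -/
def Rep (w : List A) (c : Lb × Regs ℕ) (d : Conf k prog start) : Prop :=
  c.2 none ≤ w.length ∧ (∀ i, c.2 (some i) ≤ w.length) ∧ ∃ W : Fin k → List Bool,
    d = cfg (some (.run, c.1)) (c.2 none + 1) (fun i => tapeOf (W i)) (fun _ => 1) ∧
      ∀ i, valL (W i) = c.2 (some i) ∧ (W i).length ≤ Nat.log 2 w.length + 1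

theorem inputAt_lt {w : List A} {p : ℕ} (h : p < w.length) :
    Machine.inputAt w (p + 1) = .letter w[p] := by
  simp [Machine.inputAt, h]

theorem inputAt_ge {w : List A} {p : ℕ} (h : w.length ≤ p) :
    Machine.inputAt w (p + 1) = .rightEnd := by
  simp [Machine.inputAt, h]

/-- The instruction uses only registers below `k`. -/
def UsesBelow (k : ℕ) : Instr A ℕ Lb → Prop
  | .inc (some i) _ _ => i < k
  | .dec (some i) _ _ => i < k
  | _ => True

/-- A number has at most `log |w| + 1` bits behind the mark, so a head reaches at most the cell `log
|w| + 2`, below the bound used. Strictness keeps all registers at most `|w|`. -/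
theorem Rep.step (hk : ∀ ℓ, UsesBelow k (prog ℓ)) {w : List A} {c c' : Lb × Regs ℕ}
    {d : Conf k prog start} (hd : Rep w c d) (h : step prog true w c = some c') :
    ∃ d', ReflTransGen (Good prog start w (3 * (Nat.log 2 w.length + 1))) d d' ∧ Rep w c' d' := by
  obtain ⟨ℓ, r⟩ := c
  obtain ⟨hr0, hr, W, rfl, hW⟩ := hd
  dsimp only at hr0 hr hW h ⊢
  have hs : ∀ i : Fin k, (fun _ : Fin k => 1) i < 3 * (Nat.log 2 w.length + 1) := fun i => by
    dsimp only
    lia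
  have hmin : ∀ p, p ≤ w.length → min (p + 1) (w.length + 1) = p + 1 := fun p hp => by lia
  have hat : ∀ (q : State Lb) (i : Fin k) (W' : List Bool),
      at' q (r none + 1) (fun i => tapeOf (W i)) i W' 1 =
        (cfg q (r none + 1) (fun j => tapeOf (Function.update W i W' j)) fun _ => 1 :
          Conf k prog start) := by
    intro q i W'
    unfold at'
    congr 1
    · funext j
      by_cases hj : j = i
      · subst hj
        simp
      · simp [hj]
    · exact Function.update_eq_self i _
  have hself : ∀ i : Fin k, Function.update W i (W i) = W := fun i => Function.update_eq_self i W
  have hrep : ∀ (ℓ' : Lb) (i : Fin k) (W' : List Bool), valL W' ≤ w.length →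
      W'.length ≤ Nat.log 2 w.length + 1 →
      Rep w (ℓ', Function.update r (some ↑i) (valL W'))
        (cfg (some (.run, ℓ')) (r none + 1) (fun j => tapeOf (Function.update W i W' j)) fun _ => 1 :
          Conf k prog start) := by
    intro ℓ' i W' h1 h2
    refine ⟨by simpa using hr0, fun j => ?_, Function.update W i W', by simp, fun j => ?_⟩
    · by_cases hj : j = i
      · subst hj
        simpa using h1
      · simpa [hj] using hr j
    · by_cases hj : j = i
      · subst hj
        simpa using h2
      · have : (j : ℕ) ≠ i := by simpa [Fin.val_inj] using hj
        simpa [hj, this] using hW j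
  have hbound : ∀ i, (W i).length + 1 < 3 * (Nat.log 2 w.length + 1) := fun i => by
    have := (hW i).2
    lia
  have hkℓ := hk ℓ
  rw [RegMachine.step] at h
  dsimp only at h
  cases hi : prog ℓ with
  | goto ℓ' =>
    simp only [hi, Instr.exec, Option.some.injEq] at h
    subst h
    have := good_idle (prog := prog) (start := start) (w := w) (q := some (.run, ℓ))
      (q' := some (.run, ℓ')) (p := r none + 1) (W := fun i => tapeOf (W i)) (m := .stay) hs
      (by simp [delta, hi])
    rw [Machine.movePos, hmin _ hr0] at this
    exact ⟨_, .single this, hr0, hr, W, rfl, hW⟩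
  | inc i ℓ₁ ℓ₂ =>
    cases i with
    | none =>
      simp only [hi, Instr.exec] at h
      split_ifs at h with h1
      · obtain rfl := Option.some.inj h
        have := good_idle (prog := prog) (start := start) (w := w) (q := some (.run, ℓ))
          (q' := some (.run, ℓ₁)) (p := r none + 1) (W := fun i => tapeOf (W i)) (m := .right) hs
          (by simp [delta, hi, inputAt_lt h1])
        rw [Machine.movePos, hmin _ h1] at this
        exact ⟨_, .single this, by simpa using h1, by simpa using hr, W, by simp, by simpa using hW⟩
      · obtain rfl := Option.some.inj h
        have := good_idle (prog := prog) (start := start) (w := w) (q := some (.run, ℓ))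
          (q' := some (.run, ℓ₂)) (p := r none + 1) (W := fun i => tapeOf (W i)) (m := .stay) hs
          (by simp [delta, hi, inputAt_ge (not_lt.1 h1)])
        rw [Machine.movePos, hmin _ hr0] at this
        exact ⟨_, .single this, hr0, hr, W, rfl, hW⟩
    | some i =>
      rw [hi] at hkℓ
      obtain ⟨i, rfl⟩ : ∃ j : Fin k, (j : ℕ) = i := ⟨⟨i, hkℓ⟩, rfl⟩
      simp only [hi, Instr.exec] at h
      split_ifs at h with h1 h2
      · obtain rfl := Option.some.inj h
        have h3 := good_idle (prog := prog) (start := start) (w := w) (q := some (.run, ℓ))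
          (q' := some (.carry, ℓ)) (p := r none + 1) (W := fun i => tapeOf (W i)) (m := .stay) hs
          (by simp [delta, hi])
        rw [Machine.movePos, hmin _ hr0] at h3
        -- If the length grows, then `2 ^ length` is the new value, which is at most `|w|`; so the
        -- old length is at most the logarithm.
        have hlen : (incL (W i)).length ≤ Nat.log 2 w.length + 1 := by
          rcases length_incL (W i) with h4 | ⟨h4, h5⟩
          · exact h4.trans_le (hW i).2
          · rw [h4]
            refine Nat.succ_le_succ (Nat.le_log_of_pow_le (by lia) ?_)
            rw [← h5, (hW i).1]
            exact h1
        have h4 := carry_path (start := start) (w := w) (W := fun i => tapeOf (W i))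
          (s := 3 * (Nat.log 2 w.length + 1))
          (p := r none + 1) (by lia) hi (W i) [] (hbound i)
          (by simp; lia)
        simp only [List.nil_append, List.length_nil, Nat.zero_add, hat, hself] at h4
        have h5 := hrep ℓ₁ i (incL (W i)) (by rw [valL_incL, (hW i).1]; exact h1) hlen
        rw [valL_incL, (hW i).1] at h5
        exact ⟨_, .head h3 h4, h5⟩
      -- A strict machine would be stuck here, so the full register never has to be detected on the
      -- tape.
      · exact (h2 ⟨trivial, by simp⟩).elim
  | dec i ℓ₁ ℓ₂ =>
    cases i with
    | none =>
      simp only [hi, Instr.exec] at h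
      -- Position `p` is the input cell `p + 1`. Moving left first reveals `p = 0` by the endmarker,
      -- in which case the head moves back.
      have h3 := good_idle (prog := prog) (start := start) (w := w) (q := some (.run, ℓ))
        (q' := some (.back, ℓ)) (p := r none + 1) (W := fun i => tapeOf (W i)) (m := .left) hs
        (by simp [delta, hi])
      rw [Machine.movePos, Nat.add_sub_cancel, min_eq_left (by lia)] at h3
      split_ifs at h with h1
      · obtain rfl := Option.some.inj h
        have := good_idle (prog := prog) (start := start) (w := w) (q := some (.back, ℓ))
          (q' := some (.run, ℓ₂)) (p := r none) (W := fun i => tapeOf (W i)) (m := .right) hs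
          (by simp [delta, hi, h1, Machine.inputAt])
        rw [Machine.movePos, hmin _ hr0] at this
        exact ⟨_, .head h3 (.single this), hr0, hr, W, rfl, hW⟩
      · obtain rfl := Option.some.inj h
        have hin : Machine.inputAt w (r none) = .letter (w[r none - 1]'(by lia)) := by
          conv_lhs => rw [show r none = r none - 1 + 1 by lia]
          exact inputAt_lt _
        have := good_idle (prog := prog) (start := start) (w := w) (q := some (.back, ℓ))
          (q' := some (.run, ℓ₁)) (p := r none) (W := fun i => tapeOf (W i)) (m := .stay) hs
          (by simp [delta, hi, hin])
        rw [Machine.movePos, min_eq_left (by lia)] at this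
        refine ⟨_, .head h3 (.single this), ?_, by simpa using hr, W, ?_, by simpa using hW⟩
        · simp
          lia
        · simp
          rw [Nat.sub_add_cancel (by lia)]
    | some i =>
      rw [hi] at hkℓ
      obtain ⟨i, rfl⟩ : ∃ j : Fin k, (j : ℕ) = i := ⟨⟨i, hkℓ⟩, rfl⟩
      simp only [hi, Instr.exec] at h
      have h3 := good_idle (prog := prog) (start := start) (w := w) (q := some (.run, ℓ))
        (q' := some (.borrow, ℓ)) (p := r none + 1) (W := fun i => tapeOf (W i)) (m := .stay) hs
        (by simp [delta, hi])
      rw [Machine.movePos, hmin _ hr0] at h3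
      obtain ⟨h4, h5⟩ := borrow_path (start := start) (w := w) (W := fun i => tapeOf (W i))
          (s := 3 * (Nat.log 2 w.length + 1))
          (p := r none + 1) (by lia) hi (W i) 0 (by simpa using hbound i)
      simp only [List.nil_append, List.length_nil, Nat.zero_add, hat, hself,
        List.replicate_zero] at h4 h5
      cases hdec : decL (W i) with
      | none =>
        obtain ⟨h6, h7⟩ := decL_eq_none hdec
        rw [(hW i).1] at h7
        simp only [h7, if_true, Option.some.injEq] at h
        subst h
        have h8 := h5 hdec
        rw [← h6] at h8
        simp only [hself] at h8
        exact ⟨_, .head h3 h8, hr0, hr, W, rfl, hW⟩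
      | some l =>
        obtain ⟨h6, h7⟩ := decL_eq_some hdec
        rw [(hW i).1] at h7
        rw [if_neg (by lia)] at h
        obtain rfl := Option.some.inj h
        have h8 := hrep ℓ₁ i l (by have := hr i; lia) (by rw [h6]; exact (hW i).2)
        rw [h7, Nat.add_sub_cancel]
        exact ⟨_, .head h3 (h4 l hdec), h8⟩
  | read f =>
    simp only [hi, Instr.exec, Option.some.injEq] at h
    subst h
    have := good_idle (prog := prog) (start := start) (w := w) (q := some (.run, ℓ))
      (q' := some (.run, f w[r none]?)) (p := r none + 1) (W := fun i => tapeOf (W i))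
      (m := .stay) hs (by
        rcases lt_or_ge (r none) w.length with h1 | h1
        · simp [delta, hi, inputAt_lt h1, h1]
        · simp [delta, hi, inputAt_ge h1, h1])
    rw [Machine.movePos, hmin _ hr0] at this
    exact ⟨_, .single this, hr0, hr, W, rfl, hW⟩
  | halt b => simp [hi, Instr.exec] at h

theorem Rep.reaches (hk : ∀ ℓ, UsesBelow k (prog ℓ)) {w : List A} {c c' : Lb × Regs ℕ}
    {d : Conf k prog start} (hd : Rep w c d) (h : Reaches (RegMachine.step prog true w) c c') :
    ∃ d', ReflTransGen (Good prog start w (3 * (Nat.log 2 w.length + 1))) d d' ∧ Rep w c' d' := by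
  induction h with
  | refl => exact ⟨d, .refl, hd⟩
  | tail _ hs ih =>
    obtain ⟨d₁, h1, h2⟩ := ih
    obtain ⟨d₂, h3, h4⟩ := h2.step hk hs
    exact ⟨d₂, h1.trans h3, h4⟩

/-- The initial step marks the first work cells and moves every head to cell one; zero is the empty
list of bits. -/
theorem rep_init (w : List A) : ∃ d : Conf k prog start,
    Good prog start w (3 * (Nat.log 2 w.length + 1)) (machine k prog start).init d ∧
      Rep w (start, fun _ => 0) d := by
  refine ⟨cfg (some (.run, start)) 1 (fun i => tapeOf []) fun _ => 1, ⟨?_, fun i => ?_⟩,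
    Nat.zero_le _, fun _ => Nat.zero_le _, fun _ => [], rfl, fun i => ⟨rfl, Nat.zero_le _⟩⟩
  · simp only [Machine.step, Machine.init, machine, delta, Option.map_some, Option.some.injEq, cfg]
    refine congrArg some (Conf.ext (prog := prog) (start := start) rfl
      (min_eq_left (Nat.succ_le_succ (Nat.zero_le _))) rfl ?_)
    funext i j
    cases j with
    | zero => simp [tapeOf]
    | succ j => simp [tapeOf]
  · simp only [cfg]
    lia

end RegMachine.Tape

namespace RegMachine

open LogSpace Relation StateTransition Tape

universe u

/-- A language that is decided by a register machine is in deterministic logarithmic space. -/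
theorem mem_logspace {A : Type u} {Lb : Type} [Finite Lb] (prog : Lb → Instr A ℕ Lb) (start : Lb)
    (L : Language A) (h : ∀ w, Answers prog true w (start, fun _ => 0) (w ∈ L)) :
    L ∈ LOGSPACE A := by
  -- Finitely many labels mention finitely many registers, so finitely many tapes suffice.
  obtain ⟨k, hk⟩ : ∃ k, ∀ ℓ, UsesBelow k (prog ℓ) := by
    have h1 : ∀ ℓ, ∃ k, ∀ k', k ≤ k' → UsesBelow k' (prog ℓ) := by
      intro ℓ
      rcases prog ℓ with _ | ⟨_ | i, _, _⟩ | ⟨_ | i, _, _⟩ | _ | _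
      case inc.some | dec.some => exact ⟨i + 1, fun k' hk => hk⟩
      all_goals exact ⟨0, fun _ _ => trivial⟩
    choose f hf using h1
    obtain ⟨M, hM⟩ := (Set.finite_range f).bddAbove
    exact ⟨M, fun ℓ => hf ℓ M (hM ⟨ℓ, rfl⟩)⟩
  have key : ∀ w, ∃ d : Conf k prog start,
      ReflTransGen (Good prog start w (3 * (Nat.log 2 w.length + 1)))
        (machine k prog start).init d ∧ (machine k prog start).step w d = none ∧
        (d.state ∈ (machine k prog start).accept ↔ w ∈ L) := by
    intro w
    obtain ⟨c', b, hr, hb, hp⟩ := h w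
    obtain ⟨d₀, h0, h1⟩ := rep_init (k := k) (prog := prog) (start := start) w
    obtain ⟨d, h2, h3⟩ := h1.reaches hk hr
    refine ⟨d, .head h0 h2, ?_, ?_⟩
    · obtain ⟨-, -, W, rfl, -⟩ := h3
      simp [Machine.step, machine, cfg, delta, hb]
    · obtain ⟨-, -, W, rfl, -⟩ := h3
      rw [← hp]
      constructor
      · rintro ⟨ℓ, h4, h5⟩
        simp only [cfg, Option.some.injEq, Prod.mk.injEq, true_and] at h4
        rw [← h4, hb] at h5
        simpa using h5
      · rintro rfl
        exact ⟨_, rfl, hb⟩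
  refine ⟨machine k prog start, fun w => ?_, 3, fun w c hc i => ?_⟩
  · obtain ⟨d, h1, h2, h3⟩ := key w
    exact ⟨d, Good.reaches h1, h2, h3⟩
  · obtain ⟨d, h1, h2, -⟩ := key w
    exact Good.workPos_lt h1 (fun i => by simp [Machine.init]) h2 hc i

end RegMachine


/-! # Programs over numbers with several digits -/

namespace RegMachine.Cmd

open Relation StateTransition

universe u

variable {A : Type u} {F κ : Type} [DecidableEq κ] {w : List A}

/-- The program that does nothing. -/
def skip : Cmd A F κ := assign id

theorem Runs.skip {strict : Bool} {σ : F × Regs κ} : (skip : Cmd A F κ).Runs strict w σ σ :=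
  Runs.assign id

theorem Runs.drain_skip {strict : Bool} (f : F) (v : Regs κ) (i : Option κ) :
    (drain i Cmd.skip : Cmd A F κ).Runs strict w (f, v) (f, Function.update v i 0) := by
  induction h : v i generalizing v with
  | zero =>
    rw [← h, Function.update_eq_self]
    exact Runs.drain_zero h
  | succ k ih =>
    have := ih (Function.update v i (v i - 1)) (by simp [h])
    rw [Function.update_idem] at this
    exact Runs.drain_pos (by simp [h]) Runs.skip this

theorem Runs.fill_skip {strict : Bool} {i : Option κ} (hs : strict = false ∨ i = none) (f : F)
    (v : Regs κ) (hv : v i ≤ w.length) :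
    (fill i Cmd.skip : Cmd A F κ).Runs strict w (f, v) (f, Function.update v i w.length) := by
  obtain ⟨k, hk⟩ := Nat.exists_eq_add_of_le hv
  induction k generalizing v with
  | zero =>
    rw [show w.length = v i by simpa using hk, Function.update_eq_self]
    exact Runs.fill_ge hs (by dsimp only; lia)
  | succ k ih =>
    have := ih (Function.update v i (v i + 1)) (by simp; lia) (by simp; lia)
    rw [Function.update_idem] at this
    exact Runs.fill_lt (by dsimp only; lia) Runs.skip this

/-- The number whose digits in base `n + 1` are held by the given registers. -/
def num (n : ℕ) (v : Regs κ) : List κ → ℕ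
  | [] => 0
  | d :: ds => v (some d) + (n + 1) * num n v ds

theorem num_congr {n : ℕ} {v v' : Regs κ} {ds : List κ} (h : ∀ d ∈ ds, v (some d) = v' (some d)) :
    num n v ds = num n v' ds := by
  induction ds with
  | nil => rfl
  | cons d ds ih =>
    rw [num, num, h d List.mem_cons_self, ih fun x hx => h x (List.mem_cons_of_mem _ hx)]

theorem num_update {n : ℕ} {v : Regs κ} {d : κ} {ds : List κ} (h : d ∉ ds) (x : ℕ) :
    num n (Function.update v (some d) x) ds = num n v ds :=
  num_congr fun y hy => Function.update_of_ne (fun h' => h (by rw [← Option.some.inj h']; exact hy)) _ _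

/-- Adding one to a number. -/
def incM : List κ → Cmd A F κ
  | [] => skip
  | d :: ds => inc (some d) skip (seq (drain (some d) skip) (incM ds))

/-- Subtracting one from a number and running the first program, or running the second one if the
number is zero. -/
def decM : List κ → Cmd A F κ → Cmd A F κ → Cmd A F κ
  | [], _, c₂ => c₂
  | d :: ds, c₁, c₂ => dec (some d) c₁ (decM ds (seq (fill (some d) skip) c₁) c₂)

/-- A full digit is cleared and the carry is passed on; the bound excludes a carry beyond the last
digit. -/
theorem runs_incM (f : F) (ds : List κ) (hd : ds.Nodup) (v : Regs κ) (hv : ∀ i, v i ≤ w.length)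
    (h : num w.length v ds + 1 < (w.length + 1) ^ ds.length) :
    ∃ v', (incM ds : Cmd A F κ).Runs false w (f, v) (f, v') ∧
      num w.length v' ds = num w.length v ds + 1 ∧ (∀ i, i ∉ ds.map some → v' i = v i) ∧
      ∀ i, v' i ≤ w.length := by
  induction ds generalizing v with
  | nil => simp [num] at h
  | cons d ds ih =>
    obtain ⟨hd1, hd2⟩ := List.nodup_cons.1 hd
    by_cases hlt : v (some d) < w.length
    · refine ⟨_, Runs.inc_lt hlt Runs.skip, ?_, ?_, ?_⟩
      · simp only [num, Function.update_self, num_update hd1]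
        lia
      · intro i hi
        exact Function.update_of_ne (by rintro rfl; simp at hi) _ _
      · intro i
        by_cases hi : i = some d
        · subst hi
          simpa using hlt
        · simpa [hi] using hv i
    · have heq : v (some d) = w.length := le_antisymm (hv _) (not_lt.1 hlt)
      obtain ⟨v', h1, h2, h3, h4⟩ := ih hd2 (Function.update v (some d) 0)
        (by
          intro i
          by_cases hi : i = some d
          · simp [hi]
          · simpa [hi] using hv i)
        (by
          -- The lowest digit equals `n`, so the bound reads `(n + 1) (N + 1) < (n + 1) ^ (k + 1)`
          -- with `N` the remaining number and `k` its number of digits; a factor cancels.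
          rw [num_update hd1]
          simp only [num, heq, List.length_cons, pow_succ] at h
          have : (w.length + 1) * (num w.length v ds + 1) <
              (w.length + 1) * (w.length + 1) ^ ds.length := by lia
          exact lt_of_mul_lt_mul_left this (Nat.zero_le _))
      have hd' : v' (some d) = 0 := by
        rw [h3 (some d) (by simpa using hd1), Function.update_self]
      refine ⟨v', Runs.inc_ge (Or.inl rfl) (not_lt.1 hlt) (Runs.seq (Runs.drain_skip f v _) h1),
        ?_, ?_, h4⟩
      · simp only [num, h2, hd', num_update hd1, heq]
        lia
      · intro i hi
        simp only [List.map_cons, List.mem_cons, not_or] at hi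
        rw [h3 i hi.2, Function.update_of_ne hi.1]

/-- Refilling zero digits is deferred to the successful branch, so the registers are untouched if
the number is zero. -/
theorem runs_decM_zero {f : F} {ds : List κ} {v : Regs κ} (h : num w.length v ds = 0)
    {c₁ c₂ : Cmd A F κ} {τ : F × Regs κ} (hc : c₂.Runs false w (f, v) τ) :
    (decM ds c₁ c₂).Runs false w (f, v) τ := by
  induction ds generalizing c₁ with
  | nil => exact hc
  | cons d ds ih =>
    simp only [num, Nat.add_eq_zero_iff, Nat.mul_eq_zero] at h
    exact Runs.dec_zero h.1 (ih (by lia))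

/-- The resulting registers `v'` do not depend on the continuations. A zero digit borrows from the
higher ones and becomes `n`. -/
theorem runs_decM_pos (f : F) (ds : List κ) (hd : ds.Nodup) (v : Regs κ)
    (hv : ∀ i, v i ≤ w.length) (h : num w.length v ds ≠ 0) :
    ∃ v', num w.length v' ds = num w.length v ds - 1 ∧ (∀ i, i ∉ ds.map some → v' i = v i) ∧
      (∀ i, v' i ≤ w.length) ∧ ∀ (c₁ c₂ : Cmd A F κ) (τ : F × Regs κ),
        c₁.Runs false w (f, v') τ → (decM ds c₁ c₂).Runs false w (f, v) τ := by
  induction ds with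
  | nil => simp [num] at h
  | cons d ds ih =>
    obtain ⟨hd1, hd2⟩ := List.nodup_cons.1 hd
    by_cases hz : v (some d) = 0
    · obtain ⟨v', h1, h2, h3, h4⟩ := ih hd2 (by simpa [num, hz] using h)
      refine ⟨Function.update v' (some d) w.length, ?_, ?_, ?_, fun c₁ c₂ τ hτ => ?_⟩
      · simp only [num, Function.update_self, num_update hd1, h1, hz]
        obtain ⟨x, hx⟩ : ∃ x, num w.length v ds = x + 1 :=
          Nat.exists_eq_succ_of_ne_zero (by simpa [num, hz] using h)
        rw [hx, Nat.add_sub_cancel, Nat.mul_add, mul_one]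
        lia
      · intro i hi
        simp only [List.map_cons, List.mem_cons, not_or] at hi
        rw [Function.update_of_ne hi.1, h2 i hi.2]
      · intro i
        by_cases hi : i = some d
        · simp [hi]
        · simpa [hi] using h3 i
      · exact Runs.dec_zero hz (h4 _ _ _ (Runs.seq
          (Runs.fill_skip (Or.inl rfl) f v' (h3 _)) hτ))
    · refine ⟨Function.update v (some d) (v (some d) - 1), ?_, ?_, ?_, fun c₁ c₂ τ hτ => ?_⟩
      · simp only [num, Function.update_self, num_update hd1]
        lia
      · intro i hi
        exact Function.update_of_ne (by rintro rfl; simp at hi) _ _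
      · intro i
        have := hv i
        by_cases hi : i = some d
        · subst hi
          simp
          lia
        · simpa [hi] using hv i
      · exact Runs.dec_pos hz hτ

end RegMachine.Cmd

-- Execution rules for programs on numbers in base `|w| + 1`.

namespace RegMachine.Numbers

open Cmd

universe u

variable {A : Type u} {G S : Type} [DecidableEq S] {m : ℕ} {w : List A}

/-- The registers for the digits of a number. -/
def regs (m : ℕ) (s : S) : List (S × Fin m) := (List.finRange m).map (s, ·)

theorem length_regs (s : S) : (regs m s).length = m := by simp [regs]

theorem mem_regs {s : S} {d : S × Fin m} : d ∈ regs m s ↔ d.1 = s := by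
  obtain ⟨t, j⟩ := d
  simp [regs, eq_comm]

theorem nodup_regs (s : S) : (regs m s).Nodup :=
  (List.nodup_finRange m).map fun _ _ h => (Prod.mk.inj h).2

/-- The registers represent the given numbers and the given position of the input head. -/
def Rep (w : List A) (v : Regs (S × Fin m)) (X : S → ℕ) (p : ℕ) : Prop :=
  (∀ s, num w.length v (regs m s) = X s) ∧ (∀ i, v i ≤ w.length) ∧ v none = p

/-- Programs with a flag in the finite memory. -/
abbrev NCmd (A : Type u) (G S : Type) (m : ℕ) := Cmd A (Bool × G) (S × Fin m)

/-- The memory: the flag, the finite memory, the numbers and the position of the input head. -/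
abbrev NState (G S : Type) := (Bool × G) × (S → ℕ) × ℕ

/-- Running a program on represented numbers. -/
def NRuns (w : List A) (c : NCmd A G S m) (σ τ : NState G S) : Prop :=
  ∀ v, Rep w v σ.2.1 σ.2.2 →
    ∃ v', Rep w v' τ.2.1 τ.2.2 ∧ c.Runs false w (σ.1, v) (τ.1, v')

variable {a b : NCmd A G S m} {σ τ υ : NState G S} {p : Bool × G → Bool}

theorem NRuns.assign (g : Bool × G → Bool × G) :
    NRuns w (assign g : NCmd A G S m) σ (g σ.1, σ.2) :=
  fun v hv => ⟨v, hv, Runs.assign g⟩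

theorem NRuns.skip : NRuns w (skip : NCmd A G S m) σ σ := NRuns.assign id

theorem NRuns.read (g : Option A → Bool × G → Bool × G) :
    NRuns w (read g : NCmd A G S m) σ (g w[σ.2.2]? σ.1, σ.2) :=
  fun v hv => ⟨v, hv, by
    have := Runs.read (A := A) (strict := false) (w := w) (σ := (σ.1, v)) g
    have h2 : v none = σ.2.2 := hv.2.2
    dsimp only at this
    rwa [h2] at this⟩

theorem NRuns.seq (ha : NRuns w a σ τ) (hb : NRuns w b τ υ) : NRuns w (seq a b) σ υ :=
  fun v hv => by
    obtain ⟨v', hv', h1⟩ := ha v hv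
    obtain ⟨v'', hv'', h2⟩ := hb v' hv'
    exact ⟨v'', hv'', h1.seq h2⟩

theorem NRuns.ite_true (hp : p σ.1 = true) (h : NRuns w a σ τ) : NRuns w (ite p a b) σ τ :=
  fun v hv => by
    obtain ⟨v', hv', h1⟩ := h v hv
    exact ⟨v', hv', .ite_true hp h1⟩

theorem NRuns.ite_false (hp : p σ.1 = false) (h : NRuns w b σ τ) : NRuns w (ite p a b) σ τ :=
  fun v hv => by
    obtain ⟨v', hv', h1⟩ := h v hv
    exact ⟨v', hv', .ite_false hp h1⟩

theorem NRuns.loop_true (hp : p σ.1 = true) (h : NRuns w a σ τ) (h' : NRuns w (loop p a) τ υ) :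
    NRuns w (loop p a) σ υ :=
  fun v hv => by
    obtain ⟨v', hv', h1⟩ := h v hv
    obtain ⟨v'', hv'', h2⟩ := h' v' hv'
    exact ⟨v'', hv'', .loop_true hp h1 h2⟩

theorem NRuns.loop_false (hp : p σ.1 = false) : NRuns w (loop p a) σ σ :=
  fun v hv => ⟨v, hv, .loop_false hp⟩

theorem Rep.update_none {v : Regs (S × Fin m)} {X : S → ℕ} {p : ℕ} (h : Rep w v X p) {q : ℕ}
    (hq : q ≤ w.length) : Rep w (Function.update v none q) X q := by
  refine ⟨fun s => ?_, fun i => ?_, by simp⟩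
  · rw [← h.1 s]
    exact num_congr fun d _ => by simp
  · cases i with
    | none => simpa using hq
    | some i => simpa using h.2.1 (some i)

theorem NRuns.inc_lt {f : Bool × G} {X : S → ℕ} {p : ℕ} (hp : p < w.length)
    (h : NRuns w a (f, X, p + 1) τ) : NRuns w (inc none a b) (f, X, p) τ :=
  fun v hv => by
    obtain ⟨v', hv', h1⟩ := h _ (hv.update_none hp)
    have h2 : v none = p := hv.2.2
    rw [← h2] at h1 hp
    exact ⟨v', hv', .inc_lt hp h1⟩

theorem NRuns.inc_ge {f : Bool × G} {X : S → ℕ} {p : ℕ} (hp : w.length ≤ p)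
    (h : NRuns w b (f, X, p) τ) : NRuns w (inc none a b) (f, X, p) τ :=
  fun v hv => by
    obtain ⟨v', hv', h1⟩ := h _ hv
    have h2 : v none = p := hv.2.2
    rw [← h2] at hp
    exact ⟨v', hv', .inc_ge (Or.inl rfl) hp h1⟩

theorem NRuns.dec_pos {f : Bool × G} {X : S → ℕ} {p : ℕ} (hp : p ≠ 0)
    (h : NRuns w a (f, X, p - 1) τ) : NRuns w (dec none a b) (f, X, p) τ :=
  fun v hv => by
    have h2 : v none = p := hv.2.2
    obtain ⟨v', hv', h1⟩ := h _ (hv.update_none (q := p - 1) (by have := hv.2.1 none; lia))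
    rw [← h2] at h1 hp
    exact ⟨v', hv', .dec_pos hp h1⟩

theorem NRuns.dec_zero {f : Bool × G} {X : S → ℕ}
    (h : NRuns w b (f, X, 0) τ) : NRuns w (dec none a b) (f, X, 0) τ :=
  fun v hv => by
    obtain ⟨v', hv', h1⟩ := h _ hv
    exact ⟨v', hv', .dec_zero hv.2.2 h1⟩

/-- Distinct numbers occupy disjoint blocks of registers, and none of them contains the input head.
-/
theorem Rep.update {v v' : Regs (S × Fin m)} {X : S → ℕ} {p : ℕ} (h : Rep w v X p) {s : S} {x : ℕ}
    (hx : num w.length v' (regs m s) = x) (h' : ∀ i, i ∉ (regs m s).map some → v' i = v i)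
    (hb : ∀ i, v' i ≤ w.length) : Rep w v' (Function.update X s x) p := by
  refine ⟨fun t => ?_, hb, (h' none (by simp)).trans h.2.2⟩
  by_cases ht : t = s
  · subst ht
    simpa using hx
  · rw [Function.update_of_ne ht, ← h.1 t]
    refine num_congr fun d hd => h' _ fun hd' => ht ?_
    have hd2 : d ∈ regs m s := by simpa using hd'
    exact (mem_regs.1 hd).symm.trans (mem_regs.1 hd2)

/-- Adding one to a number. -/
def incS (s : S) : NCmd A G S m := incM (regs m s)

theorem nruns_incS {f : Bool × G} {X : S → ℕ} {p : ℕ} {s : S}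
    (h : X s + 1 < (w.length + 1) ^ m) :
    NRuns w (incS s : NCmd A G S m) (f, X, p) (f, Function.update X s (X s + 1), p) :=
  fun v hv => by
    obtain ⟨v', h1, h2, h3, h4⟩ := runs_incM (w := w) f (regs m s) (nodup_regs s) v hv.2.1
      (by rw [hv.1, length_regs]; exact h)
    rw [hv.1] at h2
    exact ⟨v', hv.update h2 h3 h4, h1⟩

/-- Adding a constant to a number. -/
def addS (s : S) : ℕ → NCmd A G S m
  | 0 => skip
  | k + 1 => seq (incS s) (addS s k)

theorem nruns_addS {f : Bool × G} {X : S → ℕ} {p : ℕ} {s : S} {k : ℕ}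
    (h : X s + k < (w.length + 1) ^ m) :
    NRuns w (addS s k : NCmd A G S m) (f, X, p) (f, Function.update X s (X s + k), p) := by
  induction k generalizing X with
  | zero =>
    rw [Nat.add_zero, Function.update_eq_self]
    exact NRuns.skip
  | succ k ih =>
    have := ih (X := Function.update X s (X s + 1)) (by simp; lia)
    rw [Function.update_idem, Function.update_self, show X s + 1 + k = X s + (k + 1) by lia] at this
    exact (nruns_incS (by lia)).seq this

/-- The loop of `drainS`. -/
def loopS (s : S) (c : NCmd A G S m) : NCmd A G S m :=
  loop Prod.fst (decM (regs m s) c (assign fun f => (false, f.2)))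

/-- Counting a number down to zero and running the program each time. -/
def drainS (s : S) (c : NCmd A G S m) : NCmd A G S m :=
  seq (assign fun f => (true, f.2)) (loopS s c)

/-- The flag keeps the loop running; the zero branch of `decM` resets it. -/
theorem nruns_loopS_zero {g : G} {X : S → ℕ} {p : ℕ} {s : S} {c : NCmd A G S m} (h : X s = 0) :
    NRuns w (loopS s c) ((true, g), X, p) ((false, g), X, p) :=
  fun v hv => ⟨v, hv, .loop_true (τ := ((false, g), v)) rfl
    (runs_decM_zero ((hv.1 s).trans h) (Runs.assign _)) (.loop_false rfl)⟩

theorem nruns_loopS_pos {g : G} {X : S → ℕ} {p : ℕ} {s : S} {c : NCmd A G S m} (h : X s ≠ 0)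
    (hc : NRuns w c ((true, g), Function.update X s (X s - 1), p) τ)
    (h' : NRuns w (loopS s c) τ υ) : NRuns w (loopS s c) ((true, g), X, p) υ :=
  fun v hv => by
    obtain ⟨v', h1, h2, h3, h4⟩ := runs_decM_pos (A := A) (w := w) (true, g) (regs m s)
      (nodup_regs s) v hv.2.1 (by rw [hv.1]; exact h)
    rw [hv.1] at h1
    obtain ⟨v₂, hv₂, h5⟩ := hc v' (hv.update h1 h2 h3)
    obtain ⟨v₃, hv₃, h6⟩ := h' v₂ hv₂
    exact ⟨v₃, hv₃, .loop_true rfl (h4 _ _ _ h5) h6⟩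

/-- Moving a number, with a factor, to another one. -/
def pour (s t : S) (k : ℕ) : NCmd A G S m := drainS s (addS t k)

/-- Each round takes one from `s` and adds `k` to `t`, so `X t + k * X s` is invariant and bounds
all intermediate values. -/
theorem nruns_pour {f : Bool × G} {X : S → ℕ} {p : ℕ} {s t : S} {k : ℕ} (hst : s ≠ t)
    (h : X t + k * X s < (w.length + 1) ^ m) :
    NRuns w (pour s t k : NCmd A G S m) (f, X, p)
      ((false, f.2), Function.update (Function.update X s 0) t (X t + k * X s), p) := by
  refine NRuns.seq (NRuns.assign _) ?_
  dsimp only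
  induction hx : X s generalizing X with
  | zero =>
    rw [← hx, Function.update_eq_self, hx, Nat.mul_zero, Nat.add_zero, Function.update_eq_self]
    exact nruns_loopS_zero hx
  | succ x ih =>
    rw [hx, Nat.mul_add, mul_one] at h
    refine nruns_loopS_pos (by simp [hx]) (nruns_addS ?_) ?_
    · rw [Function.update_of_ne hst.symm]
      lia
    · have := ih (X := Function.update (Function.update X s (X s - 1)) t (X t + k))
        (by simp [hst, hx]; lia) (by simp [hst, hx])
      have h2 : Function.update (Function.update (Function.update (Function.update X s (X s - 1)) t
          (X t + k)) s 0) t (X t + k + k * x) =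
          Function.update (Function.update X s 0) t (X t + k * (x + 1)) := by
        rw [Function.update_comm hst.symm, Function.update_idem, Function.update_idem]
        congr 1
        lia
      simp only [Function.update_self, h2] at this
      rw [Function.update_of_ne hst.symm]
      exact this

end RegMachine.Numbers


/-! # Simulating Turing machines with programs over numbers -/

namespace RegMachine.Numbers

open Cmd LogSpace

universe u

variable {A : Type u} {S H : Type} [DecidableEq S] {m g : ℕ} {w : List A}

/-- Programs over numbers with a digit in the finite memory. -/
abbrev DCmd (A : Type u) (g : ℕ) (H S : Type) (m : ℕ) := NCmd A (Fin (g + 1) × H) (Option S) m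

/-- Changing the digit. -/
def onDigit (u : Fin (g + 1) → Fin (g + 1)) : DCmd A g H S m :=
  assign fun f => (f.1, u f.2.1, f.2.2)

/-- The digit after `d`, cyclically. -/
def nextDigit (d : Fin (g + 1)) : Fin (g + 1) :=
  if h : d.val + 1 < g + 1 then ⟨d.val + 1, h⟩ else 0

/-- The digit before `d`. -/
def prevDigit (d : Fin (g + 1)) : Fin (g + 1) := ⟨d.val - 1, by lia⟩

/-- Dividing by `g + 1`; the remainder becomes the digit. -/
def pop (s : S) : DCmd A g H S m :=
  seq (onDigit fun _ => 0) <| seq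
    (drainS (some s) (seq (onDigit nextDigit) (ite (fun f => decide (f.2.1 = 0)) (incS none) skip)))
    (pour none (some s) 1)

/-- Multiplying by `g + 1` and adding the digit. -/
def push (s : S) : DCmd A g H S m :=
  seq (pour (some s) none 1) <| seq (pour none (some s) (g + 1)) <|
    loop (fun f => decide (f.2.1 ≠ 0)) (seq (onDigit prevDigit) (incS (some s)))

theorem nruns_push_loop {fl : Bool} {d : Fin (g + 1)} {h : H} {X : Option S → ℕ} {p : ℕ} {s : S}
    (hb : X (some s) + d < (w.length + 1) ^ m) :
    NRuns w (loop (fun f => decide (f.2.1 ≠ 0)) (seq (onDigit prevDigit) (incS (some s))) :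
      DCmd A g H S m) ((fl, d, h), X, p)
      ((fl, 0, h), Function.update X (some s) (X (some s) + d), p) := by
  obtain ⟨n, hn⟩ : ∃ n, d.val = n := ⟨_, rfl⟩
  induction n generalizing d X with
  | zero =>
    obtain rfl : d = 0 := Fin.ext hn
    rw [Fin.val_zero, Nat.add_zero (X (some s)), Function.update_eq_self]
    exact NRuns.loop_false (by simp)
  | succ n ih =>
    refine NRuns.loop_true (by simpa using fun h0 : d = 0 => by simp [h0] at hn)
      ((NRuns.assign _).seq (nruns_incS (by lia))) ?_
    have := ih (d := prevDigit d) (X := Function.update X (some s) (X (some s) + 1))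
      (by simp [prevDigit]; lia) (by simp [prevDigit, hn])
    rw [Function.update_idem, Function.update_self] at this
    rwa [show X (some s) + d = X (some s) + 1 + (prevDigit d).val by simp [prevDigit, hn]; lia]

/-- The multiplication consists of two transfers through the scratch number `none`, which is zero
before and after; the final value bounds everything on the way. -/
theorem nruns_push {fl : Bool} {d : Fin (g + 1)} {h : H} {X : Option S → ℕ} {p : ℕ} {s : S}
    (h0 : X none = 0) (hb : d + (g + 1) * X (some s) < (w.length + 1) ^ m) :
    NRuns w (push s : DCmd A g H S m) ((fl, d, h), X, p)
      ((false, 0, h), Function.update X (some s) (d + (g + 1) * X (some s)), p) := by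
  have hle : X (some s) ≤ (g + 1) * X (some s) := Nat.le_mul_of_pos_left _ (by lia)
  have h1 := nruns_pour (A := A) (w := w) (m := m) (f := (fl, d, h)) (X := X) (p := p) (s := some s)
    (t := none) (k := 1) (by simp) (by lia)
  rw [h0, Nat.zero_add, one_mul] at h1
  have h2 := nruns_pour (A := A) (w := w) (m := m) (f := (false, d, h))
    (X := Function.update (Function.update X (some s) 0) none (X (some s))) (p := p) (s := none)
    (t := some s) (k := g + 1) (by simp) (by simp; lia)
  simp only [Function.update_self, ne_eq, reduceCtorEq, not_false_eq_true, Function.update_of_ne,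
    Nat.zero_add, Function.update_idem] at h2
  have h3 := nruns_push_loop (A := A) (w := w) (m := m) (fl := false) (d := d) (h := h)
    (X := Function.update X (some s) ((g + 1) * X (some s))) (p := p) (s := s) (by simp; lia)
  have e : Function.update (Function.update (Function.update X (some s) 0) none 0) (some s)
      ((g + 1) * X (some s)) = Function.update X (some s) ((g + 1) * X (some s)) := by
    funext t
    rcases t with - | t
    · simp [h0]
    · by_cases ht : t = s <;> simp [ht]
  rw [e] at h2
  rw [Function.update_idem, Function.update_self, Nat.add_comm _ d.val] at h3
  exact h1.seq (h2.seq h3)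

/-- While the number is counted down, the digit counts up cyclically and the scratch number counts
the returns to zero: remainder and quotient of division by `g + 1`. -/
theorem nruns_pop_loop {d : Fin (g + 1)} {h : H} {X : Option S → ℕ} {p : ℕ} {s : S}
    (hb : X none + X (some s) < (w.length + 1) ^ m) :
    NRuns w (loopS (some s) (seq (onDigit nextDigit)
      (ite (fun f => decide (f.2.1 = 0)) (incS none) skip)) : DCmd A g H S m) ((true, d, h), X, p)
      ((false, ⟨(d + X (some s)) % (g + 1), Nat.mod_lt _ (Nat.succ_pos g)⟩, h),
        Function.update (Function.update X (some s) 0) none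
          (X none + (d + X (some s)) / (g + 1)), p) := by
  obtain ⟨n, hn⟩ : ∃ n, X (some s) = n := ⟨_, rfl⟩
  induction n generalizing d X with
  | zero =>
    have h1 := nruns_loopS_zero (A := A) (w := w) (g := (d, h)) (p := p)
      (c := (seq (onDigit nextDigit)
        (ite (fun f => decide (f.2.1 = 0)) (incS none) skip) : DCmd A g H S m)) hn
    have e : Function.update (Function.update X (some s) 0) none
        (X none + (d + X (some s)) / (g + 1)) = X := by
      rw [hn, Nat.add_zero, Nat.div_eq_of_lt d.2, Nat.add_zero, ← hn, Function.update_eq_self,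
        Function.update_eq_self]
    rw [e]
    simp only [hn, Nat.add_zero, Nat.mod_eq_of_lt d.2]
    exact h1
  | succ n ih =>
    by_cases hd : d.val + 1 < g + 1
    · have hne : nextDigit d ≠ 0 := by
        simp only [nextDigit, hd, dite_true, ne_eq, Fin.ext_iff]
        simp
      have hv : (nextDigit d).val = d + 1 := by simp [nextDigit, hd]
      have h1 := ih (d := nextDigit d) (X := Function.update X (some s) (X (some s) - 1))
        (by simp; lia) (by simp [hn])
      simp only [Function.update_self, Function.update_idem, hv, ne_eq, reduceCtorEq,
        not_false_eq_true, Function.update_of_ne,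
        show d.val + 1 + (X (some s) - 1) = d + X (some s) by lia] at h1
      exact nruns_loopS_pos (by lia) ((NRuns.assign _).seq
        (NRuns.ite_false (by simpa using hne) NRuns.skip)) h1
    · have hd0 : nextDigit d = 0 := by simp only [nextDigit, hd, dite_false]
      have hv : (nextDigit d).val = 0 := by rw [hd0]; rfl
      have hdg : d.val = g := by have := d.2; lia
      have h1 := ih (d := nextDigit d) (X := Function.update (Function.update X (some s)
        (X (some s) - 1)) none (X none + 1)) (by simp; lia) (by simp [hn])
      simp only [Function.update_self, hv, ne_eq, reduceCtorEq,
        not_false_eq_true, Function.update_of_ne] at h1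
      have e1 : (0 + (X (some s) - 1)) % (g + 1) = (d + X (some s)) % (g + 1) := by
        rw [show d.val + X (some s) = 0 + (X (some s) - 1) + (g + 1) by lia, Nat.add_mod_right]
      have e2 : X none + 1 + (0 + (X (some s) - 1)) / (g + 1) =
          X none + (d + X (some s)) / (g + 1) := by
        rw [show d.val + X (some s) = 0 + (X (some s) - 1) + (g + 1) by lia,
          Nat.add_div_right _ (Nat.succ_pos g)]
        lia
      have e3 : ∀ z, Function.update (Function.update (Function.update (Function.update X (some s)
          (X (some s) - 1)) none (X none + 1)) (some s) 0) none z =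
          Function.update (Function.update X (some s) 0) none z := by
        intro z
        funext t
        rcases t with - | t
        · simp
        · by_cases ht : t = s <;> simp [ht]
      simp only [e1, e2, e3] at h1
      refine nruns_loopS_pos (by lia) ((NRuns.assign _).seq
        (NRuns.ite_true (by simpa using hd0) (nruns_incS ?_))) ?_
      · simp
        lia
      · simpa using h1

theorem nruns_pop {fl : Bool} {d : Fin (g + 1)} {h : H} {X : Option S → ℕ} {p : ℕ} {s : S}
    (h0 : X none = 0) (hb : X (some s) < (w.length + 1) ^ m) :
    NRuns w (pop s : DCmd A g H S m) ((fl, d, h), X, p)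
      ((false, ⟨X (some s) % (g + 1), Nat.mod_lt _ (Nat.succ_pos g)⟩, h),
        Function.update X (some s) (X (some s) / (g + 1)), p) := by
  have h1 := nruns_pop_loop (A := A) (w := w) (m := m) (d := (0 : Fin (g + 1))) (h := h) (X := X)
    (p := p) (s := s) (by lia)
  simp only [Fin.val_zero, Nat.zero_add, h0] at h1
  have hle : X (some s) / (g + 1) ≤ X (some s) := Nat.div_le_self _ _
  have h2 := nruns_pour (A := A) (w := w) (m := m)
    (f := (false, (⟨X (some s) % (g + 1), Nat.mod_lt _ (Nat.succ_pos g)⟩ : Fin (g + 1)), h))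
    (X := Function.update (Function.update X (some s) 0) none (X (some s) / (g + 1))) (p := p)
    (s := none) (t := some s) (k := 1) (by simp) (by simp; lia)
  have e : Function.update (Function.update (Function.update (Function.update X (some s) 0) none
      (X (some s) / (g + 1))) none 0) (some s) (X (some s) / (g + 1)) =
      Function.update X (some s) (X (some s) / (g + 1)) := by
    funext t
    rcases t with - | t
    · simp [h0]
    · by_cases ht : t = s <;> simp [ht]
  simp only [Function.update_self, ne_eq, reduceCtorEq, not_false_eq_true, Function.update_of_ne,
    Nat.zero_add, one_mul, e] at h2
  exact (NRuns.assign _).seq (((NRuns.assign _).seq h1).seq h2)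

end RegMachine.Numbers


-- Turing machine configurations as numbers, and the simulation of a run.

namespace RegMachine.OfMachine

open Cmd LogSpace Numbers StateTransition Relation

universe u

variable {A : Type u} {M : Machine A} {g m : ℕ} {w : List A}

/-- The finite memory of the simulation: the state, whether the input head is on the left
endmarker, the symbols under the work heads and the next transition. -/
structure Mem (M : Machine A) where
  /-- the state -/
  q : M.Q
  /-- whether the input head is on the left endmarker -/
  left : Bool
  /-- the symbols under the work heads -/
  syms : Fin M.k → M.Γ
  /-- the next transition -/
  res : Option (M.Q × Move × (Fin M.k → M.Γ × Move))

theorem finite_move : Finite Move :=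
  Finite.of_injective (fun mv => (match mv with | .left => 0 | .stay => 1 | .right => 2 : Fin 3))
    (by rintro (_ | _ | _) (_ | _ | _) h <;> simp at h ⊢)

theorem finite_mem (M : Machine A) : Finite (Mem M) := by
  have := M.finite_Q
  have := M.finite_Γ
  have := finite_move
  refine Finite.of_injective (fun h : Mem M => (h.q, h.left, h.syms, h.res)) ?_
  rintro ⟨q, l, s, r⟩ ⟨q', l', s', r'⟩ h
  simp only [Prod.mk.injEq] at h
  obtain ⟨rfl, rfl, rfl, rfl⟩ := h
  rfl

/-- Work tape symbols as nonzero digits. -/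
structure Code (M : Machine A) (g : ℕ) where
  /-- the digit of a symbol -/
  code : M.Γ → Fin (g + 1)
  /-- the symbol of a digit -/
  decode : Fin (g + 1) → M.Γ
  decode_code : ∀ a, decode (code a) = a
  code_ne : ∀ a, code a ≠ 0
  decode_zero : decode 0 = M.blank

/-- Shifting the codes by one reserves digit zero for the bottom of a stack, which reads as an
unvisited, hence blank, cell. -/
theorem exists_code (M : Machine A) : ∃ g, Nonempty (Code M g) := by
  have := M.finite_Γ
  obtain ⟨g, ⟨e⟩⟩ := Finite.exists_equiv_fin M.Γ
  exact ⟨g, ⟨⟨fun a => (e a).succ, Fin.cases M.blank e.symm, by simp, fun a => Fin.succ_ne_zero _,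
    rfl⟩⟩⟩

variable (E : Code M g)

/-- A stack as a number. -/
def Code.enc : List M.Γ → ℕ
  | [] => 0
  | a :: l => E.code a + (g + 1) * Code.enc l

theorem enc_lt (l : List M.Γ) : E.enc l < (g + 1) ^ l.length := by
  induction l with
  | nil => simp [Code.enc]
  | cons a l ih =>
    have h1 := (E.code a).2
    have h2 : (g + 1) * (E.enc l + 1) ≤ (g + 1) * (g + 1) ^ l.length := Nat.mul_le_mul_left _ ih
    rw [Code.enc, List.length_cons, pow_succ']
    lia

/-- A number that encodes a stack of at most the given height is represented. -/
theorem enc_lt_of_le {s : ℕ} (hs : (g + 1) ^ s ≤ (w.length + 1) ^ m) {l : List M.Γ}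
    (hl : l.length ≤ s) : E.enc l < (w.length + 1) ^ m :=
  (enc_lt E l).trans_le ((Nat.pow_le_pow_right (Nat.succ_pos g) hl).trans hs)

variable {H S : Type} [DecidableEq S]

theorem nruns_push_enc {fl : Bool} {a : M.Γ} {l : List M.Γ} {h : H} {X : Option S → ℕ} {p : ℕ}
    {s : S} (h0 : X none = 0) (hX : X (some s) = E.enc l)
    (hb : E.enc (a :: l) < (w.length + 1) ^ m) :
    NRuns w (push s : DCmd A g H S m) ((fl, E.code a, h), X, p)
      ((false, 0, h), Function.update X (some s) (E.enc (a :: l)), p) := by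
  rw [Code.enc, ← hX] at hb ⊢
  exact nruns_push h0 hb

theorem nruns_pop_cons {fl : Bool} {d : Fin (g + 1)} {a : M.Γ} {l : List M.Γ} {h : H}
    {X : Option S → ℕ} {p : ℕ} {s : S} (h0 : X none = 0) (hX : X (some s) = E.enc (a :: l))
    (hb : X (some s) < (w.length + 1) ^ m) :
    NRuns w (pop s : DCmd A g H S m) ((fl, d, h), X, p)
      ((false, E.code a, h), Function.update X (some s) (E.enc l), p) := by
  have := nruns_pop (g := g) (fl := fl) (d := d) (h := h) (p := p) h0 hb
  have e1 : X (some s) / (g + 1) = E.enc l := by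
    rw [hX, Code.enc, Nat.add_mul_div_left _ _ (Nat.succ_pos g), Nat.div_eq_of_lt (E.code a).2,
      Nat.zero_add]
  have e2 : (⟨X (some s) % (g + 1), Nat.mod_lt _ (Nat.succ_pos g)⟩ : Fin (g + 1)) = E.code a := by
    apply Fin.ext
    simp only [hX, Code.enc, Nat.add_mul_mod_self_left]
    exact Nat.mod_eq_of_lt (E.code a).2
  rwa [e1, e2] at this

/-- The number zero is the empty stack. Dividing it leaves digit zero, which codes no symbol, so
emptiness can be recognized. -/
theorem nruns_pop_nil {fl : Bool} {d : Fin (g + 1)} {h : H}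
    {X : Option S → ℕ} {p : ℕ} {s : S} (h0 : X none = 0) (hX : X (some s) = 0) :
    NRuns w (pop s : DCmd A g H S m) ((fl, d, h), X, p) ((false, 0, h), X, p) := by
  have := nruns_pop (A := A) (w := w) (m := m) (g := g) (fl := fl) (d := d) (h := h) (p := p)
    (s := s) h0 (by rw [hX]; positivity)
  have e1 : Function.update X (some s) (X (some s) / (g + 1)) = X := by
    rw [hX, Nat.zero_div, ← hX, Function.update_eq_self]
  have e2 : (⟨X (some s) % (g + 1), Nat.mod_lt _ (Nat.succ_pos g)⟩ : Fin (g + 1)) = 0 := by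
    apply Fin.ext
    simp [hX]
  rwa [e1, e2] at this

/-- A work tape is represented by the symbol under the head and the stacks on both sides. -/
def TapeRep (s : ℕ) (h : M.Γ) (x y pos : ℕ) (tape : ℕ → M.Γ) : Prop :=
  ∃ l r, x = E.enc l ∧ y = E.enc r ∧ pos = l.length ∧ l.length + r.length < s ∧
    ∀ j, tape j = (l.reverse ++ h :: r)[j]?.getD M.blank

variable {E}

theorem TapeRep.eq {s : ℕ} {h : M.Γ} {x y pos : ℕ} {tape : ℕ → M.Γ}
    (ht : TapeRep E s h x y pos tape) : tape pos = h := by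
  obtain ⟨l, r, -, -, rfl, -, hj⟩ := ht
  rw [hj, List.getElem?_append_right (by simp)]
  simp

theorem update_tape {l r : List M.Γ} {h a : M.Γ} {tape : ℕ → M.Γ}
    (ht : ∀ j, tape j = (l.reverse ++ h :: r)[j]?.getD M.blank) (j : ℕ) :
    Function.update tape l.length a j = (l.reverse ++ a :: r)[j]?.getD M.blank := by
  rcases lt_trichotomy j l.length with hj | rfl | hj
  · rw [Function.update_of_ne hj.ne, ht, List.getElem?_append_left (by simpa using hj),
      List.getElem?_append_left (by simpa using hj)]
  · rw [Function.update_self, List.getElem?_append_right (by simp)]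
    simp
  · obtain ⟨k, rfl⟩ := Nat.exists_eq_add_of_lt hj
    rw [Function.update_of_ne hj.ne', ht, List.getElem?_append_right (by simp; lia),
      List.getElem?_append_right (by simp; lia), List.length_reverse,
      show l.length + k + 1 - l.length = k + 1 by lia, List.getElem?_cons_succ,
      List.getElem?_cons_succ]

/-- Whether a move is to the right. -/
def isRight : Move → Bool
  | .right => true
  | _ => false

/-- Whether a move is to the left. -/
def isLeft : Move → Bool
  | .left => true
  | _ => false

/-- The finite memory with a new symbol under a work head. -/
def Mem.write (h : Mem M) (i : Fin M.k) (a : M.Γ) : Mem M :=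
  { h with syms := Function.update h.syms i a }

/-- Programs of the simulation. -/
abbrev SCmd (M : Machine A) (g m : ℕ) := DCmd A g (Mem M) (Fin M.k × Bool) m

variable (E)

/-- The action on a work tape. -/
def tapeCmd (m : ℕ) (i : Fin M.k) : SCmd M g m :=
  seq (assign fun f => (f.1, f.2.2.res.elim 0 fun r => E.code (r.2.2 i).1, f.2.2)) <| seq
    (ite (fun f => f.2.2.res.elim false fun r => isRight (r.2.2 i).2)
      (seq (push (i, false)) (pop (i, true)))
      (ite (fun f => f.2.2.res.elim false fun r => isLeft (r.2.2 i).2)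
        (seq (push (i, true)) (seq (pop (i, false))
          (ite (fun f => decide (f.2.1 = 0)) (pop (i, true)) skip)))
        skip))
    (assign fun f => (f.1, f.2.1, f.2.2.write i (E.decode f.2.1)))

/-- A move pushes the written symbol onto the stack behind the head and pops the next symbol from
the stack ahead. The space bound `s` limits the heights of the stacks and so the numbers. -/
theorem nruns_tapeCmd {s : ℕ} (hs : (g + 1) ^ s ≤ (w.length + 1) ^ m) {fl : Bool}
    {d : Fin (g + 1)} {h : Mem M} {X : Option (Fin M.k × Bool) → ℕ} {p pos : ℕ} {i : Fin M.k}
    {tape : ℕ → M.Γ} (h0 : X none = 0) {r : M.Q × Move × (Fin M.k → M.Γ × Move)}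
    (hr : h.res = some r)
    (ht : TapeRep E s (h.syms i) (X (some (i, false))) (X (some (i, true))) pos tape)
    (hp : Machine.movePos (r.2.2 i).2 pos < s) :
    ∃ fl' d' a X', NRuns w (tapeCmd E m i) ((fl, d, h), X, p) ((fl', d', h.write i a), X', p) ∧
      X' none = 0 ∧ (∀ j b, j ≠ i → X' (some (j, b)) = X (some (j, b))) ∧
      TapeRep E s a (X' (some (i, false))) (X' (some (i, true)))
        (Machine.movePos (r.2.2 i).2 pos) (Function.update tape pos (r.2.2 i).1) := by
  obtain ⟨l, t, hl, ht, rfl, hlt, hj⟩ := ht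
  generalize hc : (r.2.2 i).1 = c
  have hup := update_tape (a := c) hj
  have hstart : NRuns w (assign fun f => (f.1, f.2.2.res.elim 0 fun r => E.code (r.2.2 i).1,
      f.2.2) : SCmd M g m) ((fl, d, h), X, p) ((fl, E.code c, h), X, p) := by
    have := NRuns.assign (A := A) (w := w) (S := Option (Fin M.k × Bool)) (m := m)
      (G := Fin (g + 1) × Mem M) (σ := ((fl, d, h), X, p))
      (fun f => (f.1, f.2.2.res.elim 0 fun r => E.code (r.2.2 i).1, f.2.2))
    simpa only [hr, Option.elim, hc] using this
  have hpush : E.enc (c :: l) < (w.length + 1) ^ m := enc_lt_of_le E hs (by simp; lia)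
  have hpush' : E.enc (c :: t) < (w.length + 1) ^ m := enc_lt_of_le E hs (by simp; lia)
  cases hmv : (r.2.2 i).2 with
  | right =>
    have h1 := nruns_push_enc (h := h) (p := p) (fl := fl) E h0 hl hpush
    rw [hmv] at hp
    simp only [Machine.movePos] at hp ⊢
    cases t with
    -- The head enters an unexplored cell: the empty stack gives digit zero, which decodes to the
    -- blank.
    | nil =>
      have h2 := nruns_pop_nil (A := A) (w := w) (m := m) (fl := false) (d := (0 : Fin (g + 1)))
        (h := h) (X := Function.update X (some (i, false)) (E.enc (c :: l))) (p := p)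
        (s := (i, true)) (by simpa using h0) (by simpa [Code.enc] using ht)
      refine ⟨false, 0, M.blank, Function.update X (some (i, false)) (E.enc (c :: l)), hstart.seq ((NRuns.ite_true (by simp [hr, hmv, isRight])
        (h1.seq h2)).seq ?_), by simpa using h0, fun j b hne => by simp [hne], c :: l, [],
        by simp, by simpa using ht, by simp, by simpa using hp, fun j => ?_⟩
      · have := NRuns.assign (A := A) (w := w) (m := m) (G := Fin (g + 1) × Mem M)
          (σ := ((false, 0, h), Function.update X (some (i, false)) (E.enc (c :: l)), p))
          (fun f => (f.1, f.2.1, f.2.2.write i (E.decode f.2.1)))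
        simpa only [E.decode_zero] using this
      · rw [hup, List.reverse_cons, List.append_assoc, List.singleton_append]
        rcases lt_trichotomy j (l.length + 1) with hj | rfl | hj
        · rw [show l.reverse ++ [c, M.blank] = l.reverse ++ [c] ++ [M.blank] by simp,
            List.getElem?_append_left (l₂ := [M.blank]) (by simpa using hj)]
        · simp
        · rw [List.getElem?_eq_none (by simp; lia), List.getElem?_eq_none (by simp; lia)]
    | cons a t =>
      have hb : E.enc (a :: t) < (w.length + 1) ^ m := enc_lt_of_le E hs (by simp at hlt ⊢; lia)
      have h2 := nruns_pop_cons (A := A) (w := w) (m := m) (fl := false) (d := (0 : Fin (g + 1)))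
        (h := h) (X := Function.update X (some (i, false)) (E.enc (c :: l))) (p := p)
        (s := (i, true)) E (a := a) (l := t) (by simpa using h0) (by simpa using ht)
        (by simpa [ht] using hb)
      refine ⟨false, E.code a, a, Function.update (Function.update X (some (i, false)) (E.enc (c :: l)))
        (some (i, true)) (E.enc t), hstart.seq ((NRuns.ite_true (by simp [hr, hmv, isRight])
        (h1.seq h2)).seq ?_), by simpa using h0, fun j b hne => by simp [hne], c :: l, t,
        by simp, by simp, by simp, by simp at hlt ⊢; lia, fun j => ?_⟩
      · have := NRuns.assign (A := A) (w := w) (m := m) (G := Fin (g + 1) × Mem M)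
          (σ := ((false, E.code a, h), Function.update (Function.update X (some (i, false))
            (E.enc (c :: l))) (some (i, true)) (E.enc t), p))
          (fun f => (f.1, f.2.1, f.2.2.write i (E.decode f.2.1)))
        simpa only [E.decode_code] using this
      · rw [hup]
        simp
  | left =>
    have h1 := nruns_push_enc (h := h) (p := p) (fl := fl) E h0 ht hpush'
    simp only [Machine.movePos]
    cases l with
    -- A left move in the first cell leaves the head where it is. The empty left stack is recognized
    -- by digit zero, and the symbol just pushed on the right is popped again.
    | nil =>
      have h2 := nruns_pop_nil (A := A) (w := w) (m := m) (fl := false) (d := (0 : Fin (g + 1)))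
        (h := h) (X := Function.update X (some (i, true)) (E.enc (c :: t))) (p := p)
        (s := (i, false)) (by simpa using h0) (by simpa [Code.enc] using hl)
      have h3 := nruns_pop_cons (A := A) (w := w) (m := m) (fl := false) (d := (0 : Fin (g + 1)))
        (h := h) (X := Function.update X (some (i, true)) (E.enc (c :: t))) (p := p)
        (s := (i, true)) E (a := c) (l := t) (by simpa using h0) (by simp)
        (by simpa using hpush')
      refine ⟨false, E.code c, c, Function.update (Function.update X (some (i, true)) (E.enc (c :: t)))
        (some (i, true)) (E.enc t), hstart.seq ((NRuns.ite_false (by simp [hr, hmv, isRight])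
        (NRuns.ite_true (by simp [hr, hmv, isLeft])
        (h1.seq (h2.seq (NRuns.ite_true (by simp) h3))))).seq ?_), by simpa using h0,
        fun j b hne => by simp [hne], [], t,
        by simpa using hl, by simp, by simp, hlt, fun j => ?_⟩
      · have := NRuns.assign (A := A) (w := w) (m := m) (G := Fin (g + 1) × Mem M)
          (σ := ((false, E.code c, h), Function.update (Function.update X (some (i, true))
            (E.enc (c :: t))) (some (i, true)) (E.enc t), p))
          (fun f => (f.1, f.2.1, f.2.2.write i (E.decode f.2.1)))
        simpa only [E.decode_code] using this
      · rw [hup]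
    | cons a l =>
      have hb : E.enc (a :: l) < (w.length + 1) ^ m := enc_lt_of_le E hs (by simp at hlt ⊢; lia)
      have h2 := nruns_pop_cons (A := A) (w := w) (m := m) (fl := false) (d := (0 : Fin (g + 1)))
        (h := h) (X := Function.update X (some (i, true)) (E.enc (c :: t))) (p := p)
        (s := (i, false)) E (a := a) (l := l) (by simpa using h0) (by simpa using hl)
        (by simpa [hl] using hb)
      refine ⟨false, E.code a, a, Function.update (Function.update X (some (i, true)) (E.enc (c :: t)))
        (some (i, false)) (E.enc l), hstart.seq ((NRuns.ite_false (by simp [hr, hmv, isRight])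
        (NRuns.ite_true (by simp [hr, hmv, isLeft])
        (h1.seq (h2.seq (NRuns.ite_false (by simpa using E.code_ne a) NRuns.skip))))).seq ?_),
        by simpa using h0, fun j b hne => by simp [hne], l, c :: t,
        by simp, by simp, by simp, by simp at hlt ⊢; lia, fun j => ?_⟩
      · have := NRuns.assign (A := A) (w := w) (m := m) (G := Fin (g + 1) × Mem M)
          (σ := ((false, E.code a, h), Function.update (Function.update X (some (i, true))
            (E.enc (c :: t))) (some (i, false)) (E.enc l), p))
          (fun f => (f.1, f.2.1, f.2.2.write i (E.decode f.2.1)))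
        simpa only [E.decode_code] using this
      · rw [hup]
        simp
  | stay =>
    refine ⟨fl, E.code c, c, X, hstart.seq ((NRuns.ite_false (by simp [hr, hmv, isRight])
      (NRuns.ite_false (by simp [hr, hmv, isLeft]) NRuns.skip)).seq ?_), h0, fun _ _ _ => rfl,
      l, t, hl, ht, rfl, hlt, hup⟩
    have := NRuns.assign (A := A) (w := w) (m := m) (G := Fin (g + 1) × Mem M)
      (σ := ((fl, E.code c, h), X, p)) (fun f => (f.1, f.2.1, f.2.2.write i (E.decode f.2.1)))
    simpa only [E.decode_code] using this

/-- The action on some of the work tapes. -/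
def tapesCmd (m : ℕ) : List (Fin M.k) → SCmd M g m
  | [] => skip
  | i :: is => seq (tapeCmd E m i) (tapesCmd m is)

/-- The tapes in the list are still in the old state, all others already in the new one. -/
theorem nruns_tapesCmd {s : ℕ} (hs : (g + 1) ^ s ≤ (w.length + 1) ^ m)
    {r : M.Q × Move × (Fin M.k → M.Γ × Move)} {pos : Fin M.k → ℕ} {tape : Fin M.k → ℕ → M.Γ}
    (hp : ∀ i, Machine.movePos (r.2.2 i).2 (pos i) < s) (is : List (Fin M.k)) (hd : is.Nodup)
    {fl : Bool} {d : Fin (g + 1)} {h : Mem M} (hr : h.res = some r)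
    {X : Option (Fin M.k × Bool) → ℕ} {p : ℕ} (h0 : X none = 0)
    (h1 : ∀ i ∈ is, TapeRep E s (h.syms i) (X (some (i, false))) (X (some (i, true))) (pos i)
      (tape i))
    (h2 : ∀ i ∉ is, TapeRep E s (h.syms i) (X (some (i, false))) (X (some (i, true)))
      (Machine.movePos (r.2.2 i).2 (pos i)) (Function.update (tape i) (pos i) (r.2.2 i).1)) :
    ∃ fl' d' sy X', NRuns w (tapesCmd E m is) ((fl, d, h), X, p)
        ((fl', d', { h with syms := sy }), X', p) ∧ X' none = 0 ∧
      ∀ i, TapeRep E s (sy i) (X' (some (i, false))) (X' (some (i, true)))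
        (Machine.movePos (r.2.2 i).2 (pos i))
        (Function.update (tape i) (pos i) (r.2.2 i).1) := by
  induction is generalizing fl d h X with
  | nil => exact ⟨fl, d, h.syms, X, NRuns.skip, h0, fun i => h2 i (by simp)⟩
  | cons i is ih =>
    obtain ⟨hd1, hd2⟩ := List.nodup_cons.1 hd
    obtain ⟨fl₁, d₁, a, X₁, e1, e2, e3, e4⟩ := nruns_tapeCmd (fl := fl) (d := d) (p := p) E hs h0 hr
      (h1 i (by simp)) (hp i)
    obtain ⟨fl₂, d₂, sy, X₂, e5, e6, e7⟩ := ih hd2 (fl := fl₁) (d := d₁) (h := h.write i a) hr e2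
      (by
        intro j hj
        have hne : j ≠ i := by rintro rfl; exact hd1 hj
        rw [e3 _ _ hne, e3 _ _ hne]
        simpa [Mem.write, hne] using h1 j (by simp [hj]))
      (by
        intro j hj
        by_cases hne : j = i
        · subst hne
          simpa [Mem.write] using e4
        · rw [e3 _ _ hne, e3 _ _ hne]
          simpa [Mem.write, hne] using h2 j (by simp [hj, hne]))
    exact ⟨fl₂, d₂, sy, X₂, e1.seq e5, e6, e7⟩

/-- The action of the input head. -/
def headCmd (M : Machine A) (g m : ℕ) : SCmd M g m :=
  ite (fun f => f.2.2.res.elim false fun r => isRight r.2.1)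
    (ite (fun f => f.2.2.left) (assign fun f => (f.1, f.2.1, { f.2.2 with left := false }))
      (inc none skip skip))
    (ite (fun f => f.2.2.res.elim false fun r => isLeft r.2.1)
      (ite (fun f => f.2.2.left) skip
        (dec none skip (assign fun f => (f.1, f.2.1, { f.2.2 with left := true }))))
      skip)

/-- The representation of the position of the input head. -/
def HeadRep (w : List A) (left : Bool) (p pos : ℕ) : Prop :=
  (left = true ∧ pos = 0 ∧ p = 0) ∨ (left = false ∧ pos = p + 1 ∧ p ≤ w.length)

/-- The input tape has `|w| + 2` cells, one more than a register has values; the flag `left`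
accounts for the left endmarker. -/
theorem nruns_headCmd {f : Bool} {d : Fin (g + 1)} {h : Mem M}
    {X : Option (Fin M.k × Bool) → ℕ} {p pos : ℕ} {r : M.Q × Move × (Fin M.k → M.Γ × Move)}
    (hr : h.res = some r) (hh : HeadRep w h.left p pos) :
    ∃ left p', NRuns w (headCmd M g m) ((f, d, h), X, p) ((f, d, { h with left := left }), X, p') ∧
      HeadRep w left p' (min (Machine.movePos r.2.1 pos) (w.length + 1)) := by
  obtain ⟨q, left, sy, res⟩ := h
  dsimp only at hh hr
  cases hmv : r.2.1 with
  | right =>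
    rcases hh with ⟨rfl, rfl, rfl⟩ | ⟨rfl, rfl, hp⟩
    · exact ⟨false, 0, NRuns.ite_true (by simp [hr, hmv, isRight])
        (NRuns.ite_true rfl (NRuns.assign _)), Or.inr ⟨rfl, by simp [Machine.movePos], by simp⟩⟩
    · by_cases hlt : p < w.length
      · exact ⟨false, p + 1, NRuns.ite_true (by simp [hr, hmv, isRight])
          (NRuns.ite_false rfl (NRuns.inc_lt hlt NRuns.skip)),
          Or.inr ⟨rfl, by simp [Machine.movePos]; lia, hlt⟩⟩
      · exact ⟨false, p, NRuns.ite_true (by simp [hr, hmv, isRight])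
          (NRuns.ite_false rfl (NRuns.inc_ge (not_lt.1 hlt) NRuns.skip)),
          Or.inr ⟨rfl, by simp [Machine.movePos]; lia, hp⟩⟩
  | left =>
    rcases hh with ⟨rfl, rfl, rfl⟩ | ⟨rfl, rfl, hp⟩
    · exact ⟨true, 0, NRuns.ite_false (by simp [hr, hmv, isRight])
        (NRuns.ite_true (by simp [hr, hmv, isLeft]) (NRuns.ite_true rfl NRuns.skip)),
        Or.inl ⟨rfl, by simp [Machine.movePos], rfl⟩⟩
    · by_cases hz : p = 0
      · subst hz
        exact ⟨true, 0, NRuns.ite_false (by simp [hr, hmv, isRight])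
          (NRuns.ite_true (by simp [hr, hmv, isLeft]) (NRuns.ite_false rfl
            (NRuns.dec_zero (NRuns.assign _)))), Or.inl ⟨rfl, by simp [Machine.movePos], rfl⟩⟩
      · exact ⟨false, p - 1, NRuns.ite_false (by simp [hr, hmv, isRight])
          (NRuns.ite_true (by simp [hr, hmv, isLeft]) (NRuns.ite_false rfl
            (NRuns.dec_pos hz NRuns.skip))), Or.inr ⟨rfl, by simp [Machine.movePos]; lia, by lia⟩⟩
  | stay =>
    refine ⟨left, p, NRuns.ite_false (by simp [hr, hmv, isRight])
        (NRuns.ite_false (by simp [hr, hmv, isLeft]) NRuns.skip), ?_⟩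
    rcases hh with ⟨h1, rfl, rfl⟩ | ⟨h1, rfl, hp⟩
    · exact Or.inl ⟨h1, by simp [Machine.movePos], rfl⟩
    · exact Or.inr ⟨h1, by simp [Machine.movePos]; lia, hp⟩

/-- The symbol that is read from the input tape. -/
def inSym (left : Bool) (o : Option A) : InSym A :=
  bif left then .leftEnd else match o with
    | some a => .letter a
    | none => .rightEnd

theorem inSym_eq {left : Bool} {p pos : ℕ} (h : HeadRep w left p pos) :
    inSym left w[p]? = Machine.inputAt w pos := by
  rcases h with ⟨rfl, rfl, rfl⟩ | ⟨rfl, rfl, -⟩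
  · rfl
  · rfl

/-- Determining the next transition. -/
def fetchCmd (M : Machine A) (g m : ℕ) : SCmd M g m :=
  Cmd.read fun o f => (f.1, f.2.1, { f.2.2 with
    res := M.δ f.2.2.q (inSym f.2.2.left o) f.2.2.syms })

/-- The simulation of one step. -/
def stepCmd (m : ℕ) : SCmd M g m :=
  seq (tapesCmd E m (List.finRange M.k)) <| seq (headCmd M g m) <|
    seq (assign fun f => (f.1, f.2.1, { f.2.2 with q := f.2.2.res.elim f.2.2.q Prod.fst }))
      (fetchCmd M g m)

/-- The memory represents a configuration. -/
structure Sim (w : List A) (s : ℕ) (c : M.Config) (h : Mem M)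
    (X : Option (Fin M.k × Bool) → ℕ) (p : ℕ) : Prop where
  state : h.q = c.state
  head : HeadRep w h.left p c.inPos
  zero : X none = 0
  tapes : ∀ i, TapeRep E s (h.syms i) (X (some (i, false))) (X (some (i, true))) (c.workPos i)
    (c.work i)

variable {E}

theorem Sim.nruns_fetchCmd {s : ℕ} {c : M.Config} {h : Mem M} {X : Option (Fin M.k × Bool) → ℕ}
    {p : ℕ} (hc : Sim E w s c h X p) {fl : Bool} {d : Fin (g + 1)} :
    ∃ h', NRuns w (fetchCmd M g m) ((fl, d, h), X, p) ((fl, d, h'), X, p) ∧ Sim E w s c h' X p ∧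
      h'.res = M.δ c.state (Machine.inputAt w c.inPos) (fun i => c.work i (c.workPos i)) := by
  refine ⟨_, NRuns.read _, ⟨hc.state, hc.head, hc.zero, hc.tapes⟩, ?_⟩
  simp only [hc.state, inSym_eq hc.head]
  congr 1
  funext i
  exact (hc.tapes i).eq.symm

/-- Between two steps the memory holds the transition about to be made (`hres`); the tapes, the head
and the state are updated from it, and the next one is fetched. -/
theorem Sim.nruns_stepCmd {s : ℕ} (hs : (g + 1) ^ s ≤ (w.length + 1) ^ m) {c c' : M.Config}
    {h : Mem M} {X : Option (Fin M.k × Bool) → ℕ} {p : ℕ} (hc : Sim E w s c h X p)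
    (hres : h.res = M.δ c.state (Machine.inputAt w c.inPos) (fun i => c.work i (c.workPos i)))
    (hstep : M.step w c = some c') (hsp : ∀ i, c'.workPos i < s) {fl : Bool} {d : Fin (g + 1)} :
    ∃ fl' d' h' X' p', NRuns w (stepCmd E m) ((fl, d, h), X, p) ((fl', d', h'), X', p') ∧
      Sim E w s c' h' X' p' ∧
      h'.res = M.δ c'.state (Machine.inputAt w c'.inPos) (fun i => c'.work i (c'.workPos i)) := by
  rw [Machine.step, ← hres, Option.map_eq_some_iff] at hstep
  obtain ⟨r, hr, rfl⟩ := hstep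
  obtain ⟨fl₁, d₁, sy, X₁, e1, e2, e3⟩ := nruns_tapesCmd (fl := fl) (d := d) (p := p) E hs
    (r := r) (pos := c.workPos) (tape := c.work) hsp (List.finRange M.k) (List.nodup_finRange _) hr
    hc.zero (fun i _ => hc.tapes i) (fun i hi => absurd (List.mem_finRange i) hi)
  obtain ⟨left, p₁, e4, e5⟩ := nruns_headCmd (m := m) (f := fl₁) (d := d₁)
    (h := { h with syms := sy }) (X := X₁) hr hc.head
  have hsim : Sim E w s ⟨r.1, min (Machine.movePos r.2.1 c.inPos) (w.length + 1),
      fun i => Machine.movePos (r.2.2 i).2 (c.workPos i),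
      fun i => Function.update (c.work i) (c.workPos i) (r.2.2 i).1⟩
      { h with syms := sy, left := left, q := r.1 } X₁ p₁ := ⟨rfl, e5, e2, e3⟩
  obtain ⟨h', e6, e7, e8⟩ := hsim.nruns_fetchCmd (m := m) (fl := fl₁) (d := d₁)
  refine ⟨fl₁, d₁, h', X₁, p₁, e1.seq (e4.seq (NRuns.seq ?_ e6)), e7, e8⟩
  have := NRuns.assign (A := A) (w := w) (m := m) (G := Fin (g + 1) × Mem M)
    (σ := ((fl₁, d₁, { h with syms := sy, left := left }), X₁, p₁))
    (fun f => (f.1, f.2.1, { f.2.2 with q := f.2.2.res.elim f.2.2.q Prod.fst }))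
  simpa only [hr, Option.elim] using this

variable (E)

/-- The simulation of the machine. -/
def loopCmd (m : ℕ) : SCmd M g m := loop (fun f => f.2.2.res.isSome) (stepCmd E m)

variable {E}

theorem nruns_loopCmd {s : ℕ} (hs : (g + 1) ^ s ≤ (w.length + 1) ^ m) {c c' : M.Config}
    (hr : Reaches (M.step w) c c') (hhalt : M.step w c' = none)
    (hsp : ∀ c', Reaches (M.step w) c c' → ∀ i, c'.workPos i < s) {h : Mem M}
    {X : Option (Fin M.k × Bool) → ℕ} {p : ℕ} (hc : Sim E w s c h X p)
    (hres : h.res = M.δ c.state (Machine.inputAt w c.inPos) (fun i => c.work i (c.workPos i)))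
    {fl : Bool} {d : Fin (g + 1)} :
    ∃ fl' d' h' X' p', NRuns w (loopCmd E m) ((fl, d, h), X, p) ((fl', d', h'), X', p') ∧
      h'.q = c'.state := by
  induction hr using ReflTransGen.head_induction_on generalizing h X p fl d with
  | refl =>
    rw [Machine.step, ← hres, Option.map_eq_none_iff] at hhalt
    exact ⟨fl, d, h, X, p, NRuns.loop_false (by simp [hhalt]), hc.state⟩
  | @head c c₁ hcc hr ih =>
    obtain ⟨fl₁, d₁, h₁, X₁, p₁, e1, e2, e3⟩ := hc.nruns_stepCmd (m := m) hs hres hcc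
      (hsp _ (ReflTransGen.single hcc)) (fl := fl) (d := d)
    obtain ⟨fl₂, d₂, h₂, X₂, p₂, e4, e5⟩ := ih (fun c' hc' => hsp c' (hc'.head hcc)) e2 e3
      (fl := fl₁) (d := d₁)
    refine ⟨fl₂, d₂, h₂, X₂, p₂, NRuns.loop_true ?_ e1 e4, e5⟩
    rw [Machine.step, ← hres, Option.mem_def, Option.map_eq_some_iff] at hcc
    obtain ⟨r, hr, -⟩ := hcc
    simp [hr]

/-- Setting registers to zero. -/
def clear {F κ : Type} : List (Option κ) → Cmd A F κ
  | [] => Cmd.skip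
  | i :: is => seq (drain i Cmd.skip) (clear is)

theorem runs_clear {F κ : Type} [DecidableEq κ] {strict : Bool} (f : F) (is : List (Option κ))
    (v : Regs κ) : ∃ v', (clear is : Cmd A F κ).Runs strict w (f, v) (f, v') ∧
      (∀ i ∈ is, v' i = 0) ∧ ∀ i, v' i = 0 ∨ v' i = v i := by
  induction is generalizing v with
  | nil => exact ⟨v, Runs.skip, by simp, fun _ => Or.inr rfl⟩
  | cons i is ih =>
    obtain ⟨v', h1, h2, h3⟩ := ih (Function.update v i 0)
    refine ⟨v', (Runs.drain_skip f v i).seq h1, ?_, ?_⟩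
    · intro j hj
      rcases List.mem_cons.1 hj with rfl | hj
      · simpa using h3 j
      · exact h2 j hj
    · intro j
      rcases h3 j with h | h
      · exact Or.inl h
      · by_cases hij : j = i
        · subst hij
          exact Or.inl (by simpa using h)
        · exact Or.inr (by simpa [hij] using h)

theorem num_eq_zero {κ : Type} {n : ℕ} {v : Regs κ} {ds : List κ} (h : ∀ d ∈ ds, v (some d) = 0) :
    num n v ds = 0 := by
  induction ds with
  | nil => rfl
  | cons d ds ih =>
    simp [num, h d (by simp), ih fun x hx => h x (by simp [hx])]

/-- With `b = g + 1` this makes stacks of logarithmic height fit into a fixed number of digits. The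
estimate rests on `2 ^ (log n + 1) ≤ 2 n ≤ (n + 1) ^ 2`. -/
theorem pow_log_le {b c n : ℕ} (hn : n ≠ 0) :
    b ^ (c * (Nat.log 2 n + 1)) ≤ (n + 1) ^ (2 * (b * c)) := by
  calc b ^ (c * (Nat.log 2 n + 1)) ≤ (2 ^ b) ^ (c * (Nat.log 2 n + 1)) :=
        Nat.pow_le_pow_left Nat.lt_two_pow_self.le _
    _ = (2 ^ (Nat.log 2 n + 1)) ^ (b * c) := by
        rw [← pow_mul, ← pow_mul]
        congr 1
        ring
    _ ≤ ((n + 1) ^ 2) ^ (b * c) := by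
        refine Nat.pow_le_pow_left ?_ _
        rw [pow_succ, pow_two]
        have := Nat.pow_log_le_self 2 hn
        exact Nat.mul_le_mul (by lia) (by lia)
    _ = (n + 1) ^ (2 * (b * c)) := by rw [← pow_mul]

theorem exists_dolla_of_mem_logspace [Finite A] {L : Language A} (hL : L ∈ LOGSPACE A) :
    ∃ P ∈ FCDatalog.DOLLA A, P.IsBoolean ∧ L = P.language := by
  classical
  obtain ⟨M, hdec, c₀, hsp⟩ := hL
  obtain ⟨g, ⟨E⟩⟩ := exists_code M
  have := finite_mem M
  let m := 2 * ((g + 1) * c₀)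
  let regList : List (Option (Option (Fin M.k × Bool) × Fin m)) :=
    (Fintype.elems : Finset (Option (Option (Fin M.k × Bool) × Fin m))).toList
  -- All registers start at `|w|`, so the first decrement fails exactly on the empty word. There
  -- base `|w| + 1` degenerates to one, and the answer is built into the program.
  let prog : SCmd M g m := dec none
    (seq (clear regList) <| seq (fetchCmd M g m) <| seq (loopCmd E m)
      (assign fun f => (decide (f.2.2.q ∈ M.accept), f.2)))
    (assign fun f => (decide ([] ∈ L), f.2))
  let h₀ : Mem M := ⟨M.start, true, fun _ => M.blank, none⟩
  obtain ⟨N, tab, start, htab⟩ := exists_table prog Prod.fst (false, 0, h₀)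
  refine exists_dolla tab start L fun w => ?_
  suffices ∃ τ, prog.Runs false w ((false, 0, h₀), fun _ => w.length) τ ∧
      (τ.1.1 = true ↔ w ∈ L) by
    obtain ⟨τ, h1, h2⟩ := this
    exact htab _ _ _ _ _ h1 h2
  by_cases hw : w.length = 0
  · obtain rfl := List.length_eq_zero_iff.1 hw
    exact ⟨_, Runs.dec_zero rfl (Runs.assign _), by simp⟩
  · obtain ⟨c', hr, hhalt, hacc⟩ := hdec w
    obtain ⟨v, hv1, hv2, -⟩ := runs_clear (A := A) (w := w) (strict := false)
      ((false, 0, h₀) : Bool × Fin (g + 1) × Mem M) regList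
      (Function.update (fun _ => w.length) none (w.length - 1))
    have hv : ∀ i, v i = 0 := fun i => hv2 i (by simp [regList, Fintype.complete])
    have hrep : Rep w v (fun _ => 0) 0 :=
      ⟨fun s => num_eq_zero fun d _ => hv _, fun i => by simp [hv], hv _⟩
    have hsim : Sim E w (c₀ * (Nat.log 2 w.length + 1)) M.init h₀ (fun _ => 0) 0 :=
      ⟨rfl, Or.inl ⟨rfl, rfl, rfl⟩, rfl, fun i => ⟨[], [], rfl, rfl, rfl,
        hsp w _ ReflTransGen.refl i, fun j => by cases j <;> simp [Machine.init, h₀]⟩⟩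
    obtain ⟨h₁, e1, e2, e3⟩ := hsim.nruns_fetchCmd (m := m) (fl := false) (d := 0)
    obtain ⟨fl, d, h₂, X, p, e4, e5⟩ := nruns_loopCmd (m := m) (pow_log_le hw) hr hhalt
      (hsp w) e2 e3 (fl := false) (d := 0)
    obtain ⟨v₁, hv₁, e6⟩ := e1 v hrep
    obtain ⟨v₂, hv₂, e7⟩ := e4 v₁ hv₁
    refine ⟨_, Runs.dec_pos hw (hv1.seq (e6.seq (e7.seq (Runs.assign _)))), ?_⟩
    simp [e5, hacc]

end RegMachine.OfMachine


/-! # Predicates on positions that are computed by strict programs -/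

namespace RegMachine.Logic

open Cmd Relation

universe u

variable {A : Type u} {X Y : Type} {w : List A}

/-- Programs whose finite memory is a flag. -/
abbrev FCmd (A : Type u) := Cmd A Bool ℕ

/-- The registers are bounded by the length of the input. -/
def Bdd (w : List A) (v : Regs ℕ) : Prop := ∀ i, v i ≤ w.length

/-- A Hoare triple that ignores the flag. -/
def Tr (w : List A) (P : Regs ℕ → Prop) (c : FCmd A) (Q : Regs ℕ → Prop) : Prop :=
  ∀ f v, P v → ∃ f' v', c.Runs true w (f, v) (f', v') ∧ Q v'

variable {P Q R : Regs ℕ → Prop} {c c' : FCmd A}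

theorem Tr.seq (h : Tr w P c Q) (h' : Tr w Q c' R) : Tr w P (seq c c') R := fun f v hv => by
  obtain ⟨f₁, v₁, h1, h2⟩ := h f v hv
  obtain ⟨f₂, v₂, h3, h4⟩ := h' f₁ v₁ h2
  exact ⟨f₂, v₂, h1.seq h3, h4⟩

theorem Tr.mono {P' Q' : Regs ℕ → Prop} (h : Tr w P c Q) (hP : ∀ v, P' v → P v)
    (hQ : ∀ v, Q v → Q' v) : Tr w P' c Q' := fun f v hv => by
  obtain ⟨f₁, v₁, h1, h2⟩ := h f v (hP v hv)
  exact ⟨f₁, v₁, h1, hQ _ h2⟩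

theorem Tr.skip (h : ∀ v, P v → Q v) : Tr w P Cmd.skip Q :=
  fun f v hv => ⟨f, v, Runs.skip, h v hv⟩

theorem Tr.clear {i : Option ℕ} (h : ∀ v, P v → Q (Function.update v i 0)) :
    Tr w P (drain i Cmd.skip) Q :=
  fun f v hv => ⟨f, _, Runs.drain_skip f v i, h v hv⟩

theorem Tr.inc {i : Option ℕ} (h : ∀ v, P v → v i < w.length ∧ Q (Function.update v i (v i + 1))) :
    Tr w P (inc i Cmd.skip Cmd.skip) Q :=
  fun f v hv => ⟨f, _, Runs.inc_lt (h v hv).1 Runs.skip, (h v hv).2⟩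

/-- The invariant is indexed by the counter. The body sees the counter already lowered to `k`, so
its precondition refers to the registers with the counter reset to `k + 1`. -/
theorem Tr.drain (I : ℕ → Regs ℕ → Prop) {i : Option ℕ}
    (h : ∀ k, Tr w (fun v => v i = k ∧ I (k + 1) (Function.update v i (k + 1))) c
      (fun v => v i = k ∧ I k v)) :
    Tr w (fun v => I (v i) v) (drain i c) (fun v => v i = 0 ∧ I 0 v) := fun f v hv => by
  obtain ⟨k, hk⟩ : ∃ k, v i = k := ⟨_, rfl⟩
  induction k generalizing f v with
  | zero => exact ⟨f, v, Runs.drain_zero hk, hk, by rwa [hk] at hv⟩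
  | succ k ih =>
    obtain ⟨f₁, v₁, h1, h2, h3⟩ := h k f (Function.update v i k)
      ⟨by simp, by rwa [Function.update_idem, ← hk, Function.update_eq_self]⟩
    obtain ⟨f₂, v₂, h4, h5⟩ := ih f₁ v₁ (by rwa [h2]) h2
    exact ⟨f₂, v₂, Runs.drain_pos (by simp [hk]) (by simpa [hk] using h1) h4, h5⟩

theorem Bdd.update {v : Regs ℕ} (h : Bdd w v) {i : Option ℕ} {x : ℕ} (hx : x ≤ w.length) :
    Bdd w (Function.update v i x) := fun j => by
  by_cases hj : j = i
  · subst hj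
    simpa using hx
  · simpa [hj] using h j

/-- Copying a register. -/
def copy (i d : ℕ) : FCmd A :=
  seq (drain none Cmd.skip) <| seq (drain (some d) Cmd.skip) <|
    seq (drain (some i) (seq (inc none Cmd.skip Cmd.skip) (inc (some d) Cmd.skip Cmd.skip)))
      (drain none (inc (some i) Cmd.skip Cmd.skip))

/-- The input head serves as a second copy from which the source is restored. No increment meets a
full register, since each one is paid for by a decrement. -/
theorem tr_copy {i d : ℕ} (hid : i ≠ d) (v₀ : Regs ℕ) :
    Tr w (fun v => Bdd w v ∧ v = v₀) (copy i d) (fun v => Bdd w v ∧ v (some d) = v₀ (some i) ∧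
      ∀ j ≠ d, v (some j) = v₀ (some j)) := by
  let I : ℕ → Regs ℕ → Prop := fun k v => Bdd w v ∧ v₀ (some i) ≤ w.length ∧
    v none + k = v₀ (some i) ∧ v (some d) + k = v₀ (some i) ∧
      ∀ j, j ≠ d → j ≠ i → v (some j) = v₀ (some j)
  let J : ℕ → Regs ℕ → Prop := fun k v => Bdd w v ∧ v₀ (some i) ≤ w.length ∧
    v (some i) + k = v₀ (some i) ∧ v (some d) = v₀ (some i) ∧
      ∀ j, j ≠ d → j ≠ i → v (some j) = v₀ (some j)
  refine (Tr.clear (Q := fun v => Bdd w v ∧ v none = 0 ∧ ∀ j, v (some j) = v₀ (some j)) ?_).seq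
    ((Tr.clear (Q := fun v => I (v (some i)) v) ?_).seq
    (((Tr.drain I ?_).mono (fun _ h => h) (Q' := fun v => J (v none) v) ?_).seq
    ((Tr.drain J ?_).mono (fun _ h => h) ?_)))
  · rintro v ⟨h, rfl⟩
    exact ⟨h.update (Nat.zero_le _), by simp, by simp⟩
  · rintro v ⟨h1, h2, h3⟩
    refine ⟨h1.update (Nat.zero_le _), h3 i ▸ h1 _, ?_, ?_, ?_⟩
    · simp [h2, hid, h3]
    · simp [hid, h3]
    · intro j hj _
      simp [hj, h3]
  · rintro k
    refine (Tr.inc (Q := fun v => v (some i) = k ∧ Bdd w v ∧ v₀ (some i) ≤ w.length ∧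
      v none + k = v₀ (some i) ∧ v (some d) + (k + 1) = v₀ (some i) ∧
      ∀ j, j ≠ d → j ≠ i → v (some j) = v₀ (some j)) ?_).seq (Tr.inc ?_)
    · rintro v ⟨h0, h1, h2, h3, h4, h5⟩
      simp only [Function.update_of_ne, ne_eq, reduceCtorEq, not_false_eq_true, hid.symm,
        Option.some.injEq] at h3 h4
      have hb : Bdd w v := by
        have := h1.update (i := some i) (x := k) (by
          have := h1 (some i)
          simp at this
          lia)
        rwa [Function.update_idem, ← h0, Function.update_eq_self] at this
      refine ⟨by lia, by simpa using h0, hb.update (by lia), h2, by simp; lia, by simpa using h4,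
        fun j hj hji => ?_⟩
      simpa [hji] using h5 j hj hji
    · rintro v ⟨h0, h1, h2, h3, h4, h5⟩
      refine ⟨by lia, by simpa [hid] using h0, h1.update (by lia), h2, by simpa using h3,
        by simp; lia, fun j hj hji => ?_⟩
      simpa [hj] using h5 j hj hji
  · rintro v ⟨h0, h1, h2, h3, h4, h5⟩
    exact ⟨h1, h2, by lia, by lia, h5⟩
  · rintro k
    refine Tr.inc ?_
    rintro v ⟨h0, h1, h2, h3, h4, h5⟩
    simp only [Function.update_of_ne, ne_eq, reduceCtorEq, not_false_eq_true] at h3 h4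
    have hb : Bdd w v := by
      have := h1.update (i := none) (x := k) (by
        have := h1 none
        simp at this
        lia)
      rwa [Function.update_idem, ← h0, Function.update_eq_self] at this
    refine ⟨by lia, by simpa using h0, hb.update (by lia), h2, by simp; lia, ?_,
      fun j hj hji => ?_⟩
    · simpa [hid.symm] using h4
    · simpa [hji] using h5 j hj hji
  · rintro v ⟨h0, h1, h2, h3, h4, h5⟩
    refine ⟨h1, h4, fun j hj => ?_⟩
    by_cases hji : j = i
    · subst hji
      simpa using h3
    · exact h5 j hj hji

-- Decided predicates and their basic closure properties.

/-- Predicates on tuples of positions in words. -/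
abbrev Formula (A : Type u) (X : Type) := ∀ w : List A, (X → Fin (w.length + 1)) → Prop

/-- The program decides the predicate, for the tuple of positions in the given registers, and it
preserves the registers below `base`. -/
def Decides (c : FCmd A) (base : ℕ) (loc : X → ℕ) (φ : Formula A X) : Prop :=
  ∀ w ≠ [], ∀ f v, Bdd w v → ∀ x, (∀ i, v (some (loc i)) = (x i).val) →
    ∃ b v', c.Runs true w (f, v) (b, v') ∧ (b = true ↔ φ w x) ∧ Bdd w v' ∧
      ∀ i < base, v' (some i) = v (some i)

/-- The predicate is decided by programs. -/
def LD (φ : Formula A X) : Prop :=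
  ∀ (base : ℕ) (loc : X → ℕ), (∀ i, loc i < base) → ∃ c : FCmd A, Decides c base loc φ

variable {φ ψ : Formula A X}

theorem LD.congr (h : LD φ) (h' : ∀ w, w ≠ [] → ∀ x, φ w x ↔ ψ w x) : LD ψ :=
  fun base loc hl => by
    obtain ⟨c, hc⟩ := h base loc hl
    refine ⟨c, fun w hw f v hv x hx => ?_⟩
    obtain ⟨b, v', h1, h2, h3⟩ := hc w hw f v hv x hx
    exact ⟨b, v', h1, h2.trans (h' w hw x), h3⟩

theorem LD.reindex (h : LD φ) (e : X → Y) : LD (X := Y) fun w y => φ w (y ∘ e) :=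
  fun base loc hl => by
    obtain ⟨c, hc⟩ := h base (loc ∘ e) fun i => hl _
    exact ⟨c, fun w hw f v hv x hx => hc w hw f v hv _ fun i => hx (e i)⟩

theorem LD.const (p : Prop) : LD (A := A) (X := X) fun _ _ => p := fun base loc _ => by
  classical
  exact ⟨assign fun _ => decide p, fun w _ f v hv x _ =>
    ⟨_, v, Runs.assign _, by simp, hv, fun _ _ => rfl⟩⟩

theorem LD.not (h : LD φ) : LD fun w x => ¬ φ w x := fun base loc hl => by
  obtain ⟨c, hc⟩ := h base loc hl
  refine ⟨seq c (assign Bool.not), fun w hw f v hv x hx => ?_⟩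
  obtain ⟨b, v', h1, h2, h3⟩ := hc w hw f v hv x hx
  exact ⟨_, v', h1.seq (Runs.assign _), by simp [← h2], h3⟩

/-- The first program leaves the registers below `base` intact, hence also the arguments of the
second one. -/
theorem LD.and (h : LD φ) (h' : LD ψ) : LD fun w x => φ w x ∧ ψ w x := fun base loc hl => by
  obtain ⟨c, hc⟩ := h base loc hl
  obtain ⟨c', hc'⟩ := h' base loc hl
  refine ⟨seq c (ite id c' Cmd.skip), fun w hw f v hv x hx => ?_⟩
  obtain ⟨b, v', h1, h2, h3, h4⟩ := hc w hw f v hv x hx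
  cases b with
  | false =>
    exact ⟨_, v', h1.seq (.ite_false rfl Runs.skip), by simp [← h2], h3, h4⟩
  | true =>
    obtain ⟨b', v'', h5, h6, h7, h8⟩ := hc' w hw true v' h3 x fun i => by rw [h4 _ (hl i), hx]
    exact ⟨b', v'', h1.seq (.ite_true rfl h5), by simp [h6, ← h2], h7,
      fun i hi => (h8 i hi).trans (h4 i hi)⟩

theorem LD.or (h : LD φ) (h' : LD ψ) : LD fun w x => φ w x ∨ ψ w x :=
  (h.not.and h'.not).not.congr fun w _ x => by tauto

theorem LD.forall_finite {ι : Type*} [Finite ι] {φ : ι → Formula A X} (h : ∀ i, LD (φ i)) :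
    LD fun w x => ∀ i, φ i w x := by
  induction ι using Finite.induction_empty_option with
  | of_equiv e ih =>
    exact (ih fun i => h (e i)).congr fun w _ x => ⟨fun H i => by simpa using H (e.symm i), fun H i => H _⟩
  | h_empty => exact (LD.const True).congr fun w _ x => by simp
  | h_option ih =>
    exact ((h none).and (ih fun i => h (some i))).congr fun w _ x =>
      ⟨fun H i => by cases i with | none => exact H.1 | some i => exact H.2 i,
        fun H => ⟨H none, fun i => H (some i)⟩⟩

theorem LD.exists_finite {ι : Type*} [Finite ι] {φ : ι → Formula A X} (h : ∀ i, LD (φ i)) :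
    LD fun w x => ∃ i, φ i w x :=
  (LD.forall_finite fun i => (h i).not).not.congr fun w _ x => by simp

/-- Moving the input head to the position in a register. -/
def load (i d : ℕ) : FCmd A :=
  seq (copy i d) <| seq (drain none Cmd.skip) (drain (some d) (inc none Cmd.skip Cmd.skip))

theorem tr_load {i d : ℕ} (hid : i ≠ d) (v₀ : Regs ℕ) :
    Tr w (fun v => Bdd w v ∧ v = v₀) (load i d) (fun v => Bdd w v ∧ v none = v₀ (some i) ∧
      ∀ j ≠ d, v (some j) = v₀ (some j)) := by
  let I : ℕ → Regs ℕ → Prop := fun k v => Bdd w v ∧ v₀ (some i) ≤ w.length ∧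
    v none + k = v₀ (some i) ∧ ∀ j ≠ d, v (some j) = v₀ (some j)
  refine (tr_copy hid v₀).seq ((Tr.clear (Q := fun v => I (v (some d)) v) ?_).seq
    ((Tr.drain I fun k => Tr.inc ?_).mono (fun _ h => h) ?_))
  · rintro v ⟨h1, h2, h3⟩
    refine ⟨h1.update (Nat.zero_le _), ?_, by simp [h2], by simpa using h3⟩
    rw [← h3 i hid]
    exact h1 _
  · rintro v ⟨h0, h1, h2, h3, h4⟩
    simp only [Function.update_of_ne, ne_eq, reduceCtorEq, not_false_eq_true] at h3
    have hb : Bdd w v := by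
      have := h1.update (i := some d) (x := k) (by
        have := h1 (some d)
        simp at this
        lia)
      rwa [Function.update_idem, ← h0, Function.update_eq_self] at this
    refine ⟨by lia, by simpa using h0, hb.update (by lia), h2, by simp; lia, fun j hj => ?_⟩
    simpa [hj] using h4 j hj
  · rintro v ⟨h0, h1, h2, h3, h4⟩
    exact ⟨h1, by lia, h4⟩

theorem LD.letter (i : X) (a : A) : LD fun w x => w[(x i).val]? = some a := fun base loc hl => by
  classical
  refine ⟨seq (load (loc i) base) (read fun o _ => decide (o = some a)),
    fun w hw f v hv x hx => ?_⟩
  obtain ⟨f', v', h1, h2, h3, h4⟩ := tr_load (hl i).ne v f v ⟨hv, rfl⟩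
  exact ⟨_, v', h1.seq (Runs.read _), by simp [h3, hx], h2, fun j hj => h4 j hj.ne⟩

/-- On scratch copies, the truncated difference `x i - x j` is computed; it vanishes exactly if `x i
≤ x j`. -/
theorem LD.le (i j : X) : LD (A := A) fun _ x => x i ≤ x j := fun base loc hl => by
  refine ⟨seq (copy (loc i) base) <| seq (copy (loc j) (base + 1)) <|
    seq (drain (some (base + 1)) (dec (some base) Cmd.skip Cmd.skip))
      (dec (some base) (assign fun _ => false) (assign fun _ => true)),
    fun w hw f v hv x hx => ?_⟩
  obtain ⟨f₁, v₁, e1, h1, h2, h3⟩ := tr_copy (hl i).ne v f v ⟨hv, rfl⟩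
  obtain ⟨f₂, v₂, e2, h4, h5, h6⟩ := tr_copy (w := w) (i := loc j) (d := base + 1)
    ((hl j).trans (Nat.lt_succ_self _)).ne v₁ f₁ v₁ ⟨h1, rfl⟩
  let I : ℕ → Regs ℕ → Prop := fun k v' => Bdd w v' ∧ k ≤ w.length ∧
    v' (some base) - k = v (some (loc i)) - v (some (loc j)) ∧ ∀ j < base, v' (some j) = v (some j)
  have hd := Tr.drain (w := w) (i := some (base + 1)) (c := dec (some base) Cmd.skip Cmd.skip) I
    (by
      rintro k f v ⟨h0, h1, h2, h3, h4⟩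
      have hb : Bdd w v := by
        have := h1.update (i := some (base + 1)) (x := k) (by lia)
        rwa [Function.update_idem, ← h0, Function.update_eq_self] at this
      have h5 : ∀ j < base, v (some j) = _ := fun j hj => by
        simpa [show j ≠ base + 1 by lia] using h4 j hj
      simp at h3
      by_cases hz : v (some base) = 0
      · exact ⟨f, v, Runs.dec_zero hz Runs.skip, h0, hb, by lia, by lia, h5⟩
      · refine ⟨f, _, Runs.dec_pos hz Runs.skip, by simpa using h0,
          hb.update ((Nat.sub_le _ _).trans (hb _)), by lia, by simp; lia, fun j hj => ?_⟩
        simpa [hj.ne] using h5 j hj)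
  obtain ⟨f₃, v₃, e3, h7, h8, h9, h10, h11⟩ := hd f₂ v₂ ⟨h4, h4 _, by
    rw [h5, h6 base (by lia), h2, h3 _ (hl j).ne], fun j hj => by
      rw [h6 j (by lia), h3 j hj.ne]⟩
  rw [hx, hx] at h10
  by_cases hz : v₃ (some base) = 0
  · refine ⟨_, _, e1.seq (e2.seq (e3.seq (Runs.dec_zero hz (Runs.assign _)))), ?_, h8, h11⟩
    exact iff_of_true rfl (Fin.le_def.2 (by lia))
  · refine ⟨_, _, e1.seq (e2.seq (e3.seq (Runs.dec_pos hz (Runs.assign _)))), ?_,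
      h8.update ((Nat.sub_le _ _).trans (h8 _)), fun j hj => by simpa [hj.ne] using h11 j hj⟩
    exact iff_of_false (by simp) fun hle => by
      have := Fin.le_def.1 hle
      lia

/-! ## Loops over tuples of positions -/

/-- Setting a register to the length of the input. -/
def setMax (t : ℕ) : FCmd A :=
  seq (drain none Cmd.skip) <| seq (drain (some t) Cmd.skip) <|
    fill none (inc (some t) Cmd.skip Cmd.skip)

/-- Only the input head can notice its maximum, so register `t` is counted up along with it. -/
theorem tr_setMax {t : ℕ} (v₀ : Regs ℕ) :
    Tr w (fun v => Bdd w v ∧ v = v₀) (setMax t) (fun v => Bdd w v ∧ v (some t) = w.length ∧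
      ∀ j ≠ t, v (some j) = v₀ (some j)) := by
  refine (Tr.clear (Q := fun v => Bdd w v ∧ v none = 0 ∧ ∀ j, v (some j) = v₀ (some j)) ?_).seq
    ((Tr.clear (Q := fun v => Bdd w v ∧ v none = v (some t) ∧
      ∀ j ≠ t, v (some j) = v₀ (some j)) ?_).seq ?_)
  · rintro v ⟨h, rfl⟩
    exact ⟨h.update (Nat.zero_le _), by simp, by simp⟩
  · rintro v ⟨h1, h2, h3⟩
    exact ⟨h1.update (Nat.zero_le _), by simp [h2], fun j hj => by simp [hj, h3]⟩
  · rintro f v ⟨h1, h2, h3⟩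
    obtain ⟨k, hk⟩ := Nat.exists_eq_add_of_le (h1 none)
    induction k generalizing v with
    | zero =>
      exact ⟨f, v, Runs.fill_ge (Or.inr rfl) hk.le, h1, by lia, h3⟩
    | succ k ih =>
      obtain ⟨f', v', e, h⟩ := ih (Function.update (Function.update v none (v none + 1)) (some t)
        (v (some t) + 1)) ((h1.update (by lia)).update (by lia)) (by simp [h2])
        (fun j hj => by simp [hj, h3]) (by simp; lia)
      refine ⟨f', v', Runs.fill_lt (by dsimp only; lia)
        (Runs.inc_lt (by simp; lia) Runs.skip) ?_, h⟩
      simpa using e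

/-- Running a program for all values of the register `x`. -/
def forAll (x : ℕ) (c : FCmd A) : FCmd A :=
  seq (setMax (x + 1)) <| seq (drain (some x) Cmd.skip) <| seq c <|
    drain (some (x + 1)) (seq (inc (some x) Cmd.skip Cmd.skip) c)

/-- The predicate depends on the registers below `b` only. -/
def Local (b : ℕ) (P : Regs ℕ → Prop) : Prop :=
  ∀ v v' : Regs ℕ, (∀ i < b, v (some i) = v' (some i)) → P v → P v'

/-- A strict program cannot test whether the loop register is full; the companion register counts
down from `|w|` instead. One run precedes that loop, giving `|w| + 1` runs. -/
theorem tr_forAll {b : ℕ} {I : ℕ → Regs ℕ → Prop} (hI : ∀ k, Local b (I k))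
    (h : ∀ k ≤ w.length, ∀ t ≤ w.length,
      Tr w (fun v => Bdd w v ∧ I k v ∧ v (some b) = k ∧ v (some (b + 1)) = t) c
        (fun v => Bdd w v ∧ I (k + 1) v ∧ v (some b) = k ∧ v (some (b + 1)) = t)) :
    Tr w (fun v => Bdd w v ∧ I 0 v) (forAll b c) (fun v => Bdd w v ∧ I (w.length + 1) v) := by
  let J : ℕ → Regs ℕ → Prop := fun k v => Bdd w v ∧ k ≤ w.length ∧ v (some b) + k = w.length ∧
    I (v (some b) + 1) v
  have h1 : Tr w (fun v => Bdd w v ∧ I 0 v) (setMax (b + 1))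
      (fun v => Bdd w v ∧ I 0 v ∧ v (some (b + 1)) = w.length) := by
    rintro f v ⟨hv, hI0⟩
    obtain ⟨f', v', e, h1, h2, h3⟩ := tr_setMax v f v ⟨hv, rfl⟩
    exact ⟨f', v', e, h1, hI 0 v v' (fun i hi => (h3 i (by lia)).symm) hI0, h2⟩
  refine h1.seq ((Tr.clear (Q := fun v => Bdd w v ∧ I 0 v ∧ v (some b) = 0 ∧
    v (some (b + 1)) = w.length) ?_).seq (((h 0 (Nat.zero_le _) _ le_rfl).mono
      (Q' := fun v => J (v (some (b + 1))) v) (fun _ h => h) ?_).seq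
      ((Tr.drain J ?_).mono (fun _ h => h) ?_)))
  · rintro v ⟨h1, h2, h3⟩
    exact ⟨h1.update (Nat.zero_le _), hI 0 _ _ (fun i hi => by simp [hi.ne]) h2, by simp,
      by simpa using h3⟩
  · rintro v ⟨h1, h2, h3, h4⟩
    exact ⟨h1, h1 _, by lia, h3 ▸ h2⟩
  · rintro k f v ⟨h0, h1, h2, h3, h4⟩
    simp at h3 h4
    have hb : Bdd w v := by
      have := h1.update (i := some (b + 1)) (x := k) (by lia)
      rwa [Function.update_idem, ← h0, Function.update_eq_self] at this
    obtain ⟨f', v', e, h5, h6, h7, h8⟩ := h (v (some b) + 1) (by lia) k (by lia) f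
      (Function.update v (some b) (v (some b) + 1)) ⟨hb.update (by lia),
        hI _ _ _ (fun i hi => by simp [hi.ne, show i ≠ b + 1 by lia]) h4, by simp, by simpa using h0⟩
    exact ⟨f', v', (Runs.inc_lt (by dsimp only; lia) Runs.skip).seq e, h8, h5, by lia, by lia,
      h7 ▸ h6⟩
  · rintro v ⟨h1, h2, h3, h4, h5⟩
    refine ⟨h2, ?_⟩
    rwa [show v (some b) = w.length by lia] at h5

/-- Running a program for all values of `d` registers; every register is followed by a counter. -/
def rep : ℕ → ℕ → FCmd A → FCmd A
  | _, 0, c => c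
  | b, d + 1, c => forAll b (rep (b + 2) d c)

/-- The values of the registers of the loops. -/
def vals : ℕ → ℕ → Regs ℕ → List ℕ
  | _, 0, _ => []
  | b, d + 1, v => v (some b) :: vals (b + 2) d v

/-- The tuples of numbers that are at most `n`. -/
def allVals (n : ℕ) : ℕ → List (List ℕ)
  | 0 => [[]]
  | d + 1 => (List.range (n + 1)).flatMap fun k => (allVals n d).map (k :: ·)

theorem length_allVals (n d : ℕ) : (allVals n d).length = (n + 1) ^ d := by
  induction d with
  | zero => rfl
  | succ d ih => simp [allVals, List.length_flatMap, ih, pow_succ']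

theorem mem_allVals {n d : ℕ} {u : List ℕ} :
    u ∈ allVals n d ↔ u.length = d ∧ ∀ x ∈ u, x ≤ n := by
  induction d generalizing u with
  | zero =>
    rw [allVals, List.mem_singleton, List.length_eq_zero_iff]
    exact ⟨fun h => ⟨h, by simp [h]⟩, fun h => h.1⟩
  | succ d ih =>
    simp only [allVals, List.mem_flatMap, List.mem_range, List.mem_map, ih]
    constructor
    · rintro ⟨k, hk, u, ⟨rfl, hu⟩, rfl⟩
      simp
      exact ⟨by lia, hu⟩
    · rintro ⟨h1, h2⟩
      cases u with
      | nil => simp at h1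
      | cons k u =>
        simp at h1 h2
        exact ⟨k, by lia, u, ⟨h1, h2.2⟩, rfl⟩

/-- `vis` is the list of tuples visited so far. The invariant looks only below the loop registers,
and each run must leave the loop registers as they were. -/
theorem tr_rep {b d : ℕ} {I : List (List ℕ) → Regs ℕ → Prop} (hI : ∀ vis, Local b (I vis))
    (h : ∀ vis, ∀ v₀, Tr w (fun v => Bdd w v ∧ I vis v ∧ v = v₀) c
      (fun v => Bdd w v ∧ I (vis ++ [vals b d v₀]) v ∧
        ∀ i, b ≤ i → i < b + 2 * d → v (some i) = v₀ (some i))) (vis : List (List ℕ)) :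
    Tr w (fun v => Bdd w v ∧ I vis v) (rep b d c)
      (fun v => Bdd w v ∧ I (vis ++ allVals w.length d) v) := by
  induction d generalizing b I vis with
  | zero =>
    rintro f v ⟨h1, h2⟩
    obtain ⟨f', v', e, h3, h4, -⟩ := h vis v f v ⟨h1, h2, rfl⟩
    exact ⟨f', v', e, h3, h4⟩
  | succ d ih =>
    let done : ℕ → List (List ℕ) := fun k =>
      (List.range k).flatMap fun k => (allVals w.length d).map (k :: ·)
    have := tr_forAll (w := w) (c := rep (b + 2) d c) (b := b) (I := fun k => I (vis ++ done k))
      (fun k => hI _) (fun k hk t ht => by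
        -- For first coordinate `k`, the inner loops extend the list by tuples that begin with `k`;
        -- the invariant also fixes the outer loop register and its counter.
        have h1 := ih (b := b + 2) (I := fun vis' v => I (vis ++ done k ++ vis'.map (k :: ·)) v ∧
          v (some b) = k ∧ v (some (b + 1)) = t)
          (fun vis' v v' hv hP => ⟨hI _ v v' (fun i hi => hv i (by lia)) hP.1,
            (hv b (by lia)).symm.trans hP.2.1, (hv (b + 1) (by lia)).symm.trans hP.2.2⟩)
          (fun vis' v₀ => by
            rintro f v ⟨h1, ⟨h2, h3, h4⟩, rfl⟩
            obtain ⟨f', v', e, h5, h6, h7⟩ := h _ v f v ⟨h1, h2, rfl⟩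
            refine ⟨f', v', e, h5, ⟨?_, (h7 b (by lia) (by lia)).trans h3,
              (h7 (b + 1) (by lia) (by lia)).trans h4⟩, fun i hi hi' => h7 i (by lia) (by lia)⟩
            simpa [vals, h3] using h6) []
        refine h1.mono ?_ ?_
        · rintro v ⟨h1, h2, h3, h4⟩
          exact ⟨h1, by simpa using h2, h3, h4⟩
        · rintro v ⟨h1, h2, h3, h4⟩
          refine ⟨h1, ?_, h3, h4⟩
          simpa [done, List.range_succ] using h2)
    refine this.mono ?_ ?_
    · rintro v ⟨h1, h2⟩
      exact ⟨h1, by simpa [done] using h2⟩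
    · rintro v ⟨h1, h2⟩
      exact ⟨h1, h2⟩

end RegMachine.Logic


-- Existential quantification over tuples of positions.

namespace RegMachine.Logic

open Cmd Relation

universe u

variable {A : Type u} {X Y : Type} {w : List A}

theorem vals_eq (b d : ℕ) (v : Regs ℕ) :
    vals b d v = List.ofFn fun j : Fin d => v (some (b + 2 * j)) := by
  induction d generalizing b with
  | zero => rfl
  | succ d ih =>
    rw [vals, ih, List.ofFn_succ]
    simp only [Fin.val_zero, mul_zero, add_zero, Fin.val_succ]
    congr 2
    funext j
    congr 2
    ring

/-- A tuple of positions as a list of numbers. -/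
def toList {d : ℕ} (e : Y ≃ Fin d) (y : Y → Fin (w.length + 1)) : List ℕ :=
  List.ofFn fun j => (y (e.symm j)).val

theorem toList_injective {d : ℕ} (e : Y ≃ Fin d) :
    Function.Injective (toList (w := w) e) := fun y z h => by
  funext j
  have := congrFun (List.ofFn_injective h) (e j)
  simp only [Equiv.symm_apply_apply] at this
  exact Fin.ext this

theorem toList_mem {d : ℕ} (e : Y ≃ Fin d) (y : Y → Fin (w.length + 1)) :
    toList e y ∈ allVals w.length d := by
  refine mem_allVals.2 ⟨by simp [toList], fun x hx => ?_⟩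
  obtain ⟨j, rfl⟩ := List.mem_ofFn.1 hx
  exact Fin.is_le _

/-- The tuple of positions in the registers of the loops. -/
def ofRegs {d : ℕ} (e : Y ≃ Fin d) (b : ℕ) {v : Regs ℕ} (hv : Bdd w v) :
    Y → Fin (w.length + 1) := fun j => ⟨v (some (b + 2 * e j)), Nat.lt_succ_of_le (hv _)⟩

theorem toList_ofRegs {d : ℕ} (e : Y ≃ Fin d) (b : ℕ) {v : Regs ℕ} (hv : Bdd w v) :
    toList e (ofRegs e b hv) = vals b d v := by
  rw [vals_eq]
  simp [toList, ofRegs]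

/-- Each run of the inner program overwrites the flag, so success is remembered as a nonzero value
of the register `base`. -/
theorem LD.ex [Finite Y] {φ : Formula A (X ⊕ Y)} (h : LD φ) :
    LD fun w x => ∃ y : Y → Fin (w.length + 1), φ w (Sum.elim x y) := fun base loc hl => by
  obtain ⟨d, ⟨e⟩⟩ := Finite.exists_equiv_fin Y
  obtain ⟨c, hc⟩ := h (base + 1 + 2 * d) (Sum.elim loc fun j => base + 1 + 2 * e j) (by
    rintro (i | j)
    · have := hl i
      simp only [Sum.elim_inl]
      lia
    · have := (e j).2
      simp only [Sum.elim_inr]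
      lia)
  refine ⟨seq (drain (some base) Cmd.skip) <| seq (rep (base + 1) d (seq c (ite id
    (dec (some base) (inc (some base) Cmd.skip Cmd.skip) (inc (some base) Cmd.skip Cmd.skip))
    Cmd.skip))) (dec (some base) (assign fun _ => true) (assign fun _ => false)),
    fun w hw f v₀ hv₀ x hx => ?_⟩
  have hw' : 0 < w.length := List.length_pos_of_ne_nil hw
  let I : List (List ℕ) → Regs ℕ → Prop := fun vis v => (∀ i < base, v (some i) = v₀ (some i)) ∧
    (v (some base) ≠ 0 ↔ ∃ y, toList e y ∈ vis ∧ φ w (Sum.elim x y))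
  have hI : ∀ vis, Local (base + 1) (I vis) := fun vis v v' hvv h =>
    ⟨fun i hi => (hvv i (by lia)).symm.trans (h.1 i hi), hvv base (by lia) ▸ h.2⟩
  have hrep := tr_rep (w := w) (b := base + 1) (d := d) (I := I) hI (c := seq c (ite id
    (dec (some base) (inc (some base) Cmd.skip Cmd.skip) (inc (some base) Cmd.skip Cmd.skip))
    Cmd.skip)) (by
      rintro vis v₁' f v ⟨h1, ⟨h2, h3⟩, rfl⟩
      obtain ⟨b, v', e1, h4, h5, h6⟩ := hc w hw f v h1 (Sum.elim x (ofRegs e (base + 1) h1)) (by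
        rintro (i | j)
        · exact (h2 _ (hl i)).trans (hx i)
        · rfl)
      have h7 : (∃ y, toList e y ∈ vis ++ [vals (base + 1) d v] ∧ φ w (Sum.elim x y)) ↔
          v (some base) ≠ 0 ∨ b = true := by
        rw [h3, h4]
        simp only [List.mem_append, List.mem_singleton, or_and_right, exists_or,
          ← toList_ofRegs e _ h1, (toList_injective e).eq_iff, exists_eq_left]
      have h8 : v' (some base) = v (some base) := h6 _ (by lia)
      cases b with
      | false =>
        refine ⟨_, v', e1.seq (.ite_false rfl Runs.skip), h5, ⟨fun i hi =>
          (h6 i (by lia)).trans (h2 i hi), by rw [h7, h8]; simp⟩, fun i hi hi' => h6 i (by lia)⟩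
      | true =>
        -- A positive value is first lowered and then raised, so it stays positive and within the
        -- bound; raising zero needs `|w| > 0`.
        have key : ∃ k, k ≠ 0 ∧ k ≤ w.length ∧ Runs true w (seq c (ite id
            (dec (some base) (inc (some base) Cmd.skip Cmd.skip)
            (inc (some base) Cmd.skip Cmd.skip)) Cmd.skip)) (f, v)
            (true, Function.update v' (some base) k) := by
          by_cases hz : v' (some base) = 0
          · refine ⟨v' (some base) + 1, by lia, by lia, e1.seq (.ite_true rfl (.dec_zero hz
              (.inc_lt (by dsimp only; lia) Runs.skip)))⟩
          · have := h5 (some base)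
            refine ⟨v' (some base) - 1 + 1, by lia, by lia, e1.seq (.ite_true rfl (.dec_pos hz
              (.inc_lt (by simp; lia) ?_)))⟩
            simpa using Runs.skip
        obtain ⟨k, hk, hk', e2⟩ := key
        refine ⟨_, _, e2, h5.update hk', ⟨fun i hi => ?_, by rw [h7]; simp [hk]⟩,
          fun i hi hi' => ?_⟩
        · rw [Function.update_of_ne (by simp; lia)]
          exact (h6 i (by lia)).trans (h2 i hi)
        · rw [Function.update_of_ne (by simp; lia)]
          exact h6 i (by lia))
  obtain ⟨f', v', e1, h1, h2, h3⟩ := hrep [] f (Function.update v₀ (some base) 0)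
    ⟨hv₀.update (Nat.zero_le _), fun i hi => by simp [hi.ne], by simp⟩
  have h4 : v' (some base) ≠ 0 ↔ ∃ y : Y → Fin (w.length + 1), φ w (Sum.elim x y) := by
    rw [h3]
    simp [toList_mem]
  by_cases hz : v' (some base) = 0
  · refine ⟨_, v', (Runs.drain_skip f v₀ _).seq (e1.seq (.dec_zero hz (Runs.assign _))), ?_, h1, h2⟩
    exact iff_of_false (by simp) fun hy => h4.2 hy hz
  · refine ⟨_, _, (Runs.drain_skip f v₀ _).seq (e1.seq (.dec_pos hz (Runs.assign _))), ?_,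
      h1.update ((Nat.sub_le _ _).trans (h1 _)), fun i hi => ?_⟩
    · exact iff_of_true rfl (h4.1 hz)
    · simpa [hi.ne] using h2 i hi

/-! ## Deterministic transitive closure -/

/-- Copying a tuple of registers. -/
def copyList (src dst : X → ℕ) : List X → FCmd A
  | [] => Cmd.skip
  | i :: is => seq (copy (src i) (dst i)) (copyList src dst is)

theorem tr_copyList {src dst : X → ℕ} (hd : Function.Injective dst) (hsd : ∀ i j, src i ≠ dst j)
    (is : List X) (v₀ : Regs ℕ) :
    Tr w (fun v => Bdd w v ∧ v = v₀) (copyList src dst is) (fun v => Bdd w v ∧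
      (∀ i, v (some (dst i)) = v₀ (some (src i)) ∨ i ∉ is ∧ v (some (dst i)) = v₀ (some (dst i))) ∧
      ∀ j, (∀ i, j ≠ dst i) → v (some j) = v₀ (some j)) := by
  induction is generalizing v₀ with
  | nil =>
    refine Tr.skip ?_
    rintro v ⟨h, rfl⟩
    exact ⟨h, fun i => Or.inr ⟨by simp, rfl⟩, fun _ _ => rfl⟩
  | cons i is ih =>
    rintro f v ⟨hv, rfl⟩
    obtain ⟨f₁, v₁, e1, h1, h2, h3⟩ := tr_copy (hsd i i) v f v ⟨hv, rfl⟩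
    obtain ⟨f₂, v₂, e2, h4, h5, h6⟩ := ih v₁ f₁ v₁ ⟨h1, rfl⟩
    refine ⟨f₂, v₂, e1.seq e2, h4, fun j => ?_, fun j hj => ?_⟩
    · rcases h5 j with h | ⟨h, h'⟩
      · exact Or.inl (h.trans (h3 _ (hsd j i)))
      · by_cases hij : j = i
        · subst hij
          exact Or.inl (h'.trans h2)
        · exact Or.inr ⟨by simp [hij, h], h'.trans (h3 _ (hd.ne hij))⟩
    · exact (h6 j hj).trans (h3 j (hj i))

theorem exists_copy [Finite X] {src dst : X → ℕ} (hd : Function.Injective dst)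
    (hsd : ∀ i j, src i ≠ dst j) : ∃ c : FCmd A, ∀ (w : List A) (v₀ : Regs ℕ),
      Tr w (fun v => Bdd w v ∧ v = v₀) c (fun v => Bdd w v ∧
        (∀ i, v (some (dst i)) = v₀ (some (src i))) ∧
        ∀ j, (∀ i, j ≠ dst i) → v (some j) = v₀ (some j)) := by
  have := Fintype.ofFinite X
  refine ⟨copyList src dst Finset.univ.toList, fun w v₀ => (tr_copyList hd hsd _ v₀).mono
    (fun _ h => h) ?_⟩
  rintro v ⟨h1, h2, h3⟩
  exact ⟨h1, fun i => (h2 i).resolve_right (by simp), h3⟩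

/-- If `p` were first met after more than `N` steps, two earlier iterates would coincide, and
cutting out the cycle would meet `p` sooner. Points satisfying `p` are fixed, so `p` persists until
step `N`. -/
theorem iterate_card {V : Type*} [Finite V] {N : ℕ} (hN : Nat.card V ≤ N) {f : V → V}
    {p : V → Prop} (hf : ∀ y, p y → f y = y) {x : V} {k : ℕ} (hk : p (f^[k] x)) : p (f^[N] x) := by
  classical
  have hex : ∃ k, p (f^[k] x) := ⟨k, hk⟩
  have hle : Nat.find hex ≤ N := by
    by_contra hlt
    have : ¬ Function.Injective fun i : Fin (N + 1) => f^[i] x := fun hinj => by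
      have := Nat.card_le_card_of_injective _ hinj
      rw [Nat.card_fin] at this
      lia
    simp only [Function.Injective, not_forall] at this
    obtain ⟨i, j, hij, hne⟩ := this
    have key : ∀ i j : Fin (N + 1), i < j → f^[i] x = f^[j] x → False := fun i j hlt' hij => by
      have hj := j.2
      have hij' : i.val < j.val := hlt'
      refine Nat.find_min hex (m := Nat.find hex - j + i) (by lia) ?_
      have h1 := Nat.find_spec hex
      rw [show Nat.find hex = Nat.find hex - j + j by lia, Function.iterate_add_apply, ← hij,
        ← Function.iterate_add_apply] at h1
      exact h1
    rcases lt_or_gt_of_ne hne with h | h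
    · exact key i j h hij
    · exact key j i h hij.symm
  have h1 := Nat.find_spec hex
  have h2 : ∀ m, f^[m] (f^[Nat.find hex] x) = f^[Nat.find hex] x := fun m => by
    induction m with
    | zero => rfl
    | succ m ih => rw [Function.iterate_succ_apply, hf _ h1, ih]
  rw [show N = N - Nat.find hex + Nat.find hex by lia, Function.iterate_add_apply, h2]
  exact h1

/-- One step of the search for a tuple that satisfies `p`. -/
def Next {V : Type*} (R : V → V → Prop) (p : V → Prop) (y z : V) : Prop :=
  (p y ∧ z = y) ∨ ¬ p y ∧ (R y z ∨ z = y ∧ ∀ z', ¬ R y z')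

theorem exists_next {V : Type*} (R : V → V → Prop) (p : V → Prop) (y : V) : ∃ z, Next R p y z := by
  by_cases hp : p y
  · exact ⟨y, Or.inl ⟨hp, rfl⟩⟩
  · by_cases hz : ∃ z, R y z
    · obtain ⟨z, hz⟩ := hz
      exact ⟨z, Or.inr ⟨hp, Or.inl hz⟩⟩
    · exact ⟨y, Or.inr ⟨hp, Or.inr ⟨rfl, not_exists.1 hz⟩⟩⟩

theorem Next.unique {V : Type*} {R : V → V → Prop} {p : V → Prop} {y z z' : V}
    (hR : ∀ z z', R y z → R y z' → z = z') (h : Next R p y z) (h' : Next R p y z') : z = z' := by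
  rcases h with ⟨h1, rfl⟩ | ⟨h1, h2⟩
  · rcases h' with ⟨h1', rfl⟩ | ⟨h1', h2'⟩
    · rfl
    · exact absurd h1 h1'
  · rcases h' with ⟨h1', rfl⟩ | ⟨h1', h2'⟩
    · exact absurd h1' h1
    · rcases h2 with h2 | ⟨rfl, h2⟩
      · rcases h2' with h2' | ⟨rfl, h2'⟩
        · exact hR _ _ h2 h2'
        · exact absurd h2 (h2' _)
      · rcases h2' with h2' | ⟨rfl, h2'⟩
        · exact absurd h2' (h2 _)
        · rfl

/-- `Next` completes a functional relation to a total function that rests at points satisfying `p`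
and at dead ends, so a fixed number of iterations decides reachability. -/
theorem iterate_next_iff {V : Type*} [Finite V] {N : ℕ} (hN : Nat.card V ≤ N) {R : V → V → Prop}
    {p : V → Prop} (hR : ∀ y z z', R y z → R y z' → z = z') {f : V → V}
    (hf : ∀ y, Next R p y (f y)) (x : V) :
    p (f^[N] x) ↔ ∃ y, ReflTransGen R x y ∧ p y := by
  constructor
  · intro h
    refine ⟨_, ?_, h⟩
    clear hN h
    induction N with
    | zero => exact ReflTransGen.refl
    | succ N ih =>
      rw [Function.iterate_succ_apply']
      rcases hf (f^[N] x) with ⟨-, h⟩ | ⟨-, h | ⟨h, -⟩⟩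
      · rwa [h]
      · exact ih.tail h
      · rwa [h]
  · rintro ⟨y, hxy, hy⟩
    have : ∃ k, p (f^[k] x) := by
      induction hxy using ReflTransGen.head_induction_on with
      | refl => exact ⟨0, hy⟩
      | @head a b hab _ ih =>
        by_cases ha : p a
        · exact ⟨0, ha⟩
        · obtain ⟨k, hk⟩ := ih
          refine ⟨k + 1, ?_⟩
          rw [Function.iterate_succ_apply]
          rwa [(hf a).unique (hR a) (Or.inr ⟨ha, Or.inl hab⟩)]
    obtain ⟨k, hk⟩ := this
    refine iterate_card hN (fun y hy => ?_) hk
    exact (hf y).unique (hR y) (Or.inl ⟨hy, rfl⟩)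

/-- The registers `cur` hold the current tuple. Unless `ψ` holds, all candidates are tried, a
successor is stored in `nxt` and copied back. Repeating this once for each of the `(|w| + 1) ^ d`
tuples is enough. -/
theorem LD.reach [Finite X] {φ : Formula A (X ⊕ X)} {ψ : Formula A X} (h : LD φ) (h' : LD ψ)
    (hφ : ∀ w, w ≠ [] → ∀ y z z', φ w (Sum.elim y z) → φ w (Sum.elim y z') → z = z') :
    LD fun w x => ∃ y, ReflTransGen (fun a b => φ w (Sum.elim a b)) x y ∧ ψ w y :=
  fun base loc hl => by
  obtain ⟨d, ⟨e⟩⟩ := Finite.exists_equiv_fin X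
  obtain ⟨b₁, hb₁⟩ : ∃ b, b = base + 2 * d := ⟨_, rfl⟩
  obtain ⟨b₂, hb₂⟩ : ∃ b, b = b₁ + 2 * d := ⟨_, rfl⟩
  obtain ⟨cur, hcur⟩ : ∃ cur : X → ℕ, ∀ i, cur i = base + e i := ⟨_, fun _ => rfl⟩
  obtain ⟨nxt, hnxt⟩ : ∃ nxt : X → ℕ, ∀ i, nxt i = base + d + e i := ⟨_, fun _ => rfl⟩
  obtain ⟨cand, hcand⟩ : ∃ cand : X → ℕ, ∀ i, cand i = b₂ + 2 * e i := ⟨_, fun _ => rfl⟩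
  have hinj : ∀ i j, (e i).val = e j → i = j := fun i j hij => e.injective (Fin.ext hij)
  have hlt : ∀ i, (e i).val < d := fun i => (e i).2
  have cur_inj : Function.Injective cur := fun i j hij => hinj i j (by rw [hcur, hcur] at hij; lia)
  have nxt_inj : Function.Injective nxt := fun i j hij =>
    hinj i j (by rw [hnxt, hnxt] at hij; lia)
  have cur_nxt : ∀ i j, cur i ≠ nxt j := fun i j => by
    have := hlt i
    rw [hcur, hnxt]
    lia
  have cand_nxt : ∀ i j, cand i ≠ nxt j := fun i j => by
    have := hlt j
    rw [hcand, hnxt]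
    lia
  have cur_lt : ∀ i, cur i < b₁ := fun i => by
    have := hlt i
    rw [hcur]
    lia
  have nxt_lt : ∀ i, nxt i < b₁ := fun i => by
    have := hlt i
    rw [hnxt]
    lia
  obtain ⟨cp₀, hcp₀⟩ := exists_copy (A := A) (src := loc) (dst := cur) cur_inj fun i j => by
    have := hl i
    rw [hcur]
    lia
  obtain ⟨cp₁, hcp₁⟩ := exists_copy (A := A) (src := cur) (dst := nxt) nxt_inj cur_nxt
  obtain ⟨cp₂, hcp₂⟩ := exists_copy (A := A) (src := cand) (dst := nxt) nxt_inj cand_nxt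
  obtain ⟨cp₃, hcp₃⟩ := exists_copy (A := A) (src := nxt) (dst := cur) cur_inj
    fun i j => (cur_nxt j i).symm
  obtain ⟨cφ, hcφ⟩ := h (b₂ + 2 * d) (Sum.elim cur cand) (by
    rintro (i | i)
    · have := cur_lt i
      simp only [Sum.elim_inl]
      lia
    · have := hlt i
      simp only [Sum.elim_inr, hcand]
      lia)
  obtain ⟨cψ, hcψ⟩ := h' b₂ cur fun i => (cur_lt i).trans_le (by lia)
  let inner : FCmd A := seq cφ (ite id cp₂ Cmd.skip)
  let outer : FCmd A := seq cψ (ite id Cmd.skip (seq cp₁ (seq (rep b₂ d inner) cp₃)))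
  refine ⟨seq cp₀ (seq (rep b₁ d outer) cψ), fun w hw f v₀ hv₀ x hx => ?_⟩
  choose nx hnx using exists_next (fun a b => φ w (Sum.elim a b)) (ψ w)
  have hinner : ∀ (y : X → Fin (w.length + 1)) (v₁ : Regs ℕ), (∀ i, v₁ (some (cur i)) = y i) →
      ¬ ψ w y → Tr w (fun v => Bdd w v ∧ (∀ i < b₂, (∀ j, i ≠ nxt j) → v (some i) = v₁ (some i)) ∧
        ∀ i, v (some (nxt i)) = y i) (rep b₂ d inner)
        (fun v => Bdd w v ∧ (∀ i < b₂, (∀ j, i ≠ nxt j) → v (some i) = v₁ (some i)) ∧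
          ∀ i, v (some (nxt i)) = nx y i) := by
    intro y v₁ hy hyψ
    -- `nxt` holds a successor already visited, or still the tuple `y` if no visited candidate is
    -- one.
    let I : List (List ℕ) → Regs ℕ → Prop := fun vis v =>
      (∀ i < b₂, (∀ j, i ≠ nxt j) → v (some i) = v₁ (some i)) ∧
      ∃ z : X → Fin (w.length + 1), (∀ i, v (some (nxt i)) = z i) ∧
        (toList e z ∈ vis ∧ φ w (Sum.elim y z) ∨
          z = y ∧ ∀ z', toList e z' ∈ vis → ¬ φ w (Sum.elim y z'))
    have hrep := tr_rep (w := w) (b := b₂) (d := d) (c := inner) (I := I)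
      (fun vis v v' hvv hh => ⟨fun i hi hij => (hvv i hi).symm.trans (hh.1 i hi hij),
        hh.2.imp fun z hz => ⟨fun i => (hvv _ ((nxt_lt i).trans_le (by lia))).symm.trans (hz.1 i),
          hz.2⟩⟩) (by
        rintro vis v₁' f v ⟨h1, ⟨h2, z, h3, h4⟩, rfl⟩
        obtain ⟨b, v', e1, h5, h6, h7⟩ := hcφ w hw f v h1 (Sum.elim y (ofRegs e b₂ h1)) (by
          rintro (i | j)
          · exact (h2 _ ((cur_lt i).trans_le (by lia)) (cur_nxt i)).trans (hy i)
          · simp [ofRegs, hcand])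
        have h8 : ∀ i < b₂, (∀ j, i ≠ nxt j) → v' (some i) = v₁ (some i) := fun i hi hij =>
          (h7 i (by lia)).trans (h2 i hi hij)
        cases b with
        | false =>
          have h5' : ¬ φ w (Sum.elim y (ofRegs e b₂ h1)) := by simpa using h5
          refine ⟨_, v', e1.seq (.ite_false rfl Runs.skip), h6, ⟨h8, z,
            fun i => (h7 _ ((nxt_lt i).trans_le (by lia))).trans (h3 i), ?_⟩,
            fun i hi hi' => h7 i (by lia)⟩
          rcases h4 with ⟨h4, h4'⟩ | ⟨h4, h4'⟩
          · exact Or.inl ⟨by simp [h4], h4'⟩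
          · refine Or.inr ⟨h4, fun z' hz' => ?_⟩
            rcases List.mem_append.1 hz' with hz' | hz'
            · exact h4' z' hz'
            · rw [List.mem_singleton, ← toList_ofRegs e _ h1] at hz'
              rwa [toList_injective e hz']
        | true =>
          obtain ⟨f₂, v₂, e2, h9, h10, h11⟩ := hcp₂ w v' true v' ⟨h6, rfl⟩
          refine ⟨_, v₂, e1.seq (.ite_true rfl e2), h9, ⟨fun i hi hij =>
            (h11 i hij).trans (h8 i hi hij), ofRegs e b₂ h1, fun i => ?_, Or.inl ⟨?_, h5.1 rfl⟩⟩,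
            fun i hi hi' => ?_⟩
          · have := hlt i
            rw [h10, h7 _ (by rw [hcand]; lia), hcand]
            rfl
          · rw [toList_ofRegs]
            simp
          · rw [h11 i fun j => ?_, h7 i (by lia)]
            have := nxt_lt j
            lia) []
    refine hrep.mono ?_ ?_
    · rintro v ⟨h1, h2, h3⟩
      exact ⟨h1, h2, y, h3, Or.inr ⟨rfl, by simp⟩⟩
    · rintro v ⟨h1, h2, z, h3, h4⟩
      refine ⟨h1, h2, fun i => ?_⟩
      rw [h3, (hnx y).unique (hφ w hw y) (z' := z) (Or.inr ⟨hyψ, ?_⟩)]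
      rcases h4 with h4 | ⟨h4, h4'⟩
      · exact Or.inl h4.2
      · exact Or.inr ⟨h4, fun z' => h4' z' (by simpa using toList_mem e z')⟩
  -- The outer loops are merely a clock: only the number of visited tuples matters.
  let I : List (List ℕ) → Regs ℕ → Prop := fun vis v => (∀ i < base, v (some i) = v₀ (some i)) ∧
    ∀ i, v (some (cur i)) = (nx^[vis.length] x i).val
  have houter := tr_rep (w := w) (b := b₁) (d := d) (c := outer) (I := I)
    (fun vis v v' hvv hh => ⟨fun i hi => (hvv i (by lia)).symm.trans (hh.1 i hi),
      fun i => (hvv _ (cur_lt i)).symm.trans (hh.2 i)⟩) (by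
      rintro vis v₁' f v ⟨h1, ⟨h2, h3⟩, rfl⟩
      obtain ⟨b, v', e1, h4, h5, h6⟩ := hcψ w hw f v h1 _ h3
      have hbase : ∀ i < base, v' (some i) = v₀ (some i) := fun i hi =>
        (h6 i (by lia)).trans (h2 i hi)
      have hcur' : ∀ i, v' (some (cur i)) = (nx^[vis.length] x i).val := fun i =>
        (h6 _ ((cur_lt i).trans_le (by lia))).trans (h3 i)
      cases b with
      | true =>
        refine ⟨_, v', e1.seq (.ite_true rfl Runs.skip), h5, ⟨hbase, fun i => ?_⟩,
          fun i hi hi' => h6 i (by lia)⟩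
        rw [hcur', List.length_append, List.length_singleton, Function.iterate_succ_apply',
          (hnx _).unique (hφ w hw _) (Or.inl ⟨h4.1 rfl, rfl⟩)]
      | false =>
        have h4' : ¬ ψ w (nx^[vis.length] x) := by simpa using h4
        obtain ⟨f₂, v₂, e2, h7, h8, h9⟩ := hcp₁ w v' false v' ⟨h5, rfl⟩
        obtain ⟨f₃, v₃, e3, h10, h11, h12⟩ := hinner _ v' hcur' h4' f₂ v₂
          ⟨h7, fun i _ hij => h9 i hij, fun i => (h8 i).trans (hcur' i)⟩
        obtain ⟨f₄, v₄, e4, h13, h14, h15⟩ := hcp₃ w v₃ f₃ v₃ ⟨h10, rfl⟩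
        refine ⟨_, v₄, e1.seq (.ite_false rfl (e2.seq (e3.seq e4))), h13, ⟨fun i hi => ?_,
          fun i => ?_⟩, fun i hi hi' => ?_⟩
        · rw [h15 i (fun j => by rw [hcur]; lia), h11 i (by lia) (fun j => by rw [hnxt]; lia),
            hbase i hi]
        · rw [h14, h12, List.length_append, List.length_singleton, Function.iterate_succ_apply']
        · rw [h15 i (fun j => by have := cur_lt j; lia),
            h11 i (by lia) (fun j => by have := nxt_lt j; lia), h6 i (by lia)]) []
  obtain ⟨f₁, v₁, e1, h1, h2, h3⟩ := hcp₀ w v₀ f v₀ ⟨hv₀, rfl⟩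
  obtain ⟨f₂, v₂, e2, h4, h5, h6⟩ := houter f₁ v₁ ⟨h1, fun i hi => h3 i fun j => by
    rw [hcur]
    lia, fun i => (h2 i).trans (hx i)⟩
  obtain ⟨b, v₃, e3, h7, h8, h9⟩ := hcψ w hw f₂ v₂ h4 _ h6
  refine ⟨b, v₃, e1.seq (e2.seq e3), h7.trans ?_, h8, fun i hi => (h9 i (by lia)).trans (h5 i hi)⟩
  refine iterate_next_iff ?_ (hφ w hw) hnx x
  rw [List.nil_append, length_allVals, Nat.card_fun, Nat.card_congr e, Nat.card_fin, Nat.card_fin]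

end RegMachine.Logic


/-! # Predicates on factors -/

namespace RegMachine.Logic

open Relation

universe u

variable {A : Type u} {X Y I J : Type} {w : List A}

theorem LD.lt (i j : X) : LD (A := A) fun _ x => x i < x j :=
  (LD.le j i).not.congr fun _ _ _ => not_le

theorem LD.eq (i j : X) : LD (A := A) fun _ x => x i = x j :=
  ((LD.le i j).and (LD.le j i)).congr fun _ _ _ => le_antisymm_iff.symm

theorem LD.succ (i j : X) : LD (A := A) fun _ x => (x j).val = (x i).val + 1 := by
  have := LD.ex (A := A) (X := X) (Y := Unit) ((LD.lt (Sum.inl i) (Sum.inr ())).and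
    (LD.lt (Sum.inr ()) (Sum.inl j)))
  refine ((LD.lt i j).and this.not).congr fun w _ x => ?_
  simp only [Sum.elim_inl, Sum.elim_inr, Fin.lt_def, not_exists, not_and, not_lt]
  constructor
  · rintro ⟨h1, h2⟩
    by_contra h3
    have := h2 (fun _ => ⟨(x i).val + 1, by have := (x j).2; lia⟩) (Nat.lt_succ_self _)
    dsimp only at this
    lia
  · intro h
    exact ⟨by lia, fun y hy => by lia⟩

theorem LD.zero (i : X) : LD (A := A) fun _ x => (x i).val = 0 := by
  have := LD.ex (A := A) (X := X) (Y := Unit) (LD.lt (Sum.inr ()) (Sum.inl i))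
  refine this.not.congr fun w _ x => ?_
  simp only [Sum.elim_inl, Sum.elim_inr, Fin.lt_def, not_exists, not_lt]
  exact ⟨fun h => Nat.le_zero.1 (h fun _ => 0), fun h y => by lia⟩

theorem LD.last (i : X) : LD (A := A) fun w x => (x i).val = w.length := by
  have := LD.ex (A := A) (X := X) (Y := Unit) (LD.lt (Sum.inl i) (Sum.inr ()))
  refine this.not.congr fun w _ x => ?_
  simp only [Sum.elim_inl, Sum.elim_inr, Fin.lt_def, not_exists, not_lt]
  refine ⟨fun h => le_antisymm (Fin.is_le _) (h fun _ => Fin.last _), fun h y => ?_⟩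
  have := (y ()).2
  lia

/-- The factor of a word between two positions. -/
def fac (w : List A) (s e : ℕ) : List A := (w.drop s).take (e - s)

theorem fac_eq_nil {s e : ℕ} (h : e ≤ s) : fac w s e = [] := by
  simp [fac, Nat.sub_eq_zero_of_le h]

theorem length_fac {s e : ℕ} (h : e ≤ w.length) : (fac w s e).length = e - s := by
  simp [fac]
  lia

theorem fac_infix (w : List A) (s e : ℕ) : fac w s e <:+: w :=
  (List.take_prefix _ _).isInfix.trans (List.drop_suffix _ _).isInfix

theorem exists_fac_cons {s e : ℕ} (h : s < e) (he : e ≤ w.length) :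
    ∃ a, w[s]? = some a ∧ fac w s e = a :: fac w (s + 1) e := by
  have hs : s < w.length := by lia
  refine ⟨w[s], List.getElem?_eq_getElem hs, ?_⟩
  rw [fac, List.drop_eq_getElem_cons hs, show e - s = e - (s + 1) + 1 by lia, List.take_succ_cons,
    fac]

theorem fac_append {s m e : ℕ} (h : s ≤ m) (h' : m ≤ e) :
    fac w s e = fac w s m ++ fac w m e := by
  rw [fac, fac, fac, show e - s = (m - s) + (e - m) by lia, List.take_add, List.drop_drop,
    show s + (m - s) = m by lia]

theorem fac_full (w : List A) : fac w 0 w.length = w := by simp [fac]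

theorem exists_fac_eq {x : List A} (h : x <:+: w) :
    ∃ s e : Fin (w.length + 1), s ≤ e ∧ fac w s e = x := by
  obtain ⟨a, b, rfl⟩ := h
  refine ⟨⟨a.length, by simp⟩, ⟨a.length + x.length, by simp⟩, by simp [Fin.le_def], ?_⟩
  simp [fac]

/-- The factors that are given by a tuple of pairs of positions. -/
def facs (x : I × Bool → Fin (w.length + 1)) (i : I) : List A := fac w (x (i, false)) (x (i, true))

theorem facs_infix (x : I × Bool → Fin (w.length + 1)) (i : I) : facs x i <:+: w := fac_infix _ _ _

/-- Two factors are compared letter by letter: both left ends advance as long as they read the same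
letter, and the factors agree if both become empty together. This is a deterministic reachability
question. -/
theorem LD.facs_eq [Finite A] (I : Type) (i j : I) :
    LD (X := I × Bool) fun (_ : List A) x => facs x i = facs x j := by
  let S : Formula A ((Bool × Bool) ⊕ (Bool × Bool)) := fun w x => ∀ i,
    x (.inl (i, false)) < x (.inl (i, true)) ∧
    (∃ a, ∀ j, w[(x (.inl (j, false))).val]? = some a) ∧
    (x (.inr (i, false))).val = (x (.inl (i, false))).val + 1 ∧
    x (.inr (i, true)) = x (.inl (i, true))
  let E : Formula A (Bool × Bool) := fun w x => ∀ i, x (i, true) ≤ x (i, false)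
  have hS : LD S := LD.forall_finite fun i => (LD.lt _ _).and
    ((LD.exists_finite fun a => LD.forall_finite fun j => LD.letter _ a).and
    ((LD.succ _ _).and (LD.eq _ _)))
  have hE : LD E := LD.forall_finite fun i => LD.le _ _
  have hdet : ∀ w, w ≠ [] → ∀ y z z', S w (Sum.elim y z) → S w (Sum.elim y z') → z = z' := by
    rintro w - y z z' h h'
    funext ⟨i, b⟩
    obtain ⟨-, -, h1, h2⟩ := h i
    obtain ⟨-, -, h1', h2'⟩ := h' i
    cases b with
    | false => exact Fin.ext (h1.trans h1'.symm)
    | true => exact h2.trans h2'.symm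
  refine LD.congr ((LD.reach hS hE hdet).reindex
    (fun p : Bool × Bool => (bif p.1 then i else j, p.2))) fun w _ x => ?_
  have key : ∀ x : Bool × Bool → Fin (w.length + 1),
      (∃ y, ReflTransGen (fun a b => S w (Sum.elim a b)) x y ∧ E w y) ↔
        facs x true = facs x false := by
    intro x
    constructor
    · rintro ⟨y, hxy, hy⟩
      induction hxy using ReflTransGen.head_induction_on with
      | refl => rw [facs, facs, fac_eq_nil (hy true), fac_eq_nil (hy false)]
      | @head a b hab _ ih =>
        have h : ∀ i, ∃ c, w[(a (i, false)).val]? = some c ∧ facs a i = c :: facs b i := by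
          intro i
          obtain ⟨h1, -, h2, h3⟩ := hab i
          obtain ⟨c, hc, h4⟩ := exists_fac_cons h1 (Fin.is_le _)
          refine ⟨c, hc, ?_⟩
          simp only [Sum.elim_inl, Sum.elim_inr] at h2 h3 h4
          rw [facs, facs, h2, h3, h4]
        obtain ⟨c, hc, h1⟩ := h true
        obtain ⟨c', hc', h2⟩ := h false
        obtain ⟨-, ⟨a', ha⟩, -⟩ := hab true
        have e1 := (ha true).symm.trans hc
        have e2 := (ha false).symm.trans hc'
        rw [h1, h2, ih, ← Option.some.inj e1, ← Option.some.inj e2]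
    · intro h
      obtain ⟨k, hk⟩ : ∃ k, (x (true, true)).val - (x (true, false)).val = k := ⟨_, rfl⟩
      have hl : (x (true, true)).val - (x (true, false)).val =
          (x (false, true)).val - (x (false, false)).val := by
        have := congrArg List.length h
        rwa [facs, facs, length_fac (Fin.is_le _), length_fac (Fin.is_le _)] at this
      induction k generalizing x with
      | zero =>
        refine ⟨x, ReflTransGen.refl, ?_⟩
        rintro (_ | _)
        · rw [Fin.le_def]
          lia
        · rw [Fin.le_def]
          lia
      | succ k ih =>
        have hlt : ∀ i, (x (i, false)).val < (x (i, true)).val := by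
          rintro (_ | _) <;> lia
        let y : Bool × Bool → Fin (w.length + 1) := fun p =>
          if h : p.2 = true then x p else ⟨(x (p.1, false)).val + 1, by
            have := hlt p.1
            have := (x (p.1, true)).2
            lia⟩
        have h1 : ∀ i, ∃ c, w[(x (i, false)).val]? = some c ∧ facs x i = c :: facs y i :=
          fun i => exists_fac_cons (hlt i) (Fin.is_le _)
        obtain ⟨c, hc, h2⟩ := h1 true
        obtain ⟨c', hc', h3⟩ := h1 false
        rw [h2, h3, List.cons.injEq] at h
        obtain ⟨rfl, h⟩ := h
        obtain ⟨z, hz, hz'⟩ := ih y h (by simp [y]; lia) (by simp [y]; lia)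
        refine ⟨z, ReflTransGen.head ?_ hz, hz'⟩
        intro i
        refine ⟨hlt i, ⟨c, ?_⟩, rfl, rfl⟩
        rintro (_ | _)
        · exact hc'
        · exact hc
  exact key _

/-- Predicates on tuples of factors that are decided by programs. -/
def LW (φ : List A → (I → List A) → Prop) : Prop :=
  LD (X := I × Bool) fun w x => φ w (facs x)

variable {φ ψ : List A → (I → List A) → Prop}

theorem LW.congr (h : LW φ) (h' : ∀ w, w ≠ [] → ∀ x : I → List A, (∀ i, x i <:+: w) → (φ w x ↔ ψ w x)) :
    LW ψ := LD.congr h fun w hw x => h' w hw _ (facs_infix x)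

theorem LW.reindex (h : LW φ) (e : I → J) : LW (I := J) fun w y => φ w (y ∘ e) :=
  LD.reindex h fun p : I × Bool => (e p.1, p.2)

theorem LW.and (h : LW φ) (h' : LW ψ) : LW fun w x => φ w x ∧ ψ w x := LD.and h h'

theorem LW.const (p : Prop) : LW (A := A) (I := I) fun _ _ => p := LD.const p

theorem LW.forall_finite {ι : Type*} [Finite ι] {φ : ι → List A → (I → List A) → Prop}
    (h : ∀ i, LW (φ i)) : LW fun w x => ∀ i, φ i w x := LD.forall_finite h

theorem LW.exists_finite {ι : Type*} [Finite ι] {φ : ι → List A → (I → List A) → Prop}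
    (h : ∀ i, LW (φ i)) : LW fun w x => ∃ i, φ i w x := LD.exists_finite h

theorem LW.and_const {p : Prop} (h : p → LW φ) : LW fun w x => p ∧ φ w x := by
  by_cases hp : p
  · exact (h hp).congr fun w _ x _ => by simp [hp]
  · exact (LW.const False).congr fun w _ x _ => by simp [hp]

theorem LW.eq [Finite A] (i j : I) : LW fun (_ : List A) x => x i = x j := LD.facs_eq I i j

theorem LW.nil (i : I) : LW fun (_ : List A) x => x i = [] :=
  (LD.le (i, true) (i, false)).congr fun w _ x => by
    change _ ↔ facs x i = []
    rw [← List.length_eq_zero_iff, facs, length_fac (Fin.is_le _), Fin.le_def]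
    lia

theorem LW.full (i : I) : LW fun (w : List A) x => x i = w :=
  ((LD.zero (i, false)).and (LD.last (i, true))).congr fun w hw x => by
    constructor
    · rintro ⟨h1, h2⟩
      rw [facs, h1, h2, fac_full]
    · intro (h : facs x i = w)
      have h1 := congrArg List.length h
      have h2 := List.length_pos_of_ne_nil hw
      have h3 := (x (i, true)).2
      rw [facs, length_fac (Fin.is_le _)] at h1
      lia

theorem LW.single (i : I) (a : A) : LW fun (_ : List A) x => x i = [a] :=
  ((LD.succ (i, false) (i, true)).and (LD.letter (i, false) a)).congr fun w _ x => by
    constructor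
    · rintro ⟨h1, h2⟩
      obtain ⟨b, h3, h4⟩ := exists_fac_cons (w := w) (s := x (i, false)) (e := x (i, true))
        (by lia) (Fin.is_le _)
      rw [facs, h4, fac_eq_nil (by lia), ← Option.some.inj (h2.symm.trans h3)]
    · intro (h : facs x i = [a])
      have h1 := congrArg List.length h
      rw [facs, length_fac (Fin.is_le _), List.length_singleton] at h1
      obtain ⟨b, h3, h4⟩ := exists_fac_cons (w := w) (s := x (i, false)) (e := x (i, true))
        (by lia) (Fin.is_le _)
      rw [facs, h4, List.cons.injEq] at h
      exact ⟨by lia, by rw [h3, h.1]⟩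

/-- Either a cut between the two ends of the factor splits it as required, or all three words are
empty. The second case covers pairs with the left end behind the right end, where no cut exists. -/
theorem LW.append [Finite A] (i j k : I) : LW fun (_ : List A) x => x i = x j ++ x k := by
  have h1 : LD (X := I × Bool) fun (w : List A) x => ∃ m : Unit → Fin (w.length + 1),
      (x (i, false) ≤ m () ∧ m () ≤ x (i, true)) ∧ facs x j = fac w (x (i, false)) (m ()) ∧
        facs x k = fac w (m ()) (x (i, true)) := by
    refine LD.ex (Y := Unit) (φ := fun (w : List A) x =>
      (x (Sum.inl (i, false)) ≤ x (Sum.inr ()) ∧ x (Sum.inr ()) ≤ x (Sum.inl (i, true))) ∧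
      fac w (x (Sum.inl (j, false))) (x (Sum.inl (j, true))) =
        fac w (x (Sum.inl (i, false))) (x (Sum.inr ())) ∧
      fac w (x (Sum.inl (k, false))) (x (Sum.inl (k, true))) =
        fac w (x (Sum.inr ())) (x (Sum.inl (i, true))))
      (((LD.le _ _).and (LD.le _ _)).and (LD.and ?_ ?_))
    · exact LD.reindex (LD.facs_eq Bool false true) fun p =>
        bif p.1 then (bif p.2 then Sum.inr () else Sum.inl (i, false)) else Sum.inl (j, p.2)
    · exact LD.reindex (LD.facs_eq Bool false true) fun p =>
        bif p.1 then (bif p.2 then Sum.inl (i, true) else Sum.inr ()) else Sum.inl (k, p.2)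
  refine LD.congr (h1.or ((LW.nil i).and ((LW.nil j).and (LW.nil k)))) fun w _ x => ?_
  constructor
  · rintro (⟨m, ⟨h1, h2⟩, h3, h4⟩ | ⟨h1, h2, h3⟩)
    · rw [h3, h4]
      exact fac_append h1 h2
    · rw [h1, h2, h3, List.append_nil]
  · intro (h : facs x i = facs x j ++ facs x k)
    by_cases hle : x (i, false) ≤ x (i, true)
    · left
      have h2 := congrArg List.length h
      rw [facs, length_fac (Fin.is_le _), List.length_append] at h2
      have hle' := Fin.le_def.1 hle
      have h5 := Fin.is_le (x (i, true))
      let m : Fin (w.length + 1) := ⟨(x (i, false)).val + (facs x j).length, by lia⟩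
      have h3 : x (i, false) ≤ m := Fin.le_def.2 (by simp [m])
      have h4 : m ≤ x (i, true) := Fin.le_def.2 (by simp [m]; lia)
      rw [facs, fac_append h3 h4] at h
      obtain ⟨h6, h7⟩ := List.append_inj h (by
        rw [length_fac (Fin.is_le _)]
        simp [m])
      exact ⟨fun _ => m, ⟨h3, h4⟩, h6.symm, h7.symm⟩
    · right
      have h1 : facs x i = [] := fac_eq_nil (le_of_not_ge hle)
      rw [h1] at h
      have h2 := List.append_eq_nil_iff.1 h.symm
      exact ⟨h1, h2⟩

/-- Every factor has an occurrence, so quantifying over factors is quantifying over pairs of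
positions. -/
theorem LW.ex [Finite J] {φ : List A → (I ⊕ J → List A) → Prop} (h : LW φ) :
    LW fun w x => ∃ u : J → List A, (∀ j, u j <:+: w) ∧ φ w (Sum.elim x u) := by
  have h1 : LD (X := (I × Bool) ⊕ (J × Bool)) fun w z => φ w (Sum.elim
      (facs fun p => z (.inl p)) (facs fun p => z (.inr p))) := by
    refine LD.congr (LD.reindex h fun p =>
      p.1.elim (fun i => .inl (i, p.2)) fun j => .inr (j, p.2))
      fun w _ x => iff_of_eq (congrArg _ ?_)
    funext i
    rcases i with i | j <;> rfl
  refine LD.congr (LD.ex h1) fun w _ x => ?_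
  constructor
  · rintro ⟨y, hy⟩
    exact ⟨facs y, facs_infix y, hy⟩
  · rintro ⟨u, hu, hφ⟩
    choose s e _ he using fun j => exists_fac_eq (hu j)
    refine ⟨fun p => bif p.2 then e p.1 else s p.1, ?_⟩
    have : u = facs (w := w) fun p : J × Bool => bif p.2 then e p.1 else s p.1 :=
      funext fun j => (he j).symm
    rw [this] at hφ
    exact hφ

/-- Every factor is given by its leftmost occurrence. -/
def Canon (w : List A) (x : I × Bool → Fin (w.length + 1)) : Prop :=
  ∀ i, x (i, false) ≤ x (i, true) ∧ ¬ ∃ z : Unit × Bool → Fin (w.length + 1),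
    z ((), false) ≤ z ((), true) ∧ facs z () = facs x i ∧ z ((), false) < x (i, false)

theorem LD.canon [Finite A] [Finite I] : LD (A := A) (X := I × Bool) Canon := by
  refine LD.forall_finite fun i => (LD.le _ _).and (LD.not ?_)
  refine LD.ex (Y := Unit × Bool) (φ := fun (w : List A) x =>
    x (Sum.inr ((), false)) ≤ x (Sum.inr ((), true)) ∧
    fac w (x (Sum.inr ((), false))) (x (Sum.inr ((), true))) =
      fac w (x (Sum.inl (i, false))) (x (Sum.inl (i, true))) ∧ x (Sum.inr ((), false)) < x (Sum.inl (i, false)))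
    ((LD.le _ _).and (LD.and ?_ (LD.lt _ _)))
  exact LD.reindex (LD.facs_eq Bool false true) fun p =>
    bif p.1 then Sum.inl (i, p.2) else Sum.inr ((), p.2)

/-- Leftmost occurrences of the same factor start at the same place, and equal lengths then give the
same end. -/
theorem Canon.eq {x y : I × Bool → Fin (w.length + 1)} (hx : Canon w x) (hy : Canon w y)
    (h : facs x = facs y) : x = y := by
  have h1 : ∀ x y : I × Bool → Fin (w.length + 1), Canon w x → Canon w y → facs x = facs y →
      ∀ i, x (i, false) ≤ y (i, false) := fun x y hx hy h i => by
    by_contra hlt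
    exact (hx i).2 ⟨fun p => y (i, p.2), (hy i).1, (congrFun h i).symm, not_le.1 hlt⟩
  have h2 : ∀ i, x (i, false) = y (i, false) := fun i =>
    le_antisymm (h1 x y hx hy h i) (h1 y x hy hx h.symm i)
  funext ⟨i, b⟩
  cases b with
  | false => exact h2 i
  | true =>
    have h3 := congrArg List.length (congrFun h i)
    rw [facs, facs, length_fac (Fin.is_le _), length_fac (Fin.is_le _), h2] at h3
    have h4 := Fin.le_def.1 (hx i).1
    have h5 := Fin.le_def.1 (hy i).1
    rw [h2] at h4
    exact Fin.ext (by lia)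

theorem exists_canon {u : I → List A} (hu : ∀ i, u i <:+: w) :
    ∃ x : I × Bool → Fin (w.length + 1), Canon w x ∧ facs x = u := by
  have h : ∀ i, ∃ s e : Fin (w.length + 1), s ≤ e ∧ fac w s e = u i ∧
      ∀ s' e' : Fin (w.length + 1), s' ≤ e' → fac w s' e' = u i → ¬ s' < s := fun i => by
    obtain ⟨s, ⟨e, he, hse⟩, hmin⟩ := WellFounded.has_min (r := (· < ·)) wellFounded_lt
      {s : Fin (w.length + 1) | ∃ e : Fin (w.length + 1), s ≤ e ∧ fac w s e = u i}
      (exists_fac_eq (hu i))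
    exact ⟨s, e, he, hse, fun s' e' h h' => hmin s' ⟨e', h, h'⟩⟩
  choose s e h1 h2 h3 using h
  refine ⟨fun p => bif p.2 then e p.1 else s p.1, fun i => ⟨h1 i, ?_⟩, funext h2⟩
  rintro ⟨z, hz, hz', hlt⟩
  exact h3 i _ _ hz (hz'.trans (h2 i)) hlt

/-- A relation that is functional on words is not functional on positions, as a factor can occur
several times. Restricting the targets to leftmost occurrences restores determinism and loses no
walk. -/
theorem LW.reach [Finite A] [Finite I] {φ : List A → (I ⊕ I → List A) → Prop}
    {ψ : List A → (I → List A) → Prop} (h : LW φ) (h' : LW ψ)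
    (hφ : ∀ w, w ≠ [] → ∀ y z z', φ w (Sum.elim y z) → φ w (Sum.elim y z') → z = z') :
    LW fun w x => ∃ y, ReflTransGen (fun a b => (∀ i, b i <:+: w) ∧ φ w (Sum.elim a b)) x y ∧
      ψ w y := by
  have h1 : LD (X := (I × Bool) ⊕ (I × Bool)) fun w z => φ w (Sum.elim
      (facs fun p => z (.inl p)) (facs fun p => z (.inr p))) ∧ Canon w fun p => z (.inr p) := by
    refine LD.and (LD.congr (LD.reindex h fun p =>
      p.1.elim (fun i => .inl (i, p.2)) fun j => .inr (j, p.2)) fun w _ x => iff_of_eq (congrArg _ ?_))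
      (LD.reindex LD.canon fun p => Sum.inr p)
    funext i
    rcases i with i | j <;> rfl
  refine LD.congr (LD.reach h1 h' ?_) fun w _ x => ?_
  · rintro w hw y z z' ⟨h2, h3⟩ ⟨h2', h3'⟩
    exact h3.eq h3' (hφ w hw _ _ _ h2 h2')
  · constructor
    · rintro ⟨y, hxy, hy⟩
      exact ⟨facs y, ReflTransGen.lift facs (fun a b hab => ⟨facs_infix b, hab.1⟩) _ _ hxy, hy⟩
    · rintro ⟨u, hxu, hu⟩
      suffices ∃ y, ReflTransGen _ x y ∧ facs y = u by
        obtain ⟨y, hy, rfl⟩ := this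
        exact ⟨y, hy, hu⟩
      clear hu
      induction hxu with
      | refl => exact ⟨x, ReflTransGen.refl, rfl⟩
      | tail _ hbc ih =>
        obtain ⟨y, hy, rfl⟩ := ih
        obtain ⟨z, hz, rfl⟩ := exists_canon hbc.1
        exact ⟨z, hy.tail ⟨hbc.2, hz⟩, rfl⟩

/-- The first symbol is split off. The images of both parts are a prefix and a suffix of a factor of
`w`, so quantifiers over factors suffice. -/
theorem LW.pattern [Finite A] (α : FCDatalog.Pattern A) (i : I) (e : ℕ → I) :
    LW fun (_ : List A) x => x i = FCDatalog.Pattern.subst (fun n => x (e n)) α := by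
  induction α generalizing I with
  | nil => exact LW.nil i
  | cons s α ih =>
    have h1 : LW fun (_ : List A) (x : I ⊕ Bool → List A) =>
        x (.inr false) = Sum.elim (fun a => [a]) (fun n => x (.inl (e n))) s := by
      cases s with
      | inl a => exact LW.single _ a
      | inr n => exact LW.eq _ _
    refine ((h1.and ((ih (.inr true) (fun n => .inl (e n))).and
      (LW.append (.inl i) (.inr false) (.inr true)))).ex).congr fun w _ x hx => ?_
    simp only [FCDatalog.Pattern.subst, List.flatMap_cons, Sum.elim_inl, Sum.elim_inr]
    constructor
    · rintro ⟨u, -, h2, h3, h4⟩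
      rw [h4, h2, h3]
    · intro h
      have hi := hx i
      rw [h] at hi
      refine ⟨fun b => bif b then α.flatMap (Sum.elim (fun a => [a]) fun n => x (e n)) else
        Sum.elim (fun a => [a]) (fun n => x (e n)) s, ?_, rfl, rfl, h⟩
      rintro (_ | _)
      · exact (List.prefix_append _ _).isInfix.trans hi
      · exact (List.suffix_append _ _).isInfix.trans hi

/-- Only the variables up to `N` matter, so the quantifier over substitutions is one over finitely
many factors. -/
theorem LW.ex_nat {φ : List A → (I ⊕ ℕ → List A) → Prop} (h : LW φ) (N : ℕ)
    (hN : ∀ w x θ θ', (∀ y ≤ N, θ y = θ' y) → φ w (Sum.elim x θ) → φ w (Sum.elim x θ')) :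
    LW fun w x => ∃ θ : ℕ → List A, (∀ y ≤ N, θ y <:+: w) ∧ φ w (Sum.elim x θ) := by
  refine LW.congr (LW.ex (h.reindex (Sum.map id (Fin.ofNat (N + 1))))) fun w _ x _ => ?_
  constructor
  · rintro ⟨u, hu, hφ⟩
    refine ⟨u ∘ Fin.ofNat (N + 1), fun y _ => hu _, ?_⟩
    rwa [Sum.elim_comp_map] at hφ
  · rintro ⟨θ, hθ, hφ⟩
    refine ⟨fun j => θ j, fun j => hθ _ (Fin.is_le j), ?_⟩
    rw [Sum.elim_comp_map]
    refine hN w x θ _ (fun y hy => ?_) hφ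
    simp [Nat.mod_eq_of_lt (Nat.lt_succ_of_le hy)]

end RegMachine.Logic


/-! # Evaluating deterministic linear programs -/

namespace FCDatalog.Program

open Relation RegMachine.Logic

universe u

variable {A : Type u} {P : Program A} {w : List A}

theorem _root_.FCDatalog.Pattern.subst_congr {θ θ' : ℕ → List A} {α : Pattern A}
    (h : ∀ y ∈ α.vars, θ y = θ' y) : α.subst θ = α.subst θ' := by
  induction α with
  | nil => rfl
  | cons s α ih =>
    have h2 := ih fun y hy => h y (by
      rcases s with a | n
      · simpa [Pattern.vars] using hy
      · simpa [Pattern.vars] using Or.inr hy)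
    simp only [Pattern.subst, List.flatMap_cons] at h2 ⊢
    rw [h2]
    rcases s with a | n
    · rfl
    · rw [Sum.elim_inr, Sum.elim_inr, h n (by simp [Pattern.vars])]

theorem Sat.congr {θ θ' : ℕ → List A} {I : P.Interp} {φ : Atom A P.Rel}
    (h : ∀ y ∈ φ.vars, θ y = θ' y) (hφ : P.Sat w θ I φ) : P.Sat w θ' I φ := by
  cases φ with
  | eqn x α =>
    have h1 := h x (by simp [Atom.vars])
    have h2 : α.subst θ = α.subst θ' :=
      Pattern.subst_congr fun y hy => h y (by simp [Atom.vars, hy])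
    simp only [Sat] at hφ ⊢
    rwa [← h1, ← h2]
  | rel R ys =>
    simp only [Atom.vars] at h
    refine ⟨?_, fun y hy => ?_⟩
    · rw [← List.map_congr_left h]
      exact hφ.1
    · rw [← h y hy]
      exact hφ.2 y hy

variable (P)

/-- The atom is mutually recursive with the head of the rule. -/
def IsRec (ρ : Rule A P.Rel) (φ : Atom A P.Rel) : Prop :=
  ∃ R ys, φ = .rel R ys ∧ P.MutRec ρ.head R

/-- All atoms of the body that are not mutually recursive with the head hold. -/
def Low (w : List A) (ρ : Rule A P.Rel) (θ : ℕ → List A) : Prop :=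
  P.IsWSubst ρ w θ ∧ ∀ φ ∈ ρ.body, ¬ P.IsRec ρ φ → P.Sat w θ (P.fixpoint w) φ

variable {P}

theorem mem_vars {ρ : Rule A P.Rel} {φ : Atom A P.Rel} (hφ : φ ∈ ρ.body) {y : ℕ}
    (hy : y ∈ φ.vars) : y ∈ ρ.vars := List.mem_flatMap.2 ⟨φ, hφ, hy⟩

theorem Low.congr {ρ : Rule A P.Rel} {θ θ' : ℕ → List A} (h : ∀ y ∈ P.univ :: ρ.vars, θ y = θ' y)
    (hl : P.Low w ρ θ) : P.Low w ρ θ' := by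
  refine ⟨⟨?_, fun x hx => ?_⟩, fun φ hφ hrec => ?_⟩
  · rw [← h _ (by simp)]
    exact hl.1.1
  · rw [← h _ (by simp [hx])]
    exact hl.1.2 x hx
  · exact (hl.2 φ hφ hrec).congr fun y hy => h y (by simp [mem_vars hφ hy])

theorem Low.satEqns {ρ : Rule A P.Rel} {θ : ℕ → List A} (h : P.Low w ρ θ) : P.SatEqns w θ ρ :=
  fun x α hx => h.2 _ hx (by rintro ⟨R, ys, h, -⟩; cases h)

theorem eq_of_length_filterMap_le {α β : Type*} {f : α → Option β} {l : List α}
    (h : (l.filterMap f).length ≤ 1) {a b : α} (ha : a ∈ l) (hb : b ∈ l) (ha' : (f a).isSome)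
    (hb' : (f b).isSome) : a = b := by
  induction l with
  | nil => simp at ha
  | cons c l ih =>
    have key : ∀ x ∈ l, (f x).isSome → 0 < (l.filterMap f).length := fun x hx hx' => by
      obtain ⟨y, hy⟩ := Option.isSome_iff_exists.1 hx'
      exact List.length_pos_of_mem (List.mem_filterMap.2 ⟨x, hx, hy⟩)
    have key2 : (f c).isSome → ∀ x ∈ l, ¬ (f x).isSome := fun hc x hx hx' => by
      obtain ⟨y, hy⟩ := Option.isSome_iff_exists.1 hc
      have := key x hx hx'
      rw [List.filterMap_cons, hy, List.length_cons] at h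
      lia
    rcases List.mem_cons.1 ha with rfl | hal
    · rcases List.mem_cons.1 hb with rfl | hbl
      · rfl
      · exact absurd hb' (key2 ha' b hbl)
    · rcases List.mem_cons.1 hb with rfl | hbl
      · exact absurd ha' (key2 hb' a hal)
      · refine ih (le_trans ?_ h) hal hbl
        rw [List.filterMap_cons]
        split <;> simp

theorem IsLinear.eq_of_isRec (hP : P.IsLinear) {ρ : Rule A P.Rel} (hρ : ρ ∈ P.rules)
    {φ ψ : Atom A P.Rel} (hφ : φ ∈ ρ.body) (hψ : ψ ∈ ρ.body) (h : P.IsRec ρ φ)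
    (h' : P.IsRec ρ ψ) : φ = ψ := by
  classical
  refine eq_of_length_filterMap_le (hP ρ hρ) hφ hψ ?_ ?_
  · obtain ⟨R, ys, rfl, hm⟩ := h
    simp [hm]
  · obtain ⟨R, ys, rfl, hm⟩ := h'
    simp [hm]

theorem IsLinear.bottom_eq (hP : P.IsLinear) {ρ : Rule A P.Rel} (hρ : ρ ∈ P.rules) {R : P.Rel}
    {ys : List ℕ} (h : Atom.rel R ys ∈ ρ.body) (hm : P.MutRec ρ.head R) : P.bottom ρ = ys := by
  have h1 : ys ∈ P.recArgs ρ := P.mem_recArgs.2 ⟨R, h, hm⟩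
  have h2 := hP ρ hρ
  obtain ⟨zs, hzs⟩ := List.length_eq_one_iff.1 (le_antisymm h2 (List.length_pos_of_mem h1))
  rw [hzs, List.mem_singleton] at h1
  rw [bottom, hzs, h1]
  simp

variable (P)

/-- A relation symbol and a tuple of words, as a tuple of words of fixed length. -/
noncomputable def enc (a : ℕ) (w : List A) (R : P.Rel) (t : List (List A)) :
    P.Rel ⊕ Fin a → List A :=
  open Classical in Sum.elim (fun R' => if R' = R then w else []) fun i => t[i.val]?.getD []

variable {P} {a : ℕ}

/-- The symbol is marked by `w` among empty words, which needs `w ≠ []`; the padding of the tuple is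
harmless because the arity fixes the length. -/
theorem enc_inj (hw : w ≠ []) {R R' : P.Rel} {t t' : List (List A)} (ht : t.length = P.ar R)
    (ht' : t'.length = P.ar R') (ha : ∀ R, P.ar R ≤ a) (h : P.enc a w R t = P.enc a w R' t') :
    R = R' ∧ t = t' := by
  classical
  have h1 : R = R' := by
    by_contra hne
    have := congrFun h (.inl R)
    simp [enc, hne] at this
    exact hw this
  subst h1
  refine ⟨rfl, List.ext_getElem (ht.trans ht'.symm) fun i hi hi' => ?_⟩
  have := congrFun h (.inr ⟨i, by have := ha R; lia⟩)
  simpa [enc, hi, hi'] using this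

theorem enc_infix {R : P.Rel} {t : List (List A)} (ht : ∀ x ∈ t, x <:+: w) (i : P.Rel ⊕ Fin a) :
    P.enc a w R t i <:+: w := by
  classical
  rcases i with R' | i
  · by_cases hR : R' = R
    · simp [enc, hR]
    · simp [enc, hR]
  · cases h : t[i.val]? with
    | none => simp [enc, h]
    | some x =>
      simp only [enc, Sum.elim_inr, h, Option.getD_some]
      exact ht x (List.mem_of_getElem? h)

/-- One step of the evaluation, for the relation symbols in `C`. -/
def StepOf (P : Program A) (a : ℕ) (C : Set P.Rel) (w : List A)
    (x : (P.Rel ⊕ Fin a) ⊕ (P.Rel ⊕ Fin a) → List A) : Prop :=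
  ∃ ρ : P.rules, ρ.1.head ∈ C ∧ ∃ R : P.Rel, ∃ ys : {ys // Atom.rel R ys ∈ ρ.1.body},
    P.MutRec ρ.1.head R ∧ ∃ θ, P.Low w ρ θ ∧
      x ∘ Sum.inl = P.enc a w ρ.1.head (ρ.1.headVars.map θ) ∧
      x ∘ Sum.inr = P.enc a w R (ys.1.map θ)

/-- The end of the evaluation, for the relation symbols in `C`. -/
def EndOf (P : Program A) (a : ℕ) (C : Set P.Rel) (w : List A) (x : P.Rel ⊕ Fin a → List A) :
    Prop :=
  ∃ ρ : P.rules, (ρ.1.head ∈ C ∧ ∀ φ ∈ ρ.1.body, ¬ P.IsRec ρ φ) ∧ ∃ θ, P.Low w ρ θ ∧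
    x = P.enc a w ρ.1.head (ρ.1.headVars.map θ)

/-- The encoded fact fixes the head symbol and the top tuple. Global determinism then fixes the
rule, linearity its recursive atom, and local determinism the values of that atom. -/
theorem StepOf.unique (h1 : P.IsLinear) (h2 : P.IsLocallyDet) (h3 : P.IsGloballyDet)
    (ha : ∀ R, P.ar R ≤ a) {C : Set P.Rel} (hw : w ≠ []) {y z z' : P.Rel ⊕ Fin a → List A}
    (h : StepOf P a C w (Sum.elim y z)) (h' : StepOf P a C w (Sum.elim y z')) : z = z' := by
  obtain ⟨⟨ρ, hρ⟩, -, R, ⟨ys, hys⟩, hm, θ, hθ, hy, hz⟩ := h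
  obtain ⟨⟨χ, hχ⟩, -, R', ⟨ys', hys'⟩, hm', θ', hθ', hy', hz'⟩ := h'
  simp only [Sum.elim_comp_inl, Sum.elim_comp_inr] at hy hz hy' hz'
  obtain ⟨h4, h5⟩ := enc_inj hw (by simpa using P.length_headVars ρ hρ)
    (by simpa using P.length_headVars χ hχ) ha (hy.symm.trans hy')
  have h6 : (P.top ρ).map θ = (P.top χ).map θ' := by
    simp [top, h5, hθ.1.1, hθ'.1.1]
  have h7 : ρ = χ := by
    by_contra hne
    exact h3 w ρ hρ χ hχ h4 hne ⟨_, _, _, ⟨θ, hθ.1, hθ.satEqns, rfl, rfl⟩,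
      ⟨θ', hθ'.1, hθ'.satEqns, h6, rfl⟩⟩
  subst h7
  have h8 := h1.eq_of_isRec hρ hys hys' ⟨_, _, rfl, hm⟩ ⟨_, _, rfl, hm'⟩
  simp only [Atom.rel.injEq] at h8
  obtain ⟨rfl, rfl⟩ := h8
  have h9 := h2 w ρ hρ _ _ _ ⟨θ, hθ.1, hθ.satEqns, rfl, rfl⟩ ⟨θ', hθ'.1, hθ'.satEqns, h6, rfl⟩
  rw [h1.bottom_eq hρ hys hm] at h9
  rw [hz, hz', h9]

/-- The relation symbols that are equal to `R` or mutually recursive with it. -/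
def component (P : Program A) (R : P.Rel) : Set P.Rel := {R' | R' = R ∨ P.MutRec R R'}

theorem component_of_mutRec {R R' R'' : P.Rel} (h : R' ∈ P.component R) (h' : P.MutRec R' R'') :
    R'' ∈ P.component R := by
  rcases h with rfl | h
  · exact Or.inr h'
  · exact Or.inr ⟨h.1.trans h'.1, h'.2.trans h.2⟩

/-- Backwards along the walk: the last fact follows from a rule without recursive atom, and each
earlier one from its successor and atoms of lower classes. -/
theorem mem_fixpoint_of_reach (h1 : P.IsLinear) (ha : ∀ R, P.ar R ≤ a) {C : Set P.Rel}
    (hw : w ≠ []) {x y : P.Rel ⊕ Fin a → List A}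
    (hxy : ReflTransGen (fun b c => (∀ i, c i <:+: w) ∧ StepOf P a C w (Sum.elim b c)) x y)
    (hy : EndOf P a C w y) {R : P.Rel} {t : List (List A)} (ht : t.length = P.ar R)
    (hx : x = P.enc a w R t) : t ∈ P.fixpoint w R := by
  induction hxy using ReflTransGen.head_induction_on generalizing R t with
  | refl =>
    obtain ⟨⟨ρ, hρ⟩, ⟨-, hrec⟩, θ, hθ, hy⟩ := hy
    obtain ⟨rfl, rfl⟩ := enc_inj hw ht (by simpa using P.length_headVars ρ hρ) ha
      (hx.symm.trans hy)
    exact P.mem_fixpoint_of_rule hρ hθ.1 fun φ hφ => hθ.2 φ hφ (hrec φ hφ)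
  | head hbc _ ih =>
    obtain ⟨-, ⟨ρ, hρ⟩, -, R', ⟨ys, hys⟩, hm, θ, hθ, hy, hz⟩ := hbc
    simp only [Sum.elim_comp_inl, Sum.elim_comp_inr] at hy hz
    obtain ⟨rfl, rfl⟩ := enc_inj hw ht (by simpa using P.length_headVars ρ hρ) ha
      (hx.symm.trans hy)
    have h2 := ih (by simpa using P.length_rel ρ hρ R' ys hys) hz
    refine P.mem_fixpoint_of_rule hρ hθ.1 fun φ hφ => ?_
    by_cases hrec : P.IsRec ρ φ
    · obtain rfl := h1.eq_of_isRec hρ hφ hys hrec ⟨_, _, rfl, hm⟩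
      exact ⟨h2, fun y hy => hθ.1.2 y (mem_vars hφ hy)⟩
    · exact hθ.2 φ hφ hrec

/-- Induction on the derivation: a recursive body atom gives the next fact of the walk, and a rule
without one ends it. -/
theorem exists_reach_of_mem_fixpoint (R₀ : P.Rel) {R : P.Rel} {t : List (List A)}
    (ht : t ∈ P.fixpoint w R) (hR : R ∈ P.component R₀) :
    ∃ y, ReflTransGen (fun b c => (∀ i, c i <:+: w) ∧
      StepOf P a (P.component R₀) w (Sum.elim b c)) (P.enc a w R t) y ∧
      EndOf P a (P.component R₀) w y := by
  refine P.fixpoint_induction (Q := fun R t => R ∈ P.component R₀ → ∃ y,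
    ReflTransGen (fun b c => (∀ i, c i <:+: w) ∧ StepOf P a (P.component R₀) w (Sum.elim b c))
      (P.enc a w R t) y ∧ EndOf P a (P.component R₀) w y) (fun ρ hρ θ hθ hb hC => ?_) ht hR
  have hlow : P.Low w ρ θ := ⟨hθ, fun φ hφ _ => (hb φ hφ).mono fun _ _ ht => ht.1⟩
  by_cases hrec : ∃ φ ∈ ρ.body, P.IsRec ρ φ
  · obtain ⟨_, hφ, R', ys, rfl, hm⟩ := hrec
    obtain ⟨⟨-, h1⟩, h2⟩ := hb _ hφ
    obtain ⟨y, h3, h4⟩ := h1 (component_of_mutRec hC hm)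
    refine ⟨y, ReflTransGen.head ⟨enc_infix ?_, ⟨ρ, hρ⟩, hC, R', ⟨ys, hφ⟩, hm, θ, hlow, rfl, rfl⟩
      h3, h4⟩
    intro x hx
    obtain ⟨y, hy, rfl⟩ := List.mem_map.1 hx
    exact h2 y hy
  · push Not at hrec
    exact ⟨_, ReflTransGen.refl, ⟨ρ, hρ⟩, ⟨hC, hrec⟩, θ, hlow, rfl⟩

-- Deciding the relations, class by class of mutually recursive symbols.

/-- Membership in a relation is decided by programs. -/
def Decidable (P : Program A) (R : P.Rel) : Prop :=
  LW (I := ℕ) fun w x => (List.range (P.ar R)).map x ∈ P.fixpoint w R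

variable {I : Type}

theorem lw_enc [Finite A] (R : P.Rel) (ys : List ℕ) (e : P.Rel ⊕ Fin a → I) (f : ℕ → I) :
    LW fun (w : List A) x => x ∘ e = P.enc a w R (ys.map (x ∘ f)) := by
  classical
  have := P.finite_rel
  have h : ∀ j, LW fun (w : List A) x => x (e j) = P.enc a w R (ys.map (x ∘ f)) j := by
    rintro (R' | i)
    · by_cases hR : R' = R
      · simpa [enc, hR] using LW.full _
      · simpa [enc, hR] using LW.nil _
    · cases hy : ys[i.val]? with
      | none => simpa [enc, hy] using LW.nil _
      | some y => simpa [enc, hy] using LW.eq _ _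
  exact (LW.forall_finite h).congr fun w _ x _ => funext_iff.symm

theorem lw_low [Finite A] {ρ : Rule A P.Rel} (hρ : ρ ∈ P.rules)
    (h : ∀ R ys, Atom.rel R ys ∈ ρ.body → ¬ P.MutRec ρ.head R → P.Decidable R) (f : ℕ → I) :
    LW fun (w : List A) x => P.Low w ρ (x ∘ f) := by
  have : Finite {φ // φ ∈ ρ.body} := List.finite_toSet ρ.body
  have h1 : ∀ φ : {φ // φ ∈ ρ.body}, LW fun (w : List A) x =>
      ¬ P.IsRec ρ φ.1 → P.Sat w (x ∘ f) (P.fixpoint w) φ.1 := by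
    rintro ⟨φ, hφ⟩
    by_cases hrec : P.IsRec ρ φ
    · exact (LW.const True).congr fun w _ x _ => by simp [hrec]
    · cases φ with
      | eqn x α =>
        refine (LW.pattern α (f x) f).congr fun w _ z hz => ?_
        simp only [hrec, not_false_eq_true, forall_const, Sat]
        constructor
        · intro hx
          exact ⟨hx, hz _, by have := hz (f x); rw [hx] at this; exact this⟩
        · exact fun hx => hx.1
      | rel R ys =>
        have hR := h R ys hφ fun hm => hrec ⟨R, ys, rfl, hm⟩
        -- The default `0` is never used: only indices below the arity, which is the length of `ys`,
        -- enter the tuple.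
        refine (LW.reindex hR fun i => f (ys.getD i 0)).congr fun w _ z hz => ?_
        have e : (List.range (P.ar R)).map (z ∘ fun i => f (ys.getD i 0)) = ys.map (z ∘ f) := by
          have hl := P.length_rel ρ hρ R ys hφ
          refine List.ext_getElem (by simp [hl]) fun i hi hi' => ?_
          simp only [List.length_map] at hi'
          simp [hi']
        simp only [hrec, not_false_eq_true, forall_const, Sat, e]
        exact ⟨fun hx => ⟨hx, fun y _ => hz _⟩, fun hx => hx.1⟩
  refine ((LW.full (f P.univ)).and (LW.forall_finite h1)).congr fun w _ x hx => ?_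
  constructor
  · rintro ⟨h2, h3⟩
    exact ⟨⟨h2, fun y _ => hx _⟩, fun φ hφ => h3 ⟨φ, hφ⟩⟩
  · rintro ⟨h2, h3⟩
    exact ⟨h2.1, fun φ => h3 φ.1 φ.2⟩

/-- The substitutions range over arbitrary words on variables outside the rule; sending those
variables to the empty word makes all values factors of `w`. -/
theorem lw_ex_rule {ρ : Rule A P.Rel} {φ : List A → (I ⊕ ℕ → List A) → Prop} (h : LW φ)
    (hlow : ∀ w x θ, φ w (Sum.elim x θ) → P.Low w ρ θ)
    (hφ : ∀ w x θ θ', (∀ y ∈ P.univ :: ρ.vars, θ y = θ' y) → φ w (Sum.elim x θ) →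
      φ w (Sum.elim x θ')) :
    LW fun w x => ∃ θ : ℕ → List A, φ w (Sum.elim x θ) := by
  classical
  obtain ⟨N, hN⟩ : ∃ N, ∀ y ∈ P.univ :: ρ.vars, y ≤ N := by
    obtain ⟨N, hN⟩ := (List.finite_toSet (P.univ :: ρ.vars)).bddAbove
    exact ⟨N, fun y hy => hN hy⟩
  refine (h.ex_nat N fun w x θ θ' hy => hφ w x θ θ' fun y h' => hy y (hN y h')).congr
    fun w _ x _ => ⟨fun ⟨θ, _, h⟩ => ⟨θ, h⟩, ?_⟩
  rintro ⟨θ, hθ⟩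
  have hl := (hlow w x θ hθ).1
  refine ⟨fun y => if y ∈ P.univ :: ρ.vars then θ y else [], fun y _ => ?_,
    hφ w x θ _ (fun y hy => by rw [if_pos hy]) hθ⟩
  change (if y ∈ P.univ :: ρ.vars then θ y else []) <:+: w
  by_cases hy : y ∈ P.univ :: ρ.vars
  · rw [if_pos hy]
    rcases List.mem_cons.1 hy with rfl | hy
    · rw [hl.1]
    · exact hl.2 y hy
  · rw [if_neg hy]
    exact List.nil_infix

theorem lw_stepOf [Finite A] {C : Set P.Rel}
    (h : ∀ ρ ∈ P.rules, ρ.head ∈ C → ∀ R ys, Atom.rel R ys ∈ ρ.body → ¬ P.MutRec ρ.head R →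
      P.Decidable R) : LW (StepOf P a C) := by
  have := P.finite_rel
  have : Finite P.rules := P.finite_rules
  refine LW.exists_finite fun ρ => LW.and_const fun hC => LW.exists_finite fun R => ?_
  have : Finite {ys // Atom.rel R ys ∈ ρ.1.body} := by
    have : Finite {φ // φ ∈ ρ.1.body} := List.finite_toSet ρ.1.body
    refine Finite.of_injective (β := {φ // φ ∈ ρ.1.body}) (fun ys => ⟨_, ys.2⟩) fun x y h => ?_
    simpa [Subtype.ext_iff] using h
  refine LW.exists_finite fun ys => LW.and_const fun _ => ?_
  refine lw_ex_rule (φ := fun w z => P.Low w ρ (z ∘ Sum.inr) ∧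
    (z ∘ fun j => Sum.inl (Sum.inl j)) =
      P.enc a w ρ.1.head (ρ.1.headVars.map (z ∘ Sum.inr)) ∧
    (z ∘ fun j => Sum.inl (Sum.inr j)) = P.enc a w R (ys.1.map (z ∘ Sum.inr)))
    ((lw_low ρ.2 (h ρ.1 ρ.2 hC) _).and ((lw_enc _ _ _ _).and (lw_enc _ _ _ _)))
    (fun w x θ hθ => hθ.1) ?_
  rintro w x θ θ' hy ⟨h1, h2, h3⟩
  simp only [Sum.elim_comp_inr] at h1 h2 h3 ⊢
  refine ⟨h1.congr hy, ?_, ?_⟩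
  · rw [← List.map_congr_left (f := θ) fun y hy' => hy y
      (List.mem_cons_of_mem _ (P.headVars_subset ρ ρ.2 y hy'))]
    exact h2
  · have h4 : ∀ y ∈ ys.1, θ y = θ' y := fun y hy' =>
      hy y (List.mem_cons_of_mem _ (mem_vars ys.2 hy'))
    rw [← List.map_congr_left h4]
    exact h3

theorem lw_endOf [Finite A] {C : Set P.Rel}
    (h : ∀ ρ ∈ P.rules, ρ.head ∈ C → ∀ R ys, Atom.rel R ys ∈ ρ.body → ¬ P.MutRec ρ.head R →
      P.Decidable R) : LW (EndOf P a C) := by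
  have : Finite P.rules := P.finite_rules
  refine LW.exists_finite fun ρ => LW.and_const fun hC => ?_
  refine lw_ex_rule (φ := fun w z => P.Low w ρ (z ∘ Sum.inr) ∧
    (z ∘ Sum.inl) = P.enc a w ρ.1.head (ρ.1.headVars.map (z ∘ Sum.inr)))
    ((lw_low ρ.2 (h ρ.1 ρ.2 hC.1) _).and (lw_enc _ _ _ _))
    (fun w x θ hθ => hθ.1) ?_
  rintro w x θ θ' hy ⟨h1, h2⟩
  simp only [Sum.elim_comp_inr] at h1 h2 ⊢
  refine ⟨h1.congr hy, ?_⟩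
  rw [← List.map_congr_left (f := θ) fun y hy' => hy y
    (List.mem_cons_of_mem _ (P.headVars_subset ρ ρ.2 y hy'))]
  exact h2

theorem decidable_of_lower [Finite A] (h1 : P.IsLinear) (h2 : P.IsLocallyDet)
    (h3 : P.IsGloballyDet) (R : P.Rel)
    (h : ∀ R', TransGen P.Uses R R' → ¬ TransGen P.Uses R' R → P.Decidable R') :
    P.Decidable R := by
  have := P.finite_rel
  obtain ⟨a, ha⟩ : ∃ a, ∀ R, P.ar R ≤ a := by
    obtain ⟨a, ha⟩ := (Set.finite_range P.ar).bddAbove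
    exact ⟨a, fun R => ha ⟨R, rfl⟩⟩
  -- A body symbol that is not mutually recursive with its head lies strictly below the class of
  -- `R`.
  have hlow : ∀ ρ ∈ P.rules, ρ.head ∈ P.component R → ∀ R' ys, Atom.rel R' ys ∈ ρ.body →
      ¬ P.MutRec ρ.head R' → P.Decidable R' := by
    intro ρ hρ hC R' ys hys hm
    have hu : P.Uses ρ.head R' := ⟨ρ, hρ, rfl, ys, hys⟩
    rcases hC with hC | hC
    · exact h R' (hC ▸ .single hu) fun h' => hm ⟨.single hu, hC ▸ h'⟩
    · exact h R' (hC.1.tail hu) fun h' => hm ⟨.single hu, h'.trans hC.1⟩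
  have hr := LW.reach (lw_stepOf (a := a) hlow) (lw_endOf (a := a) hlow)
    fun w hw y z z' hz hz' => StepOf.unique h1 h2 h3 ha hw hz hz'
  have he := LW.ex (I := ℕ) (J := P.Rel ⊕ Fin a)
    ((lw_enc (A := A) (a := a) R (List.range (P.ar R)) Sum.inr Sum.inl).and
      (LW.reindex hr (J := ℕ ⊕ (P.Rel ⊕ Fin a)) Sum.inr))
  refine he.congr fun w hw x hx => ?_
  simp only [Sum.elim_comp_inl, Sum.elim_comp_inr]
  constructor
  · rintro ⟨u, -, rfl, y, hxy, hy⟩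
    exact mem_fixpoint_of_reach h1 ha hw hxy hy (by simp) rfl
  · intro ht
    refine ⟨_, enc_infix ?_, rfl, exists_reach_of_mem_fixpoint R ht (Or.inl rfl)⟩
    intro y hy
    obtain ⟨i, -, rfl⟩ := List.mem_map.1 hy
    exact hx i

/-- Being strictly below is transitive and irreflexive on a finite set of symbols, hence well
founded. -/
theorem decidable [Finite A] (h1 : P.IsLinear) (h2 : P.IsLocallyDet) (h3 : P.IsGloballyDet)
    (R : P.Rel) : P.Decidable R := by
  have := P.finite_rel
  let lower : P.Rel → P.Rel → Prop := fun R' R =>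
    TransGen P.Uses R R' ∧ ¬ TransGen P.Uses R' R
  have : IsTrans P.Rel lower := ⟨fun a b c hab hbc =>
    ⟨hbc.1.trans hab.1, fun h => hab.2 (h.trans hbc.1)⟩⟩
  have : Std.Irrefl lower := ⟨fun a h => h.2 h.1⟩
  induction R using (Finite.wellFounded_of_trans_of_irrefl lower).induction with
  | _ R ih => exact decidable_of_lower h1 h2 h3 R fun R' h h' => ih R' ⟨h, h'⟩

theorem language_mem_logspace [Finite A] (h1 : P.IsLinear) (h2 : P.IsLocallyDet)
    (h3 : P.IsGloballyDet) (hb : P.IsBoolean) : P.language ∈ LogSpace.LOGSPACE A := by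
  classical
  obtain ⟨c, hc⟩ := decidable h1 h2 h3 P.ans 1 (fun _ => 0) fun _ => Nat.one_pos
  -- The registers start at zero, so the first increment of the input head fails exactly on the
  -- empty word, whose answer is built in.
  let prog : FCmd A := .inc none c (.assign fun _ => decide ([] ∈ P.language))
  obtain ⟨N, tab, start, htab⟩ := prog.exists_table id false
  refine RegMachine.mem_logspace tab start _ fun w => ?_
  by_cases hw : w = []
  · subst hw
    exact htab _ _ _ _ _ (.inc_ge (Or.inr rfl) le_rfl (.assign _)) (by simp)
  · obtain ⟨b, v, h4, h5, -⟩ := hc w hw false (Function.update (fun _ => 0) none 1)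
      (fun i => by
        have := List.length_pos_of_ne_nil hw
        by_cases hi : i = none <;> simp [hi]
        lia) (fun _ => 0) (fun _ => by simp)
    refine htab _ _ _ _ _ (.inc_lt (List.length_pos_of_ne_nil hw) h4) (h5.trans ?_)
    have hb' : P.ar P.ans = 0 := hb
    simp only [hb', List.range_zero, List.map_nil]
    exact Iff.rfl

end FCDatalog.Program

/-- DOLLA FC-Datalog captures deterministic logarithmic space. -/
theorem mainTheorem6 {A : Type*} [Finite A] :
    FCDatalog.Captures (FCDatalog.DOLLA A) (LogSpace.LOGSPACE A) := by
  refine Set.Subset.antisymm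
    (fun L hL => RegMachine.OfMachine.exists_dolla_of_mem_logspace hL) ?_
  rintro L ⟨P, ⟨⟨h1, -⟩, h2, h3⟩, hb, rfl⟩
  exact FCDatalog.Program.language_mem_logspace h1 h2 h3 hb
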